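/- Work in the word RAM model: a program is fixed once and for all, memory cells and registers hold words of $w$ bits, and the unit-time operations are memory access, comparison, addition, subtraction, bit shifts by an arbitrary number of positions, bitwise Boolean operations, and $x\mapsto\lfloor\log_2 x\rfloor$; there is no multiplication or division. Let $G=(N,A)$ be a simple, loopless, strongly connected directed graph with $n=|N|\ge 2$ nodes and $m=|A|$ arcs, and let $c\in\mathbb{Q}_{++}^A$ be positive rational arc costs. For a potential $\pi\in\mathbb{Q}^N$, let $c^\pi(u,v)=c(u,v)+\pi(u)-\pi(v)$ denote the reduced cost. For $\xi\ge 1$, a cost function $c'$ on the arcs of a strongly connected graph is called $\xi$-min-balanced if $c'\ge 0$ and every arc $e\in A$ lies on a directed cycle $C\subseteq A$ such that $c'(f)\le \xi\, c'(e)$ for all $f\in C$. Then, in time $O(m\log^2 n)$, one can find a potential $\pi\in\mathbb{Q}^N$ such that $c^\pi$ is $7n^2$-min-balanced. Precisely: there are a word RAM program and absolute constants $K,\kappa\in\mathbb{N}$ such that the following holds. For every such $G$ and $c$, given as a list of the arcs with cost numerators $z(e)\in\mathbb{Z}_{++}$ and a common denominator $d\in\mathbb{Z}_{++}$, $c(e)=z(e)/d$,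 and for every word length $w$ with $n^\kappa d\le 2^w$ and $n^\kappa z(e)\le 2^w$ for all $e\in A$, the program halts after at most $K\, m\,(\log_2 n)^2$ steps, and outputs nonnegative integer numerators and a positive integer common denominator, each a single word, of a potential $\pi\in\mathbb{Q}^N$ such that $c^\pi$ is $7n^2$-min-balanced. -/

import Mathlib

/-! ## Directed graphs with arc costs -/

/-- A simple loopless directed graph with node set `N` and arc set `A`: every arc `e` goes from
`src e` to `tgt e`, there are no loops, and no two arcs have the same tail and head. -/
structure ArcDigraph (N A : Type*) where
  /-- the tail of an arc -/
  src : A → N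
  /-- the head of an arc -/
  tgt : A → N
  loopless : ∀ e, src e ≠ tgt e
  simple : ∀ e f, src e = src f → tgt e = tgt f → e = f

namespace ArcDigraph

variable {N A : Type*}

/-- There is a directed path (possibly of length zero) between any two nodes, in both
directions. -/
def StronglyConnected (G : ArcDigraph N A) : Prop :=
  ∀ u v : N, Relation.ReflTransGen (fun x y => ∃ e, G.src e = x ∧ G.tgt e = y) u v

/-- The list `C` of arcs, in the order of traversal, is a directed cycle: it is non-empty, every
arc ends where the next one starts, the last arc ends where the first one starts, and no node is
visited twice. -/
def IsDirectedCycle (G : ArcDigraph N A) (C : List A) : Prop :=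
  C.IsChain (fun e f => G.tgt e = G.src f) ∧
  (∃ h : C ≠ [], G.tgt (C.getLast h) = G.src (C.head h)) ∧
  (C.map G.src).Nodup

/-- The reduced cost `c^π(u,v) = c(u,v) + π(u) - π(v)`. -/
def reducedCost (G : ArcDigraph N A) (c : A → ℚ) (π : N → ℚ) (e : A) : ℚ :=
  c e + π (G.src e) - π (G.tgt e)

/-- `(G, c)` is `ξ`-min-balanced: `G` is strongly connected, `ξ ≥ 1`, the costs are nonnegative, and
every arc `e` lies on a directed cycle all of whose arcs cost at most `ξ * c e`. -/
def IsMinBalanced (G : ArcDigraph N A) (ξ : ℚ) (c : A → ℚ) : Prop :=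
  G.StronglyConnected ∧ 1 ≤ ξ ∧ (∀ e, 0 ≤ c e) ∧
  ∀ e, ∃ C : List A, G.IsDirectedCycle C ∧ e ∈ C ∧ ∀ f ∈ C, c f ≤ ξ * c e

end ArcDigraph

/-! ## The word RAM

Words have `w` bits. The machine has registers and a random access memory that is addressed by
words. A program is a structured program whose text depends neither on `w` nor on the input.
Every elementary instruction and every evaluation of a test takes one unit of time. There is no
multiplication and no division. -/

namespace WordRAM

/-- The state of a word RAM with word length `w`. -/
structure State (w : ℕ) where
  /-- the registers -/
  reg : ℕ → BitVec w
  /-- the memory -/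
  mem : BitVec w → BitVec w

/-- An operand: the content of a register, or a constant. -/
inductive Operand where
  | reg (r : ℕ)
  | const (k : ℕ)

/-- The value of an operand. -/
def Operand.eval {w : ℕ} (s : State w) : Operand → BitVec w
  | .reg r => s.reg r
  | .const k => BitVec.ofNat w k

/-- The unary unit-time operations: copy, bitwise negation, and position `⌊log₂ x⌋` of the most
significant bit. -/
inductive UnOp where
  | copy
  | not
  | msb

/-- The value of a unary operation (the most significant bit operation returns `0` at `0`). -/
def UnOp.eval {w : ℕ} : UnOp → BitVec w → BitVec w
  | .copy, x => x
  | .not, x => ~~~x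
  | .msb, x => BitVec.ofNat w (Nat.log 2 x.toNat)

/-- The binary unit-time operations: addition and subtraction (modulo `2 ^ w`), shifts by an
arbitrary number of positions, and bitwise Boolean operations. -/
inductive BinOp where
  | add
  | sub
  | shl
  | shr
  | and
  | or
  | xor

/-- The value of a binary operation. -/
def BinOp.eval {w : ℕ} : BinOp → BitVec w → BitVec w → BitVec w
  | .add, x, y => x + y
  | .sub, x, y => x - y
  | .shl, x, y => x <<< y.toNat
  | .shr, x, y => x >>> y.toNat
  | .and, x, y => x &&& y
  | .or, x, y => x ||| y
  | .xor, x, y => x ^^^ y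

/-- Comparisons of words (as unsigned integers). -/
inductive Test where
  | eq (x y : Operand)
  | ne (x y : Operand)
  | lt (x y : Operand)
  | le (x y : Operand)

/-- The truth value of a test. -/
def Test.Holds {w : ℕ} (s : State w) : Test → Prop
  | .eq x y => x.eval s = y.eval s
  | .ne x y => x.eval s ≠ y.eval s
  | .lt x y => (x.eval s).toNat < (y.eval s).toNat
  | .le x y => (x.eval s).toNat ≤ (y.eval s).toNat

/-- Programs: `r := o x`, `r := x o y`, `r := mem[a]`, `mem[a] := x`, sequencing, conditionals and
while loops. -/
inductive Program where
  | skip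
  | unary (r : ℕ) (o : UnOp) (x : Operand)
  | binary (r : ℕ) (o : BinOp) (x y : Operand)
  | load (r : ℕ) (a : Operand)
  | store (a x : Operand)
  | seq (p q : Program)
  | branch (b : Test) (p q : Program)
  | loop (b : Test) (p : Program)

/-- Overwrite a register. -/
def State.setReg {w : ℕ} (s : State w) (r : ℕ) (x : BitVec w) : State w :=
  { s with reg := Function.update s.reg r x }

/-- Overwrite a memory cell. -/
def State.setMem {w : ℕ} (s : State w) (a x : BitVec w) : State w :=
  { s with mem := Function.update s.mem a x }

/-- `Runs p s s' t`: started in the state `s`, the program `p` halts in the state `s'` after exactly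
`t` units of time. -/
inductive Runs {w : ℕ} : Program → State w → State w → ℕ → Prop where
  | skip (s : State w) : Runs .skip s s 1
  | unary (s : State w) (r : ℕ) (o : UnOp) (x : Operand) :
      Runs (.unary r o x) s (s.setReg r (o.eval (x.eval s))) 1
  | binary (s : State w) (r : ℕ) (o : BinOp) (x y : Operand) :
      Runs (.binary r o x y) s (s.setReg r (o.eval (x.eval s) (y.eval s))) 1
  | load (s : State w) (r : ℕ) (a : Operand) :
      Runs (.load r a) s (s.setReg r (s.mem (a.eval s))) 1
  | store (s : State w) (a x : Operand) :
      Runs (.store a x) s (s.setMem (a.eval s) (x.eval s)) 1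
  | seq {p q : Program} {s s' s'' : State w} {t t' : ℕ} :
      Runs p s s' t → Runs q s' s'' t' → Runs (.seq p q) s s'' (t + t')
  | branch_true {b : Test} {p q : Program} {s s' : State w} {t : ℕ} :
      b.Holds s → Runs p s s' t → Runs (.branch b p q) s s' (1 + t)
  | branch_false {b : Test} {p q : Program} {s s' : State w} {t : ℕ} :
      ¬ b.Holds s → Runs q s s' t → Runs (.branch b p q) s s' (1 + t)
  | loop_false {b : Test} {p : Program} {s : State w} :
      ¬ b.Holds s → Runs (.loop b p) s s 1
  | loop_true {b : Test} {p : Program} {s s' s'' : State w} {t t' : ℕ} :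
      b.Holds s → Runs p s s' t → Runs (.loop b p) s' s'' t' →
      Runs (.loop b p) s s'' (1 + t + t')

/-! ## Input and output -/

/-- The initial state for the digraph `G` with nodes `0, …, n-1` and arcs `0, …, m-1`, in which arc
`i` has cost `z i / d`: registers `0`, `1`, `2` hold `n`, `m`, `d`, the cells `3i`, `3i+1`, `3i+2`
hold the tail, the head and the cost numerator of arc `i`, and everything else is `0`. -/
def inputState (w : ℕ) {n m : ℕ} (G : ArcDigraph (Fin n) (Fin m)) (d : ℕ) (z : Fin m → ℕ) :
    State w where
  reg := fun r =>
    match r with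
    | 0 => BitVec.ofNat w n
    | 1 => BitVec.ofNat w m
    | 2 => BitVec.ofNat w d
    | _ => 0
  mem := fun a =>
    if h : a.toNat / 3 < m then
      match a.toNat % 3 with
      | 0 => BitVec.ofNat w (G.src ⟨a.toNat / 3, h⟩)
      | 1 => BitVec.ofNat w (G.tgt ⟨a.toNat / 3, h⟩)
      | _ => BitVec.ofNat w (z ⟨a.toNat / 3, h⟩)
    else 0

/-- The state `s` holds the potential `π : Fin n → ℚ`, as a positive common denominator in
register `0` and the numerator of `π v` in the cell `v`. -/
def HoldsPotential {w n : ℕ} (s : State w) (π : Fin n → ℚ) : Prop :=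
  0 < (s.reg 0).toNat ∧
  ∀ v : Fin n, π v = ((s.mem (BitVec.ofNat w v)).toNat : ℚ) / ((s.reg 0).toNat : ℚ)

end WordRAM

/-!
# Approximately min-balanced potentials on the word RAM

Let the arcs be sorted by cost, so that arc `i` has cost `C i` and `C` is monotone. For every arc
`i` from `u` to `v` let `l` be the least index such that `v` reaches `u` along arcs of index at
most `l`. Together with arc `i` this yields a cycle whose arcs have index at most `max l i`. Hence
it is enough to find a nonnegative integral potential `φ`, for costs that have been scaled by a
power of two `2 n ≤ 2 ^ k < 4 n`, such that the reduced cost of arc `i` is at least `C (max l i)`: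
the reduced costs on the cycle are nonnegative and sum up to at most `n * 2 ^ k * C (max l i)`,
which bounds each of them by `4 n²` times the reduced cost of arc `i` (`Balances.isMinBalanced`).
For `i < l` the potential has to drop by at least `C l` from `u` to `v`; for `l ≤ i` it suffices
that it does not rise by more than `(n - 1) * C l`.

Such a potential exists because the strong components of the arcs of index below `t` form a
laminar family as `t` grows. Suppose that the components that merge at the index `l` are numbered
such that the arcs of index below `l` lead from larger to smaller numbers. If every component
precedes those with larger numbers, with a gap of its size times `C l`, and if these gaps are
added up over all levels, then arcs of index below `l` drop far enough, while no arc rises too far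
since the sizes of the components sum up to at most `n`.

The family is found by halving the range of `l` for all components at once. A `Hierarchy` of width
`H` is a forest of blocks in which the `l` of each arc is known up to an interval of length `H`. A
round halves the interval (`Hierarchy.condense`): the active arcs, those of index below the middle
of the interval of their ends, are searched for strong components, each component becomes a new
block between its members and their parent, and the ends of the arcs that leave the component move
up to it. The search is path-based and numbers components in reverse topological order, which
gives the required numbering; its invariant is `SearchInv`. All rounds together form `O(m log n)`
blocks. At width `1` the gaps can be written down (`Hierarchy.good_basePotential`), and undoing
the rounds (`Good.condense`) means to add to the potential of each member that of its component. A
log of all pairs of a member and a component suffices for this (`Unrolls`). Each of the `O(log n)`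
rounds takes time `O(m)`; at the end, each of the `O(m log n)` blocks requires one multiplication
of a cost by a number of at most `n`, which takes `O(log n)` additions.

Programs are written in a small language of array programs over the natural numbers with a weakest
precondition calculus whose states carry a clock (`wp`). Its compilation to the word RAM is
faithful as long as no number overflows a word (`runs_of_wp`).
-/


/-! ### A language of array programs and its compilation to the word RAM -/

namespace MinBalance

open WordRAM

/-- The variables of array programs. The first three hold the input, and `n` also the output. -/
inductive Reg where
  | n | m | d | i | j | k | width | iEnd | jEnd | next | p | q | x | y | z | s | e | t | u
  | pw | h | nn | nn0 | sp | bp | dp | ln | acc | fac | mult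
  deriving DecidableEq

/-- The arrays of array programs. -/
inductive Arr where
  | tail | head | cost | adj | link | idx | nodes | bounds | path | parent | level | size
  | logChild | logParent | sum | pot | perm | merged | inTail | inHead | inCost
  deriving DecidableEq

/-- The register of the word RAM that holds a variable. -/
def Reg.code (r : Reg) : ℕ := r.ctorIdx

/-- The position of the cells of an array within each group of 32 cells. -/
def Arr.code (k : Arr) : ℕ := k.ctorIdx

theorem Reg.code_lt (r : Reg) : r.code < 60 := by cases r <;> decide

theorem Arr.code_lt (k : Arr) : k.code < 32 := by cases k <;> decide

theorem Reg.code_injective : Function.Injective Reg.code := by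
  intro a b h
  have := congrArg Reg.ofNat h
  simpa [Reg.code, Reg.ofNat_ctorIdx] using this

theorem Arr.code_injective : Function.Injective Arr.code := by
  intro a b h
  have := congrArg Arr.ofNat h
  simpa [Arr.code, Arr.ofNat_ctorIdx] using this

/-- An operand of an array program: a variable or a constant. -/
inductive Opd where
  | reg (r : Reg)
  | const (c : ℕ)

/-- The state of an array program, in natural numbers: variables, arrays, the input and output cells
of the machine, and a clock that bounds the running time on the word RAM. -/
structure AS where
  v : Reg → ℕ
  a : Arr → ℕ → ℕ
  low : ℕ → ℕ
  tick : ℕ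

/-- The value of an operand. -/
def Opd.val (s : AS) : Opd → ℕ
  | .reg r => s.v r
  | .const c => c

/-- Elementary instructions: assignments `r := x`, `r := x + y`, `r := x - y`, `r := ⌊x / 2⌋`,
array reads and writes, reads and writes of the input and output cells. -/
inductive Instr where
  | mov (r : Reg) (x : Opd)
  | add (r : Reg) (x y : Opd)
  | sub (r : Reg) (x y : Opd)
  | half (r : Reg) (x : Opd)
  | ld (r : Reg) (k : Arr) (x : Opd)
  | st (k : Arr) (x y : Opd)
  | ldl (r : Reg) (x : Opd)
  | stl (x y : Opd)

/-- Comparisons of operands. -/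
inductive Tst where
  | eq (x y : Opd)
  | ne (x y : Opd)
  | lt (x y : Opd)

/-- Array programs. -/
inductive Code where
  | ins (i : Instr)
  | seq (p q : Code)
  | ite (b : Tst) (p q : Code)
  | loop (b : Tst) (p : Code)

/-- The truth value of a comparison. -/
def Tst.holds (s : AS) : Tst → Prop
  | .eq x y => x.val s = y.val s
  | .ne x y => x.val s ≠ y.val s
  | .lt x y => x.val s < y.val s

/-- Overwrite a variable. -/
def AS.set (s : AS) (r : Reg) (x : ℕ) (c : ℕ) : AS :=
  { s with v := Function.update s.v r x, tick := s.tick + c }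

/-- Overwrite a value of a function on the natural numbers. -/
def upd (f : ℕ → ℕ) (i x : ℕ) : ℕ → ℕ := Function.update f i x

@[simp] theorem upd_self (f : ℕ → ℕ) (i x : ℕ) : upd f i x i = x := Function.update_self ..

@[simp] theorem upd_of_ne (f : ℕ → ℕ) {i j : ℕ} (x : ℕ) (h : j ≠ i) : upd f i x j = f j :=
  Function.update_of_ne h ..

/-- Overwrite an array entry. -/
def AS.put (s : AS) (k : Arr) (i x : ℕ) : AS :=
  { s with a := Function.update s.a k (upd (s.a k) i x), tick := s.tick + 4 }

/-- Overwrite an output cell. -/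
def AS.putLow (s : AS) (i x : ℕ) : AS :=
  { s with low := upd s.low i x, tick := s.tick + 1 }

/-- Let one unit of time pass. -/
def AS.wait (s : AS) : AS := { s with tick := s.tick + 1 }

/-- The effect of an elementary instruction. -/
def Instr.post (s : AS) : Instr → AS
  | .mov r x => s.set r (x.val s) 1
  | .add r x y => s.set r (x.val s + y.val s) 1
  | .sub r x y => s.set r (x.val s - y.val s) 1
  | .half r x => s.set r (x.val s / 2) 1
  | .ld r k x => s.set r (s.a k (x.val s)) 4
  | .st k x y => s.put k (x.val s) (y.val s)
  | .ldl r x => s.set r (s.low (x.val s)) 1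
  | .stl x y => s.putLow (x.val s) (y.val s)

/-- The condition under which an elementary instruction neither overflows a word nor leaves the
memory area in which it works: words are smaller than `W`, the cells below `base` are input and
output cells, and arrays have `cap` entries. -/
def Instr.pre (W base cap : ℕ) (s : AS) : Instr → Prop
  | .mov _ _ => True
  | .add _ x y => x.val s + y.val s < W
  | .sub _ x y => y.val s ≤ x.val s
  | .half _ _ => True
  | .ld _ _ x => x.val s < cap
  | .st _ x _ => x.val s < cap
  | .ldl _ x => x.val s < base
  | .stl x _ => x.val s < base

/-- The weakest precondition of an array program, with a loop rule: `I` is an invariant that bounds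
the clock. As every iteration takes time, such a loop terminates. -/
def wp (W base cap : ℕ) : Code → AS → (AS → Prop) → Prop
  | .ins i, s, Q => i.pre W base cap s ∧ Q (i.post s)
  | .seq p q, s, Q => wp W base cap p s fun s' => wp W base cap q s' Q
  | .ite b p q, s, Q =>
      (b.holds s → wp W base cap p s.wait Q) ∧ (¬ b.holds s → wp W base cap q s.wait Q)
  | .loop b p, s, Q => ∃ (I : AS → Prop) (B : ℕ), I s ∧ (∀ s, I s → s.tick ≤ B) ∧
      (∀ s, I s → b.holds s → wp W base cap p s.wait I) ∧ ∀ s, I s → ¬ b.holds s → Q s.wait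

theorem wp_mono {W base cap : ℕ} (c : Code) : ∀ {s : AS} {Q Q' : AS → Prop}, (∀ s, Q s → Q' s) →
    wp W base cap c s Q → wp W base cap c s Q' := by
  induction c with
  | ins i => exact fun h hw => ⟨hw.1, h _ hw.2⟩
  | seq p q hp hq => exact fun h hw => hp (fun s hs => hq h hs) hw
  | ite b p q hp hq => exact fun h hw => ⟨fun hb => hp h (hw.1 hb), fun hb => hq h (hw.2 hb)⟩
  | loop b p hp =>
    rintro s Q Q' h ⟨I, B, h1, h2, h3, h4⟩
    exact ⟨I, B, h1, h2, h3, fun s hs hb => h _ (h4 s hs hb)⟩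

/-- Sequential composition through an intermediate assertion. -/
theorem wp_seq {W base cap : ℕ} {p q : Code} {s : AS} {Q : AS → Prop} (R : AS → Prop)
    (hp : wp W base cap p s R) (hq : ∀ s, R s → wp W base cap q s Q) :
    wp W base cap (.seq p q) s Q := wp_mono p hq hp

/-- The loop rule. -/
theorem wp_loop {W base cap : ℕ} {b : Tst} {p : Code} {s : AS} {Q : AS → Prop}
    (I : AS → Prop) (B : ℕ) (h0 : I s) (hB : ∀ s, I s → s.tick ≤ B)
    (hstep : ∀ s, I s → b.holds s → wp W base cap p s.wait I)
    (hexit : ∀ s, I s → ¬ b.holds s → Q s.wait) : wp W base cap (.loop b p) s Q :=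
  ⟨I, B, h0, hB, hstep, hexit⟩

/-- Operands of the word RAM for operands of array programs. -/
def Opd.compile : Opd → Operand
  | .reg r => .reg r.code
  | .const c => .const c

/-- Tests of the word RAM for comparisons of array programs. -/
def Tst.compile : Tst → Test
  | .eq x y => .eq x.compile y.compile
  | .ne x y => .ne x.compile y.compile
  | .lt x y => .lt x.compile y.compile

/-- Load the address of entry `x` of the array `k` into the auxiliary register `60`. The register
`61` holds the address at which the arrays start. -/
def addrProgram (k : Arr) (x : Opd) : Program :=
  .seq (.binary 60 .shl x.compile (.const 5))
    (.seq (.binary 60 .add (.reg 60) (.const k.code)) (.binary 60 .add (.reg 60) (.reg 61)))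

/-- The word RAM program for an elementary instruction. -/
def Instr.compile : Instr → Program
  | .mov r x => .unary r.code .copy x.compile
  | .add r x y => .binary r.code .add x.compile y.compile
  | .sub r x y => .binary r.code .sub x.compile y.compile
  | .half r x => .binary r.code .shr x.compile (.const 1)
  | .ld r k x => .seq (addrProgram k x) (.load r.code (.reg 60))
  | .st k x y => .seq (addrProgram k x) (.store (.reg 60) y.compile)
  | .ldl r x => .load r.code x.compile
  | .stl x y => .store x.compile y.compile

/-- The word RAM program for an array program. -/
def Code.compile : Code → Program
  | .ins i => i.compile
  | .seq p q => .seq p.compile q.compile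
  | .ite b p q => .branch b.compile p.compile q.compile
  | .loop b p => .loop b.compile p.compile

/-- The constants in an operand are at most 31, so that they fit into a word. -/
def Opd.small : Opd → Bool
  | .reg _ => true
  | .const c => c < 32

/-- All constants in a comparison are small. -/
def Tst.small : Tst → Bool
  | .eq x y | .ne x y | .lt x y => x.small && y.small

/-- All constants in an instruction are small. -/
def Instr.small : Instr → Bool
  | .mov _ x | .half _ x | .ld _ _ x | .ldl _ x => x.small
  | .add _ x y | .sub _ x y | .st _ x y | .stl x y => x.small && y.small

/-- All constants in an array program are small. -/
def Code.small : Code → Bool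
  | .ins i => i.small
  | .seq p q => p.small && q.small
  | .ite b p q => b.small && (p.small && q.small)
  | .loop b p => b.small && p.small

/-- The state `σ` of the word RAM represents the state `s` of an array program. Entry `j` of the
array with code `k` is in the cell `base + 32 j + k`. -/
structure Rep {w : ℕ} (base cap : ℕ) (s : AS) (σ : State w) : Prop where
  reg_eq : ∀ r : Reg, (σ.reg r.code).toNat = s.v r
  base_eq : (σ.reg 61).toNat = base
  low_eq : ∀ i < base, (σ.mem (BitVec.ofNat w i)).toNat = s.low i
  arr_eq : ∀ (k : Arr) (j : ℕ), j < cap →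
    (σ.mem (BitVec.ofNat w (base + 32 * j + k.code))).toNat = s.a k j

section Soundness

variable {w base cap : ℕ}

theorem eval_const (σ : State w) (c : ℕ) : Operand.eval σ (.const c) = BitVec.ofNat w c := rfl

theorem eval_reg (σ : State w) (r : ℕ) : Operand.eval σ (.reg r) = σ.reg r := rfl

theorem Rep.eval {s : AS} {σ : State w} (h : Rep base cap s σ) (hw : 32 ≤ 2 ^ w) {x : Opd}
    (hx : x.small = true) : (x.compile.eval σ).toNat = x.val s := by
  cases x with
  | reg r => exact h.reg_eq r
  | const c =>
    simp only [Opd.small, decide_eq_true_eq] at hx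
    simp only [Opd.compile, Operand.eval, Opd.val, BitVec.toNat_ofNat]
    exact Nat.mod_eq_of_lt (by omega)

theorem Rep.holds {s : AS} {σ : State w} (h : Rep base cap s σ) (hw : 32 ≤ 2 ^ w) {b : Tst}
    (hb : b.small = true) : b.compile.Holds σ ↔ b.holds s := by
  cases b <;> simp only [Tst.small, Bool.and_eq_true] at hb <;>
    simp only [Tst.compile, Test.Holds, Tst.holds, ← h.eval hw hb.1, ← h.eval hw hb.2, ne_eq,
      ← BitVec.toNat_inj]

theorem Rep.setReg {s : AS} {σ : State w} (h : Rep base cap s σ) (r : Reg) {x : BitVec w} {y : ℕ}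
    (hx : x.toNat = y) (c : ℕ) : Rep base cap (s.set r y c) (σ.setReg r.code x) where
  reg_eq r' := by
    by_cases hr : r' = r
    · subst hr; simp [State.setReg, AS.set, hx]
    · have : r'.code ≠ r.code := fun h => hr (Reg.code_injective h)
      simp [State.setReg, AS.set, Function.update_of_ne this, Function.update_of_ne hr, h.reg_eq]
  base_eq := by
    have : 61 ≠ r.code := by have := r.code_lt; omega
    simp [State.setReg, Function.update_of_ne this, h.base_eq]
  low_eq := h.low_eq
  arr_eq := h.arr_eq

theorem Rep.wait {s : AS} {σ : State w} (h : Rep base cap s σ) : Rep base cap s.wait σ :=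
  ⟨h.reg_eq, h.base_eq, h.low_eq, h.arr_eq⟩

theorem ofNat_eq_iff {i j : ℕ} (hi : i < 2 ^ w) (hj : j < 2 ^ w) :
    BitVec.ofNat w i = BitVec.ofNat w j ↔ i = j := by
  rw [← BitVec.toNat_inj, BitVec.toNat_ofNat, BitVec.toNat_ofNat, Nat.mod_eq_of_lt hi,
    Nat.mod_eq_of_lt hj]

theorem eq_ofNat {x : BitVec w} {i : ℕ} (h : x.toNat = i) : x = BitVec.ofNat w i := by
  subst h; simp

theorem Rep.setMem {s : AS} {σ : State w} (h : Rep base cap s σ) (hcap : base + 32 * cap ≤ 2 ^ w)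
    {k : Arr} {j : ℕ} (hj : j < cap) {a x : BitVec w} {y : ℕ}
    (ha : a.toNat = base + 32 * j + k.code) (hx : x.toNat = y) :
    Rep base cap (s.put k j y) (σ.setMem a x) where
  reg_eq := h.reg_eq
  base_eq := h.base_eq
  low_eq i hi := by
    have hk := k.code_lt
    have : BitVec.ofNat w i ≠ a := by
      rw [eq_ofNat ha, Ne, ofNat_eq_iff (by omega) (by omega)]; omega
    simp [State.setMem, AS.put, Function.update_of_ne this, h.low_eq i hi]
  arr_eq k' j' hj' := by
    have hk := k.code_lt
    have hk' := k'.code_lt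
    have key : BitVec.ofNat w (base + 32 * j' + k'.code) = a ↔ k' = k ∧ j' = j := by
      rw [eq_ofNat ha, ofNat_eq_iff (by omega) (by omega)]
      constructor
      · intro h
        exact ⟨Arr.code_injective (by omega), by omega⟩
      · rintro ⟨rfl, rfl⟩; rfl
    by_cases hkk : k' = k
    · subst hkk
      by_cases hjj : j' = j
      · subst hjj
        rw [key.2 ⟨rfl, rfl⟩]; simp [State.setMem, AS.put, hx]
      · have : ¬ _ := fun h => hjj (key.1 h).2
        simp [State.setMem, AS.put, Function.update_of_ne this, h.arr_eq _ _ hj', hjj]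
    · have : ¬ _ := fun h => hkk (key.1 h).1
      simp [State.setMem, AS.put, Function.update_of_ne this, h.arr_eq _ _ hj', hkk]

theorem Rep.setLow {s : AS} {σ : State w} (h : Rep base cap s σ) (hcap : base + 32 * cap ≤ 2 ^ w)
    {i : ℕ} (hi : i < base) {a x : BitVec w} {y : ℕ} (ha : a.toNat = i) (hx : x.toNat = y) :
    Rep base cap (s.putLow i y) (σ.setMem a x) where
  reg_eq := h.reg_eq
  base_eq := h.base_eq
  low_eq i' hi' := by
    by_cases hii : i' = i
    · subst hii
      rw [← eq_ofNat ha]; simp [State.setMem, AS.putLow, hx]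
    · have : BitVec.ofNat w i' ≠ a := by
        rw [eq_ofNat ha, Ne, ofNat_eq_iff (by omega) (by omega)]; exact hii
      simp [State.setMem, AS.putLow, Function.update_of_ne this, h.low_eq _ hi', hii]
  arr_eq k j hj := by
    have hk := k.code_lt
    have : BitVec.ofNat w (base + 32 * j + k.code) ≠ a := by
      rw [eq_ofNat ha, Ne, ofNat_eq_iff (by omega) (by omega)]; omega
    simp [State.setMem, AS.putLow, Function.update_of_ne this, h.arr_eq _ _ hj]

theorem runs_addrProgram {s : AS} {σ : State w} (h : Rep base cap s σ)
    (hcap : base + 32 * cap ≤ 2 ^ w) (hw : 32 ≤ 2 ^ w) {k : Arr} {x : Opd} (hx : x.small = true)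
    (hj : x.val s < cap) :
    ∃ σ', Runs (addrProgram k x) σ σ' 3 ∧ Rep base cap s σ' ∧
      (σ'.reg 60).toNat = base + 32 * x.val s + k.code := by
  have hk := k.code_lt
  have e1 := h.eval hw hx
  refine ⟨_, .seq (t := 1) (t' := 2) (.binary ..) (.seq (t := 1) (t' := 1) (.binary ..)
    (.binary ..)), ⟨fun r => ?_, ?_, h.low_eq, h.arr_eq⟩, ?_⟩
  · have : r.code ≠ 60 := by have := r.code_lt; omega
    simp [State.setReg, Function.update_of_ne this, h.reg_eq]
  · simp [State.setReg, h.base_eq]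
  · have h5 : (5 : ℕ) % 2 ^ w = 5 := Nat.mod_eq_of_lt (by omega)
    have hk5 : k.code % 2 ^ w = k.code := Nat.mod_eq_of_lt (by omega)
    have h32 : x.val s * 32 % 2 ^ w = x.val s * 32 := Nat.mod_eq_of_lt (by omega)
    have hs1 : (x.val s * 32 + k.code) % 2 ^ w = x.val s * 32 + k.code :=
      Nat.mod_eq_of_lt (by omega)
    have hs2 : (x.val s * 32 + k.code + base) % 2 ^ w = x.val s * 32 + k.code + base :=
      Nat.mod_eq_of_lt (by omega)
    have hsh : x.val s <<< 5 = x.val s * 32 := by rw [Nat.shiftLeft_eq]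
    simp only [State.setReg, eval_const, eval_reg, BinOp.eval, Function.update_self,
      BitVec.toNat_add, BitVec.toNat_shiftLeft, BitVec.toNat_ofNat, e1, h5, hk5, hsh, h32, hs1,
      ne_eq, Nat.reduceEqDiff, not_false_eq_true, Function.update_of_ne, h.base_eq, hs2]
    omega

theorem runs_instr {s : AS} {σ : State w} (h : Rep base cap s σ)
    (hcap : base + 32 * cap ≤ 2 ^ w) (hw : 32 ≤ 2 ^ w) {i : Instr} (hi : i.small = true)
    (hpre : i.pre (2 ^ w) base cap s) :
    ∃ σ' t, Runs i.compile σ σ' t ∧ Rep base cap (i.post s) σ' ∧ s.tick + t ≤ (i.post s).tick := by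
  cases i with
  | mov r x =>
    exact ⟨_, 1, .unary .., h.setReg r (h.eval hw hi) 1, le_rfl⟩
  | add r x y =>
    simp only [Instr.small, Bool.and_eq_true] at hi
    refine ⟨_, 1, .binary .., h.setReg r ?_ 1, le_rfl⟩
    simp only [BinOp.eval, BitVec.toNat_add, h.eval hw hi.1, h.eval hw hi.2]
    exact Nat.mod_eq_of_lt hpre
  | sub r x y =>
    simp only [Instr.small, Bool.and_eq_true] at hi
    refine ⟨_, 1, .binary .., h.setReg r ?_ 1, le_rfl⟩
    simp only [Instr.pre] at hpre
    rw [BinOp.eval, BitVec.toNat_sub_of_le, h.eval hw hi.1, h.eval hw hi.2]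
    rw [BitVec.le_def, h.eval hw hi.1, h.eval hw hi.2]
    exact hpre
  | half r x =>
    refine ⟨_, 1, .binary .., h.setReg r ?_ 1, le_rfl⟩
    have : (1 : ℕ) % 2 ^ w = 1 := Nat.mod_eq_of_lt (by omega)
    simp only [BinOp.eval, eval_const, BitVec.toNat_ushiftRight,
      BitVec.toNat_ofNat, this, h.eval hw hi, Nat.shiftRight_eq_div_pow, pow_one]
  | ld r k x =>
    obtain ⟨σ1, hr, h1, ha⟩ := runs_addrProgram (k := k) h hcap hw hi hpre
    refine ⟨_, 4, .seq (t := 3) (t' := 1) hr (.load ..), h1.setReg r ?_ 4, le_rfl⟩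
    simp only [Operand.eval]
    rw [eq_ofNat ha, h1.arr_eq _ _ hpre]
  | st k x y =>
    simp only [Instr.small, Bool.and_eq_true] at hi
    obtain ⟨σ1, hr, h1, ha⟩ := runs_addrProgram (k := k) h hcap hw hi.1 hpre
    exact ⟨_, 4, .seq (t := 3) (t' := 1) hr (.store ..), h1.setMem hcap hpre ha (h1.eval hw hi.2),
      le_rfl⟩
  | ldl r x =>
    refine ⟨_, 1, .load .., h.setReg r ?_ 1, le_rfl⟩
    rw [eq_ofNat (h.eval hw hi), h.low_eq _ hpre]
  | stl x y =>
    simp only [Instr.small, Bool.and_eq_true] at hi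
    exact ⟨_, 1, .store .., h.setLow hcap hpre (h.eval hw hi.1) (h.eval hw hi.2), le_rfl⟩

/-- Array programs are simulated faithfully by their compilations, within the time that the clock
shows. -/
theorem runs_of_wp (hcap : base + 32 * cap ≤ 2 ^ w) (hw : 32 ≤ 2 ^ w) (c : Code) :
    ∀ {s : AS} {σ : State w} {Q : AS → Prop}, c.small = true → Rep base cap s σ →
      wp (2 ^ w) base cap c s Q →
      ∃ s' σ' t, Runs c.compile σ σ' t ∧ Rep base cap s' σ' ∧ s.tick + t ≤ s'.tick ∧ Q s' := by
  induction c with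
  | ins i =>
    intro s σ Q hs h hwp
    obtain ⟨σ', t, h1, h2, h3⟩ := runs_instr h hcap hw hs hwp.1
    exact ⟨_, σ', t, h1, h2, h3, hwp.2⟩
  | seq p q hp hq =>
    intro s σ Q hs h hwp
    simp only [Code.small, Bool.and_eq_true] at hs
    obtain ⟨s1, σ1, t1, h1, h2, h3, h4⟩ := hp hs.1 h hwp
    obtain ⟨s2, σ2, t2, g1, g2, g3, g4⟩ := hq hs.2 h2 h4
    exact ⟨s2, σ2, _, .seq h1 g1, g2, by omega, g4⟩
  | ite b p q hp hq =>
    intro s σ Q hs h hwp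
    simp only [Code.small, Bool.and_eq_true] at hs
    by_cases hb : b.holds s
    · obtain ⟨s1, σ1, t1, h1, h2, h3, h4⟩ := hp hs.2.1 h.wait (hwp.1 hb)
      exact ⟨s1, σ1, _, .branch_true ((h.holds hw hs.1).2 hb) h1, h2,
        by simp only [AS.wait] at h3; omega, h4⟩
    · obtain ⟨s1, σ1, t1, h1, h2, h3, h4⟩ := hq hs.2.2 h.wait (hwp.2 hb)
      exact ⟨s1, σ1, _, .branch_false (fun hc => hb ((h.holds hw hs.1).1 hc)) h1, h2,
        by simp only [AS.wait] at h3; omega, h4⟩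
  | loop b p hp =>
    rintro s σ Q hs h ⟨I, B, hI, hB, hstep, hexit⟩
    simp only [Code.small, Bool.and_eq_true] at hs
    -- The clock is bounded by `B` and each iteration advances it.
    induction hk : B - s.tick using Nat.strong_induction_on generalizing s σ with
    | _ k ih =>
      by_cases hb : b.holds s
      · obtain ⟨s1, σ1, t1, h1, h2, h3, h4⟩ := hp hs.2 h.wait (hstep s hI hb)
        simp only [AS.wait] at h3
        have := hB s hI
        have := hB s1 h4
        obtain ⟨s2, σ2, t2, g1, g2, g3, g4⟩ := ih (B - s1.tick) (by omega) h2 h4 rfl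
        exact ⟨s2, σ2, _, .loop_true ((h.holds hw hs.1).2 hb) h1 g1, g2, by omega, g4⟩
      · exact ⟨s.wait, σ, 1, .loop_false fun hc => hb ((h.holds hw hs.1).1 hc), h.wait, le_rfl,
          hexit s hI hb⟩

end Soundness

end MinBalance

/-! ### The hierarchy of blocks -/

namespace MinBalance

open Finset

/-- The arcs of a digraph in the order of their costs: arc `i` goes from `src i` to `tgt i` and costs
`cost i`. The costs are extended monotonically to all indices below `pw`. -/
structure SortedArcs where
  n : ℕ
  m : ℕ
  pw : ℕ
  src : ℕ → ℕ
  tgt : ℕ → ℕ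
  cost : ℕ → ℕ
  m_le : m ≤ pw
  cost_mono : ∀ i j, i ≤ j → j < pw → cost i ≤ cost j

/-- `b` can be reached from `a` along arcs of index below `t`. -/
def SortedArcs.Reach (G : SortedArcs) (t : ℕ) : ℕ → ℕ → Prop :=
  Relation.ReflTransGen fun a b => ∃ i < G.m, i < t ∧ G.src i = a ∧ G.tgt i = b

theorem SortedArcs.Reach.mono {G : SortedArcs} {t t' : ℕ} (h : t ≤ t') {a b : ℕ}
    (hab : G.Reach t a b) : G.Reach t' a b :=
  Relation.ReflTransGen.mono (fun _ _ (⟨i, h1, h2, h3⟩ : ∃ i < G.m, i < t ∧ _) =>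
    ⟨i, h1, by omega, h3⟩) _ _ hab

/-- A nested family of blocks of nodes. Block `0` consists of all nodes, block `v + 1` of the node
`v`, and the other blocks below `count` have been formed since. Each block `x ≠ 0` lies in the block
`parent x`, contains `size x` nodes, and is connected by arcs of index below `level x`. The ends of
arc `i` have been replaced by the blocks `tail i` and `head i`, which have the same parent. -/
structure Forest where
  tail : ℕ → ℕ
  head : ℕ → ℕ
  parent : ℕ → ℕ
  level : ℕ → ℕ
  size : ℕ → ℕ
  count : ℕ

namespace Forest

/-- The blocks that are ends of arcs. -/
def Touched (F : Forest) (m x : ℕ) : Prop := ∃ i < m, F.tail i = x ∨ F.head i = x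

/-- The arcs that count when the blocks of a parent are merged into components, with offset `h`
from the level of the blocks. -/
def Active (F : Forest) (m h i : ℕ) : Prop := i < m ∧ i < F.level (F.tail i) + h

/-- There is an active arc from `x` to `y`. -/
def Step (F : Forest) (m h x y : ℕ) : Prop := ∃ i, F.Active m h i ∧ F.tail i = x ∧ F.head i = y

/-- The children of a block have at most as many nodes as the block itself. -/
def ChildSum (F : Forest) : Prop :=
  ∀ p, ∑ x ∈ Ico 1 F.count with F.parent x = p, F.size x ≤ F.size p

theorem ChildSum.size_le {F : Forest} (h : F.ChildSum) {x : ℕ} (h1 : 1 ≤ x) (h2 : x < F.count) :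
    F.size x ≤ F.size (F.parent x) := by
  have hx : x ∈ (Ico 1 F.count).filter (F.parent · = F.parent x) :=
    mem_filter.2 ⟨mem_Ico.2 ⟨h1, h2⟩, rfl⟩
  exact (single_le_sum (f := F.size) (fun _ _ => Nat.zero_le _) hx).trans (h _)

/-- `F'` arises from `F` by forming a new block for each strong component of the active arcs among
the blocks of a common parent. The new blocks are numbered in reverse topological order. -/
structure Condenses (m h : ℕ) (F F' : Forest) : Prop where
  tail_eq : F'.tail = F.tail
  head_eq : F'.head = F.head
  count_le : F.count ≤ F'.count
  parent_ge : ∀ x, F.Touched m x → F.count ≤ F'.parent x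
  parent_lt : ∀ x, F.Touched m x → F'.parent x < F'.count
  parent_old : ∀ x < F.count, ¬ F.Touched m x → F'.parent x = F.parent x
  level_old : ∀ x < F.count, F'.level x = F.level x
  size_old : ∀ x < F.count, F'.size x = F.size x
  level_new : ∀ x, F.Touched m x → F'.level (F'.parent x) = F.level x + h
  parent_new : ∀ x, F.Touched m x → F'.parent (F'.parent x) = F.parent x
  used : ∀ s, F.count ≤ s → s < F'.count → ∃ x, F.Touched m x ∧ F'.parent x = s
  reach : ∀ x y, F.Touched m x → F.Touched m y → F'.parent x = F'.parent y →
    Relation.ReflTransGen (F.Step m h) x y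
  order : ∀ i, F.Active m h i → F'.parent (F.head i) ≤ F'.parent (F.tail i)
  childSum : F'.ChildSum

/-- Move the ends of the arcs between different new blocks to these blocks. -/
def relabel (F : Forest) (m : ℕ) : Forest where
  tail i := if i < m ∧ F.parent (F.tail i) ≠ F.parent (F.head i) then F.parent (F.tail i)
    else F.tail i
  head i := if i < m ∧ F.parent (F.tail i) ≠ F.parent (F.head i) then F.parent (F.head i)
    else F.head i
  parent := F.parent
  level := F.level
  size := F.size
  count := F.count

/-- The invariant of the hierarchy: the blocks with a common parent, of level `l`, are strongly
connected by arcs of index below `l + H`, while the arcs of index below `l` between them go from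
larger to smaller blocks. -/
structure Hierarchy (G : SortedArcs) (H : ℕ) (F : Forest) : Prop where
  tail_pos : ∀ i < G.m, 1 ≤ F.tail i
  head_pos : ∀ i < G.m, 1 ≤ F.head i
  tail_lt : ∀ i < G.m, F.tail i < F.count
  head_lt : ∀ i < G.m, F.head i < F.count
  count_pos : 1 ≤ F.count
  parent_lt : ∀ x, 1 ≤ x → x < F.count → F.parent x < F.count
  level_le : ∀ x, 1 ≤ x → x < F.count → F.level x + H ≤ G.pw
  parent_eq : ∀ i < G.m, F.parent (F.tail i) = F.parent (F.head i)
  level_eq : ∀ i < G.m, F.level (F.tail i) = F.level (F.head i)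
  order : ∀ i < G.m, i < F.level (F.tail i) → F.head i < F.tail i
  childSum : F.ChildSum
  size_le : ∀ x < F.count, F.size x ≤ G.n
  reach : ∀ i < G.m, G.Reach (F.level (F.tail i) + H) (G.tgt i) (G.src i)
  -- `mem a x` means that the node `a` lies in the block `x`.
  connected : ∃ mem : ℕ → ℕ → Prop, (∀ i < G.m, mem (G.src i) (F.tail i)) ∧
    (∀ i < G.m, mem (G.tgt i) (F.head i)) ∧
    ∀ x, 1 ≤ x → x < F.count → ∀ a b, mem a x → mem b x → G.Reach (F.level x) a b

/-- The potential of the inner nodes is bounded, and the potential differences across arcs are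
sufficient: if `l` is the index at which the ends of arc `i` become strongly connected, then the
reduced cost of arc `i` is at least a fixed fraction of the maximum of `cost l` and `cost i`. -/
structure Good (G : SortedArcs) (H : ℕ) (F : Forest) (φ : ℕ → ℕ) : Prop where
  bound : ∀ x, 1 ≤ x → x < F.count →
    φ x ≤ (F.size (F.parent x) - F.size x) * G.cost (F.level x + H - 1)
  arc : ∀ i < G.m, ∃ l, F.level (F.tail i) ≤ l ∧ l < F.level (F.tail i) + H ∧
    (i < l → φ (F.head i) + F.size (F.head i) * G.cost l ≤ φ (F.tail i)) ∧
    (l ≤ i → φ (F.head i) ≤ φ (F.tail i) + (G.n - F.size (F.head i)) * G.cost l) ∧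
    G.Reach (l + 1) (G.tgt i) (G.src i)

/-- The potential before a condensation, from the potential after it. -/
def wrap (F F' : Forest) (φ : ℕ → ℕ) (x : ℕ) : ℕ :=
  if x < F.count ∧ F.count ≤ F'.parent x then φ x + φ (F'.parent x) else φ x

variable {G : SortedArcs} {F F' : Forest} {h : ℕ}

theorem Hierarchy.touched_pos {H : ℕ} (hF : Hierarchy G H F) {x : ℕ} (hx : F.Touched G.m x) :
    1 ≤ x := by
  obtain ⟨i, hi, rfl | rfl⟩ := hx
  exacts [hF.tail_pos i hi, hF.head_pos i hi]

theorem Hierarchy.touched_lt {H : ℕ} (hF : Hierarchy G H F) {x : ℕ} (hx : F.Touched G.m x) :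
    x < F.count := by
  obtain ⟨i, hi, rfl | rfl⟩ := hx
  exacts [hF.tail_lt i hi, hF.head_lt i hi]

theorem touched_tail {m i : ℕ} (hi : i < m) : F.Touched m (F.tail i) := ⟨i, hi, .inl rfl⟩

theorem touched_head {m i : ℕ} (hi : i < m) : F.Touched m (F.head i) := ⟨i, hi, .inr rfl⟩

/-- Active paths between blocks yield paths between their nodes. -/
theorem reach_of_steps {mem : ℕ → ℕ → Prop} {H : ℕ} (hF : Hierarchy G H F)
    (h1 : ∀ i < G.m, mem (G.src i) (F.tail i)) (h2 : ∀ i < G.m, mem (G.tgt i) (F.head i))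
    (h3 : ∀ x, 1 ≤ x → x < F.count → ∀ a b, mem a x → mem b x → G.Reach (F.level x) a b)
    {x y : ℕ} (hx : F.Touched G.m x) (hxy : Relation.ReflTransGen (F.Step G.m h) x y) :
    F.level y = F.level x ∧ ∀ a b, mem a x → mem b y → G.Reach (F.level x + h) a b := by
  induction hxy with
  | refl =>
    exact ⟨rfl, fun a b ha hb =>
      (h3 x (hF.touched_pos hx) (hF.touched_lt hx) a b ha hb).mono (by omega)⟩
  | tail _ hs ih =>
    obtain ⟨i, ⟨hi, hl⟩, rfl, rfl⟩ := hs
    have hlev := hF.level_eq i hi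
    refine ⟨by omega, fun a b ha hb => ?_⟩
    have r1 := ih.2 a _ ha (h1 i hi)
    have r2 := h3 _ (hF.head_pos i hi) (hF.head_lt i hi) _ b (h2 i hi) hb
    exact (r1.tail ⟨i, hi, by omega, rfl, rfl⟩).trans (r2.mono (by omega))

theorem Hierarchy.condense (hF : Hierarchy G (2 * h) F) (hc : Condenses G.m h F F') :
    Hierarchy G h (F'.relabel G.m) := by
  obtain ⟨mem, h1, h2, h3⟩ := hF.connected
  have hpos : ∀ {x}, F.Touched G.m x → 1 ≤ x := hF.touched_pos
  have hlt : ∀ {x}, F.Touched G.m x → x < F.count := hF.touched_lt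
  have tl := hc.tail_eq
  have hd := hc.head_eq
  have hcle := hc.count_le
  have hcpos := hF.count_pos
  have hreach : ∀ x y, F.Touched G.m x → F.Touched G.m y → F'.parent x = F'.parent y →
      ∀ a b, mem a x → mem b y → G.Reach (F.level x + h) a b := fun x y hx hy he =>
    (reach_of_steps hF h1 h2 h3 hx (hc.reach x y hx hy he)).2
  have hparent_lt : ∀ x, 1 ≤ x → x < F'.count → F'.parent x < F'.count := by
    intro x hx hx'
    by_cases hxo : x < F.count
    · by_cases ht : F.Touched G.m x
      · exact hc.parent_lt x ht
      · rw [hc.parent_old x hxo ht]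
        exact (hF.parent_lt x hx hxo).trans_le hcle
    · obtain ⟨y, hy, rfl⟩ := hc.used x (by omega) hx'
      rw [hc.parent_new y hy]
      exact (hF.parent_lt y (hpos hy) (hlt hy)).trans_le hcle
  -- The cases of an arc within a new block and of an arc between different new blocks.
  have cases : ∀ i < G.m,
      (F'.parent (F.tail i) = F'.parent (F.head i) ∧ (F'.relabel G.m).tail i = F.tail i ∧
        (F'.relabel G.m).head i = F.head i) ∨
      (F'.parent (F.tail i) ≠ F'.parent (F.head i) ∧
        (F'.relabel G.m).tail i = F'.parent (F.tail i) ∧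
        (F'.relabel G.m).head i = F'.parent (F.head i)) := by
    intro i hi
    by_cases he : F'.parent (F.tail i) = F'.parent (F.head i)
    · left; simp [relabel, tl, hd, he]
    · right; simp [relabel, tl, hd, he, hi]
  have tt : ∀ {i}, i < G.m → F.Touched G.m (F.tail i) := touched_tail
  have th : ∀ {i}, i < G.m → F.Touched G.m (F.head i) := touched_head
  have level' : ∀ i < G.m, F'.level (F'.parent (F.tail i)) = F.level (F.tail i) + h :=
    fun i hi => hc.level_new _ (tt hi)
  have level'' : ∀ i < G.m, F'.level (F'.parent (F.head i)) = F.level (F.tail i) + h :=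
    fun i hi => by rw [hc.level_new _ (th hi), hF.level_eq i hi]
  refine ⟨?_, ?_, ?_, ?_, by simp only [relabel]; omega, hparent_lt, ?_, ?_, ?_, ?_, hc.childSum,
    ?_, ?_, ?_⟩
  · intro i hi
    have := hc.parent_ge _ (tt hi)
    have := hpos (tt hi)
    rcases cases i hi with ⟨-, h, -⟩ | ⟨-, h, -⟩ <;> omega
  · intro i hi
    have := hc.parent_ge _ (th hi)
    have := hpos (th hi)
    rcases cases i hi with ⟨-, -, h⟩ | ⟨-, -, h⟩ <;> omega
  · intro i hi
    have := hc.parent_lt _ (tt hi)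
    have := hlt (tt hi)
    change _ < F'.count
    rcases cases i hi with ⟨-, h, -⟩ | ⟨-, h, -⟩ <;> omega
  · intro i hi
    have := hc.parent_lt _ (th hi)
    have := hlt (th hi)
    change _ < F'.count
    rcases cases i hi with ⟨-, -, h⟩ | ⟨-, -, h⟩ <;> omega
  · intro x hx hx'
    change F'.level x + h ≤ _
    by_cases hxo : x < F.count
    · rw [hc.level_old x hxo]
      have := hF.level_le x hx hxo
      omega
    · obtain ⟨y, hy, rfl⟩ := hc.used x (by omega) hx'
      rw [hc.level_new y hy]
      have := hF.level_le y (hpos hy) (hlt hy)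
      omega
  · intro i hi
    change F'.parent _ = F'.parent _
    rcases cases i hi with ⟨h1, h2, h3⟩ | ⟨h1, h2, h3⟩ <;> rw [h2, h3]
    · exact h1
    · rw [hc.parent_new _ (tt hi), hc.parent_new _ (th hi), hF.parent_eq i hi]
  · intro i hi
    change F'.level _ = F'.level _
    rcases cases i hi with ⟨h1, h2, h3⟩ | ⟨h1, h2, h3⟩ <;> rw [h2, h3]
    · rw [hc.level_old _ (hlt (tt hi)), hc.level_old _ (hlt (th hi)), hF.level_eq i hi]
    · rw [level' i hi, level'' i hi]
  · intro i hi
    change i < F'.level _ → _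
    rcases cases i hi with ⟨h1, h2, h3⟩ | ⟨h1, h2, h3⟩ <;> rw [h2, h3]
    · rw [hc.level_old _ (hlt (tt hi))]
      exact hF.order i hi
    · rw [level' i hi]
      intro hil
      exact lt_of_le_of_ne (hc.order i ⟨hi, hil⟩) (Ne.symm h1)
  · intro x hx
    change x < F'.count at hx
    change F'.size x ≤ _
    by_cases hxo : x < F.count
    · rw [hc.size_old x hxo]
      exact hF.size_le x hxo
    · obtain ⟨y, hy, rfl⟩ := hc.used x (by omega) hx
      have hP := hF.parent_lt y (hpos hy) (hlt hy)
      have := hc.childSum.size_le (by omega) hx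
      rw [hc.parent_new y hy, hc.size_old _ hP] at this
      exact this.trans (hF.size_le _ hP)
  · intro i hi
    change G.Reach (F'.level _ + h) _ _
    rcases cases i hi with ⟨g1, g2, g3⟩ | ⟨g1, g2, g3⟩ <;> rw [g2]
    · rw [hc.level_old _ (hlt (tt hi)), hF.level_eq i hi]
      exact hreach _ _ (th hi) (tt hi) g1.symm _ _ (h2 i hi) (h1 i hi)
    · rw [level' i hi]
      exact (hF.reach i hi).mono (by omega)
  · refine ⟨fun a z => (z < F.count ∧ mem a z) ∨
      (F.count ≤ z ∧ ∃ x, F.Touched G.m x ∧ F'.parent x = z ∧ mem a x), ?_, ?_, ?_⟩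
    · intro i hi
      rcases cases i hi with ⟨g1, g2, g3⟩ | ⟨g1, g2, g3⟩ <;> rw [g2]
      · exact .inl ⟨hlt (tt hi), h1 i hi⟩
      · exact .inr ⟨hc.parent_ge _ (tt hi), _, tt hi, rfl, h1 i hi⟩
    · intro i hi
      rcases cases i hi with ⟨g1, g2, g3⟩ | ⟨g1, g2, g3⟩ <;> rw [g3]
      · exact .inl ⟨hlt (th hi), h2 i hi⟩
      · exact .inr ⟨hc.parent_ge _ (th hi), _, th hi, rfl, h2 i hi⟩
    · intro z hz hz' a b ha hb
      change G.Reach (F'.level z) a b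
      rcases ha with ⟨hzo, ha⟩ | ⟨hzo, x, hx, rfl, ha⟩
      · rcases hb with ⟨-, hb⟩ | ⟨hzo', -⟩
        · rw [hc.level_old z hzo]
          exact h3 z hz hzo a b ha hb
        · omega
      · rcases hb with ⟨hzo', -⟩ | ⟨-, y, hy, hxy, hb⟩
        · omega
        · rw [hc.level_new x hx]
          exact hreach x y hx hy hxy.symm a b ha hb

theorem Good.condense (hh : 1 ≤ h) (hF : Hierarchy G (2 * h) F) (hc : Condenses G.m h F F')
    {φ : ℕ → ℕ} (hφ : Good G h (F'.relabel G.m) φ) : Good G (2 * h) F (wrap F F' φ) := by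
  have hpos : ∀ {x}, F.Touched G.m x → 1 ≤ x := hF.touched_pos
  have hlt : ∀ {x}, F.Touched G.m x → x < F.count := hF.touched_lt
  have hcle := hc.count_le
  have hcpos := hF.count_pos
  have hwrap : ∀ x, F.Touched G.m x → wrap F F' φ x = φ x + φ (F'.parent x) := fun x hx => by
    simp [wrap, hlt hx, hc.parent_ge x hx]
  have hb : ∀ x, 1 ≤ x → x < F'.count →
    φ x ≤ (F'.size (F'.parent x) - F'.size x) * G.cost (F'.level x + h - 1) := hφ.bound
  have hb1 : ∀ x, F.Touched G.m x →
      φ x ≤ (F'.size (F'.parent x) - F.size x) * G.cost (F.level x + h - 1) := fun x hx => by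
    have := hb x (hpos hx) ((hlt hx).trans_le hcle)
    rwa [hc.size_old x (hlt hx), hc.level_old x (hlt hx)] at this
  have hs1 : ∀ x, F.Touched G.m x → F.size x ≤ F'.size (F'.parent x) := fun x hx => by
    have := hc.childSum.size_le (hpos hx) ((hlt hx).trans_le hcle)
    rwa [hc.size_old x (hlt hx)] at this
  have hs2 : ∀ x, F.Touched G.m x → F'.size (F'.parent x) ≤ F.size (F.parent x) := fun x hx => by
    have := hc.parent_ge x hx
    have := hc.childSum.size_le (by omega) (hc.parent_lt x hx)
    rwa [hc.parent_new x hx, hc.size_old _ (hF.parent_lt x (hpos hx) (hlt hx))] at this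
  have tt : ∀ {i}, i < G.m → F.Touched G.m (F.tail i) := touched_tail
  have th : ∀ {i}, i < G.m → F.Touched G.m (F.head i) := touched_head
  constructor
  · intro x hx hxc
    have hlev := hF.level_le x hx hxc
    have hmono : G.cost (F.level x + h - 1) ≤ G.cost (F.level x + 2 * h - 1) :=
      G.cost_mono _ _ (by omega) (by omega)
    by_cases ht : F.Touched G.m x
    · rw [hwrap x ht]
      have e1 := hb1 x ht
      have e2 := hb (F'.parent x) (by have := hc.parent_ge x ht; omega) (hc.parent_lt x ht)
      rw [hc.parent_new x ht, hc.size_old _ (hF.parent_lt x hx hxc), hc.level_new x ht] at e2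
      rw [show F.level x + h + h - 1 = F.level x + 2 * h - 1 by omega] at e2
      have e3 := hs1 x ht
      have e4 := hs2 x ht
      calc φ x + φ (F'.parent x)
          ≤ (F'.size (F'.parent x) - F.size x) * G.cost (F.level x + 2 * h - 1) +
            (F.size (F.parent x) - F'.size (F'.parent x)) * G.cost (F.level x + 2 * h - 1) :=
            add_le_add (e1.trans (Nat.mul_le_mul_left _ hmono)) e2
        _ = _ := by rw [← add_mul]; congr 1; omega
    · have hp := hc.parent_old x hxc ht
      have hP := hF.parent_lt x hx hxc
      have : wrap F F' φ x = φ x := by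
        rw [wrap, if_neg]; rw [hp]; omega
      rw [this]
      have := hb x hx (by omega)
      rw [hp, hc.size_old _ hP, hc.size_old _ hxc, hc.level_old _ hxc] at this
      exact this.trans (Nat.mul_le_mul_left _ hmono)
  · intro i hi
    obtain ⟨l, l1, l2, l3, l4, l5⟩ := hφ.arc i hi
    have hlev := hF.level_le _ (hpos (tt hi)) (hlt (tt hi))
    have hle := hF.level_eq i hi
    rw [hwrap _ (tt hi), hwrap _ (th hi)]
    by_cases he : F'.parent (F.tail i) = F'.parent (F.head i)
    · simp only [relabel, hc.tail_eq, hc.head_eq, he, ne_eq, not_true_eq_false, and_false,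
        if_false, hc.level_old _ (hlt (tt hi)), hc.size_old _ (hlt (th hi))] at l1 l2 l3 l4
      refine ⟨l, l1, by omega, fun h => ?_, fun h => ?_, l5⟩
      · have := l3 h; rw [he]; omega
      · have := l4 h; rw [he]; omega
    · simp only [relabel, hc.tail_eq, hc.head_eq, he, ne_eq, not_false_eq_true, and_true, hi,
        if_true, hc.level_new _ (tt hi)] at l1 l2 l3 l4
      have hmono : G.cost (F.level (F.head i) + h - 1) ≤ G.cost l :=
        G.cost_mono _ _ (by omega) (by omega)
      have e1 := (hb1 _ (th hi)).trans (Nat.mul_le_mul_left _ hmono)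
      have e3 := hs1 _ (th hi)
      refine ⟨l, by omega, by omega, fun h => ?_, fun h => ?_, l5⟩
      · have := l3 h
        have e2 : (F'.size (F'.parent (F.head i)) - F.size (F.head i)) * G.cost l +
            F.size (F.head i) * G.cost l = F'.size (F'.parent (F.head i)) * G.cost l := by
          rw [← add_mul]; congr 1; omega
        omega
      · have := l4 h
        have e4 := hs2 _ (th hi)
        have e5 := hF.size_le _ (hF.parent_lt _ (hpos (th hi)) (hlt (th hi)))
        have e2 : (F'.size (F'.parent (F.head i)) - F.size (F.head i)) * G.cost l +
            (G.n - F'.size (F'.parent (F.head i))) * G.cost l =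
              (G.n - F.size (F.head i)) * G.cost l := by
          rw [← add_mul]; congr 1; omega
        omega

/-- The potential on the finest hierarchy: a block precedes the blocks of the same parent with larger
numbers, and the gap left for it is its size times the cost at its level. -/
def basePotential (G : SortedArcs) (F : Forest) (x : ℕ) : ℕ :=
  (∑ y ∈ Ico 1 x with F.parent y = F.parent x, F.size y) * G.cost (F.level x)

theorem sum_lt_add_size_le {x z : ℕ} (hxz : x < z) (hx : 1 ≤ x) :
    (∑ y ∈ Ico 1 x with F.parent y = F.parent x, F.size y) + F.size x ≤
      ∑ y ∈ Ico 1 z with F.parent y = F.parent x, F.size y := by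
  have hnot : x ∉ (Ico 1 x).filter (F.parent · = F.parent x) := by simp
  rw [add_comm, ← sum_insert (f := F.size) hnot]
  refine sum_le_sum_of_subset fun y hy => ?_
  simp only [mem_insert, mem_filter, mem_Ico] at hy ⊢
  rcases hy with rfl | ⟨⟨h1, h2⟩, h3⟩
  · exact ⟨⟨hx, hxz⟩, rfl⟩
  · exact ⟨⟨h1, by omega⟩, h3⟩

theorem Hierarchy.good_basePotential (hF : Hierarchy G 1 F) {φ : ℕ → ℕ}
    (hφ : ∀ x, 1 ≤ x → x < F.count → φ x = basePotential G F x) : Good G 1 F φ := by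
  have bound : ∀ x, 1 ≤ x → x < F.count →
      φ x ≤ (F.size (F.parent x) - F.size x) * G.cost (F.level x) := by
    intro x hx hxc
    rw [hφ x hx hxc]
    have := (sum_lt_add_size_le (F := F) hxc hx).trans (hF.childSum (F.parent x))
    exact Nat.mul_le_mul_right _ (by omega)
  refine ⟨bound, fun i hi => ⟨F.level (F.tail i), le_rfl, by omega, fun hl => ?_, fun hl => ?_,
    hF.reach i hi⟩⟩
  · have hord := hF.order i hi hl
    rw [hφ _ (hF.tail_pos i hi) (hF.tail_lt i hi), hφ _ (hF.head_pos i hi) (hF.head_lt i hi),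
      basePotential, basePotential, ← hF.level_eq i hi, ← add_mul, hF.parent_eq i hi]
    exact Nat.mul_le_mul_right _ (sum_lt_add_size_le hord (hF.head_pos i hi))
  · have e1 := bound _ (hF.head_pos i hi) (hF.head_lt i hi)
    rw [← hF.level_eq i hi] at e1
    have e2 := hF.size_le _ (hF.parent_lt _ (hF.head_pos i hi) (hF.head_lt i hi))
    have e3 : (F.size (F.parent (F.head i)) - F.size (F.head i)) * G.cost (F.level (F.tail i)) ≤
        (G.n - F.size (F.head i)) * G.cost (F.level (F.tail i)) :=
      Nat.mul_le_mul_right _ (by omega)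
    omega

end Forest

end MinBalance

/-! ### Strong components by path-based search -/

namespace MinBalance

open Finset

namespace Forest

/-- The state of a path-based search for strong components. The visited blocks whose component is not
yet known form the stack `nodes`; `idx` gives the height at which a block was pushed, and `0` for
blocks that were not visited. The stack is divided into segments, which begin at the heights
`bounds`. The stack `path` holds the blocks whose arcs have not yet been exhausted. The unexplored
arcs `i` with tail `x` are those with `i < adj x`. A finished component has been made the new
parent of its members. -/
structure Search where
  idx : ℕ → ℕ
  nodes : ℕ → ℕ
  bounds : ℕ → ℕ
  path : ℕ → ℕ
  adj : ℕ → ℕ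
  parent : ℕ → ℕ
  sp : ℕ
  bp : ℕ
  dp : ℕ
  count : ℕ

/-- `link` chains the active arcs with the same tail in decreasing order. Arc `i` is represented by
`i + 1`, and `0` marks the end of a chain. -/
structure Linked (F : Forest) (m h : ℕ) (link : ℕ → ℕ) : Prop where
  active : ∀ i, F.Active m h i → link i ≠ 0 → F.Active m h (link i - 1)
  tail : ∀ i, F.Active m h i → link i ≠ 0 → F.tail (link i - 1) = F.tail i
  le : ∀ i, F.Active m h i → link i ≤ i
  max : ∀ i, F.Active m h i → ∀ j, F.Active m h j → F.tail j = F.tail i → j < i → j < link i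

/-- Reachability along active arcs. -/
abbrev Steps (F : Forest) (m h : ℕ) : ℕ → ℕ → Prop := Relation.ReflTransGen (F.Step m h)

/-- The invariant of the search: every segment is strongly connected, each block of the stack reaches
the blocks above it, explored arcs do not lead from a segment to a lower one, and finished
components are closed under active arcs and numbered in reverse topological order. -/
structure SearchInv (F : Forest) (m h : ℕ) (S : Search) : Prop where
  count_le : F.count ≤ S.count
  idx_nodes : ∀ k < S.sp, S.idx (S.nodes k) = k + 1
  parent_nodes : ∀ k < S.sp, S.parent (S.nodes k) < F.count
  touched_nodes : ∀ k < S.sp, F.Touched m (S.nodes k)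
  visited : ∀ x, F.Touched m x → S.idx x ≠ 0 → S.parent x < F.count →
    S.idx x ≤ S.sp ∧ S.nodes (S.idx x - 1) = x
  idx_ne : ∀ x, F.Touched m x → F.count ≤ S.parent x → S.idx x ≠ 0
  parent_lt : ∀ x, F.Touched m x → S.parent x < S.count
  closed : ∀ i, F.Active m h i → F.count ≤ S.parent (F.tail i) →
    F.count ≤ S.parent (F.head i) ∧ S.parent (F.head i) ≤ S.parent (F.tail i)
  same : ∀ x y, F.Touched m x → F.Touched m y → F.count ≤ S.parent x → S.parent x = S.parent y →
    F.Steps m h x y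
  reach : ∀ i j, i ≤ j → j < S.sp → F.Steps m h (S.nodes i) (S.nodes j)
  bounds_pos : ∀ k < S.bp, 1 ≤ S.bounds k
  bounds_le : ∀ k < S.bp, S.bounds k ≤ S.sp
  bounds_mono : ∀ k k', k < k' → k' < S.bp → S.bounds k < S.bounds k'
  bp_pos : 0 < S.sp → 0 < S.bp
  bounds_zero : 0 < S.sp → S.bounds 0 = 1
  segment : ∀ k < S.bp, ∀ j < S.sp, S.bounds k ≤ j + 1 →
    (∀ k', k < k' → k' < S.bp → j + 1 < S.bounds k') →
    F.Steps m h (S.nodes j) (S.nodes (S.bounds k - 1))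
  path_mono : ∀ k k', k < k' → k' < S.dp → S.idx (S.path k) < S.idx (S.path k')
  path_touched : ∀ k < S.dp, F.Touched m (S.path k)
  path_idx : ∀ k < S.dp, S.idx (S.path k) ≠ 0
  path_parent : ∀ k < S.dp, S.parent (S.path k) < F.count
  path_of_adj : ∀ j < S.sp, S.adj (S.nodes j) ≠ 0 → ∃ k < S.dp, S.path k = S.nodes j
  path_of_bounds : ∀ k < S.bp, ∃ k' < S.dp, S.path k' = S.nodes (S.bounds k - 1)
  adj_active : ∀ x, F.Touched m x → S.adj x ≠ 0 → F.Active m h (S.adj x - 1)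
  adj_tail : ∀ x, F.Touched m x → S.adj x ≠ 0 → F.tail (S.adj x - 1) = x
  unexplored : ∀ i, F.Active m h i → S.idx (F.tail i) = 0 → i < S.adj (F.tail i)
  explored : ∀ i, F.Active m h i → S.adj (F.tail i) ≤ i → S.parent (F.tail i) < F.count →
    F.count ≤ S.parent (F.head i) ∨ (S.idx (F.head i) ≠ 0 ∧
      ∀ k < S.bp, S.bounds k ≤ S.idx (F.tail i) → S.bounds k ≤ S.idx (F.head i))

/-- Push an unvisited block. -/
def Search.push (S : Search) (y : ℕ) : Search :=
  { S with
    idx := Function.update S.idx y (S.sp + 1)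
    nodes := Function.update S.nodes S.sp y
    bounds := Function.update S.bounds S.bp (S.sp + 1)
    path := Function.update S.path S.dp y
    sp := S.sp + 1
    bp := S.bp + 1
    dp := S.dp + 1 }

namespace SearchInv

variable {F : Forest} {m h : ℕ} {S : Search}

theorem idx_le (hS : SearchInv F m h S) {k : ℕ} (hk : k < S.dp) : S.idx (S.path k) ≤ S.sp :=
  (hS.visited _ (hS.path_touched k hk) (hS.path_idx k hk) (hS.path_parent k hk)).1

theorem nodes_idx (hS : SearchInv F m h S) {k : ℕ} (hk : k < S.dp) :
    S.nodes (S.idx (S.path k) - 1) = S.path k :=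
  (hS.visited _ (hS.path_touched k hk) (hS.path_idx k hk) (hS.path_parent k hk)).2

/-- The topmost block of the path belongs to the topmost segment. -/
theorem bounds_le_idx (hS : SearchInv F m h S) (hd : 0 < S.dp) (hb : 0 < S.bp) :
    S.bounds (S.bp - 1) ≤ S.idx (S.path (S.dp - 1)) := by
  obtain ⟨k, hk, he⟩ := hS.path_of_bounds (S.bp - 1) (by omega)
  have h1 := hS.bounds_pos (S.bp - 1) (by omega)
  have h2 := hS.bounds_le (S.bp - 1) (by omega)
  have h3 := hS.idx_nodes (S.bounds (S.bp - 1) - 1) (by omega)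
  rw [← he] at h3
  rcases Nat.lt_or_ge k (S.dp - 1) with hlt | hge
  · have := hS.path_mono k (S.dp - 1) hlt (by omega)
    omega
  · obtain rfl : k = S.dp - 1 := by omega
    omega

theorem sp_pos (hS : SearchInv F m h S) (hd : 0 < S.dp) : 0 < S.sp := by
  have h1 := hS.idx_le (k := S.dp - 1) (by omega)
  have h2 := hS.path_idx (S.dp - 1) (by omega)
  omega

theorem bp_pos' (hS : SearchInv F m h S) (hd : 0 < S.dp) : 0 < S.bp := hS.bp_pos (hS.sp_pos hd)

theorem top_le (hS : SearchInv F m h S) (hd : 0 < S.dp) :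
    S.idx (S.path (S.dp - 1)) ≤ S.sp := hS.idx_le (by omega)

/-- Every block of the topmost segment reaches the first one of the segment. -/
theorem reach_bounds (hS : SearchInv F m h S) (hb : 0 < S.bp) {j : ℕ} (hj : j < S.sp)
    (hjb : S.bounds (S.bp - 1) ≤ j + 1) :
    F.Steps m h (S.nodes j) (S.nodes (S.bounds (S.bp - 1) - 1)) :=
  hS.segment (S.bp - 1) (by omega) j hj hjb fun k' h1 h2 => by omega

/-- Every block of the stack reaches the topmost block of the path. -/
theorem reach_top (hS : SearchInv F m h S) (hd : 0 < S.dp) {j : ℕ} (hj : j < S.sp) :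
    F.Steps m h (S.nodes j) (S.path (S.dp - 1)) := by
  have hb := hS.bp_pos' hd
  have h1 := hS.bounds_le_idx hd hb
  have h2 := hS.top_le hd
  have h3 := hS.bounds_pos (S.bp - 1) (by omega)
  rw [← hS.nodes_idx (k := S.dp - 1) (by omega)]
  rcases Nat.lt_or_ge j (S.bounds (S.bp - 1)) with hlt | hge
  · exact hS.reach _ _ (by omega) (by omega)
  · exact (hS.reach_bounds hb hj (by omega)).trans (hS.reach _ _ (by omega) (by omega))

theorem parent_lt_of_idx (hS : SearchInv F m h S) {y : ℕ} (hy : F.Touched m y)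
    (h0 : S.idx y = 0) : S.parent y < F.count := by
  by_contra hc
  exact hS.idx_ne y hy (by omega) h0

theorem push (hS : SearchInv F m h S) {y : ℕ} (hy : F.Touched m y) (h0 : S.idx y = 0)
    (hr : ∀ j < S.sp, F.Steps m h (S.nodes j) y) : SearchInv F m h (S.push y) := by
  have hpy := hS.parent_lt_of_idx hy h0
  have hne : ∀ {x}, S.idx x ≠ 0 → x ≠ y := fun hx h => hx (h ▸ h0)
  have nn : ∀ k < S.sp, S.nodes k ≠ y := fun k hk => hne (by rw [hS.idx_nodes k hk]; omega)
  have np : ∀ k < S.dp, S.path k ≠ y := fun k hk => hne (hS.path_idx k hk)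
  have hle : ∀ k < S.dp, S.idx (S.path k) ≤ S.sp := fun k hk => hS.idx_le hk
  have eqn : ∀ k, k < S.sp → Function.update S.nodes S.sp y k = S.nodes k :=
    fun k hk => Function.update_of_ne (by omega) _ _
  have eqb : ∀ k, k < S.bp → Function.update S.bounds S.bp (S.sp + 1) k = S.bounds k :=
    fun k hk => Function.update_of_ne (by omega) _ _
  have eqp : ∀ k, k < S.dp → Function.update S.path S.dp y k = S.path k :=
    fun k hk => Function.update_of_ne (by omega) _ _
  have eqi : ∀ x, x ≠ y → Function.update S.idx y (S.sp + 1) x = S.idx x :=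
    fun x hx => Function.update_of_ne hx _ _
  have ble := hS.bounds_le
  constructor <;> simp only [Search.push]
  · exact hS.count_le
  · intro k hk
    rcases Nat.lt_succ_iff_lt_or_eq.1 hk with hk | rfl
    · rw [eqn k hk, eqi _ (nn k hk), hS.idx_nodes k hk]
    · simp
  · intro k hk
    rcases Nat.lt_succ_iff_lt_or_eq.1 hk with hk | rfl
    · rw [eqn k hk]; exact hS.parent_nodes k hk
    · simpa using hpy
  · intro k hk
    rcases Nat.lt_succ_iff_lt_or_eq.1 hk with hk | rfl
    · rw [eqn k hk]; exact hS.touched_nodes k hk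
    · simpa using hy
  · intro x hx hi hp
    by_cases hxy : x = y
    · subst hxy; simp
    · rw [eqi x hxy] at hi ⊢
      have := hS.visited x hx hi hp
      exact ⟨by omega, by rw [eqn _ (by omega)]; exact this.2⟩
  · intro x hx hp
    by_cases hxy : x = y
    · subst hxy; omega
    · rw [eqi x hxy]; exact hS.idx_ne x hx hp
  · exact hS.parent_lt
  · exact hS.closed
  · exact hS.same
  · intro i j hij hj
    rcases Nat.lt_succ_iff_lt_or_eq.1 hj with hj | rfl
    · rw [eqn j hj, eqn i (by omega)]; exact hS.reach i j hij hj
    · rw [Function.update_self]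
      rcases Nat.lt_or_eq_of_le hij with hi | rfl
      · rw [eqn i hi]; exact hr i hi
      · rw [Function.update_self]
  · intro k hk
    rcases Nat.lt_succ_iff_lt_or_eq.1 hk with hk | rfl
    · rw [eqb k hk]; exact hS.bounds_pos k hk
    · simp
  · intro k hk
    rcases Nat.lt_succ_iff_lt_or_eq.1 hk with hk | rfl
    · rw [eqb k hk]; have := ble k hk; omega
    · simp
  · intro k k' hkk hk'
    rcases Nat.lt_succ_iff_lt_or_eq.1 hk' with hk' | rfl
    · rw [eqb k (by omega), eqb k' hk']; exact hS.bounds_mono k k' hkk hk'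
    · rw [eqb k hkk, Function.update_self]; have := ble k hkk; omega
  · omega
  · intro _
    rcases Nat.eq_zero_or_pos S.sp with hz | hz
    · rcases Nat.eq_zero_or_pos S.bp with hb | hb
      · simp [hb, hz]
      · have := ble 0 hb; have := hS.bounds_pos 0 hb; omega
    · rw [eqb 0 (hS.bp_pos hz)]; exact hS.bounds_zero hz
  · intro k hk j hj hkj hk'
    rcases Nat.lt_succ_iff_lt_or_eq.1 hk with hk | rfl
    · have hbk := hk' S.bp hk (by omega)
      rw [Function.update_self] at hbk
      rw [eqb k hk] at hkj ⊢
      have := ble k hk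
      have := hS.bounds_pos k hk
      rw [eqn j (by omega), eqn _ (by omega)]
      refine hS.segment k hk j (by omega) hkj fun k' h1 h2 => ?_
      have := hk' k' h1 (by omega)
      rwa [eqb k' h2] at this
    · rw [Function.update_self] at hkj ⊢
      obtain rfl : j = S.sp := by omega
      rw [Nat.add_sub_cancel]
  · intro k k' hkk hk'
    rcases Nat.lt_succ_iff_lt_or_eq.1 hk' with hk' | rfl
    · rw [eqp k (by omega), eqp k' hk', eqi _ (np _ hk'), eqi _ (np _ (by omega))]
      exact hS.path_mono k k' hkk hk'
    · rw [eqp k hkk, eqi _ (np _ hkk), Function.update_self, Function.update_self]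
      have := hle k hkk; omega
  · intro k hk
    rcases Nat.lt_succ_iff_lt_or_eq.1 hk with hk | rfl
    · rw [eqp k hk]; exact hS.path_touched k hk
    · simpa using hy
  · intro k hk
    rcases Nat.lt_succ_iff_lt_or_eq.1 hk with hk | rfl
    · rw [eqp k hk, eqi _ (np _ hk)]; exact hS.path_idx k hk
    · simp
  · intro k hk
    rcases Nat.lt_succ_iff_lt_or_eq.1 hk with hk | rfl
    · rw [eqp k hk]; exact hS.path_parent k hk
    · simpa using hpy
  · intro j hj ha
    rcases Nat.lt_succ_iff_lt_or_eq.1 hj with hj | rfl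
    · rw [eqn j hj] at ha ⊢
      obtain ⟨k, hk, he⟩ := hS.path_of_adj j hj ha
      exact ⟨k, by omega, by rw [eqp k hk, he]⟩
    · exact ⟨S.dp, by omega, by simp⟩
  · intro k hk
    rcases Nat.lt_succ_iff_lt_or_eq.1 hk with hk | rfl
    · obtain ⟨k', hk', he⟩ := hS.path_of_bounds k hk
      have := ble k hk
      have := hS.bounds_pos k hk
      exact ⟨k', by omega, by rw [eqp k' hk', eqb k hk, eqn _ (by omega), he]⟩
    · exact ⟨S.dp, by omega, by simp⟩
  · exact hS.adj_active
  · exact hS.adj_tail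
  · intro i hi hx
    by_cases hxy : F.tail i = y
    · rw [hxy, Function.update_self] at hx; omega
    · rw [eqi _ hxy] at hx; exact hS.unexplored i hi hx
  · intro i hi ha hp
    by_cases hxy : F.tail i = y
    · have := hS.unexplored i hi (by rw [hxy, h0]); omega
    · rcases hS.explored i hi ha hp with hl | ⟨hr1, hr2⟩
      · exact .inl hl
      · refine .inr ?_
        rw [eqi _ hxy, eqi _ (hne hr1)]
        refine ⟨hr1, fun k hk => ?_⟩
        rcases Nat.lt_succ_iff_lt_or_eq.1 hk with hk | rfl
        · rw [eqb k hk]; exact hr2 k hk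
        · rw [Function.update_self]
          have hix : S.idx (F.tail i) ≠ 0 := fun hz => by
            have := hS.unexplored i hi hz; omega
          have := (hS.visited _ (touched_tail hi.1) hix hp).1
          omega

/-- An arc from the topmost block of the path to a lower segment: the two topmost segments are
merged. -/
theorem merge (hS : SearchInv F m h S) (hd : 0 < S.dp) {y : ℕ} (hy : F.Touched m y)
    (hxy : F.Step m h (S.path (S.dp - 1)) y) (hi : S.idx y ≠ 0) (hp : S.parent y < F.count)
    (hlt : S.idx y < S.bounds (S.bp - 1)) : SearchInv F m h { S with bp := S.bp - 1 } := by
  have hb := hS.bp_pos' hd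
  obtain ⟨hv1, hv2⟩ := hS.visited y hy hi hp
  have hz := hS.bounds_zero (hS.sp_pos hd)
  have hb2 : 2 ≤ S.bp := by
    by_contra hc
    obtain h1 : S.bp - 1 = 0 := by omega
    rw [h1, hz] at hlt
    omega
  have lt : ∀ {k}, k < S.bp - 1 → k < S.bp := by omega
  refine ⟨hS.count_le, hS.idx_nodes, hS.parent_nodes, hS.touched_nodes, hS.visited, hS.idx_ne,
    hS.parent_lt, hS.closed, hS.same, hS.reach, fun k hk => hS.bounds_pos k (lt hk),
    fun k hk => hS.bounds_le k (lt hk), fun k k' h1 h2 => hS.bounds_mono k k' h1 (lt h2),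
    fun _ => by simp only; omega, hS.bounds_zero, ?_, hS.path_mono, hS.path_touched, hS.path_idx,
    hS.path_parent, hS.path_of_adj, fun k hk => hS.path_of_bounds k (lt hk), hS.adj_active,
    hS.adj_tail, hS.unexplored, ?_⟩
  · intro k hk j hj hkj hk'
    simp only at hk hj hkj hk' ⊢
    by_cases hj2 : j + 1 < S.bounds (S.bp - 1)
    · refine hS.segment k (by omega) j hj hkj fun k' h1 h2 => ?_
      by_cases hk2 : k' = S.bp - 1
      · rw [hk2]; exact hj2
      · exact hk' k' h1 (by omega)
    · have r1 := hS.reach_bounds hb hj (by omega)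
      have h1 := hS.bounds_le_idx hd hb
      have h2 := hS.top_le hd
      have r2 := hS.reach (S.bounds (S.bp - 1) - 1) (S.idx (S.path (S.dp - 1)) - 1) (by omega)
        (by omega)
      rw [hS.nodes_idx (by omega)] at r2
      have r3 := (r1.trans r2).tail hxy
      have hkeq : k = S.bp - 2 := by
        by_contra hne
        have e1 := hk' (S.bp - 2) (by omega) (by omega)
        have e2 := hS.bounds_mono (S.bp - 2) (S.bp - 1) (by omega) (by omega)
        omega
      subst hkeq
      rw [← hv2] at r3
      refine r3.trans ?_
      by_cases hlow : S.bounds (S.bp - 2) ≤ S.idx y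
      · refine hS.segment _ (by omega) _ (by omega) (by omega) fun k' h1 h2 => ?_
        obtain rfl : k' = S.bp - 1 := by omega
        omega
      · have := hS.bounds_le (S.bp - 2) (by omega)
        exact hS.reach _ _ (by omega) (by omega)
  · intro i hi ha hp
    rcases hS.explored i hi ha hp with hl | ⟨h1, h2⟩
    · exact .inl hl
    · exact .inr ⟨h1, fun k hk => h2 k (by simp only at hk; omega)⟩

/-- The first unexplored arc of the topmost block of the path leads to a finished component or into
the topmost segment: nothing changes. -/
theorem advance (hS : SearchInv F m h S) {link : ℕ → ℕ} (hl : F.Linked m h link) (hd : 0 < S.dp)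
    (ha : S.adj (S.path (S.dp - 1)) ≠ 0)
    (hor : F.count ≤ S.parent (F.head (S.adj (S.path (S.dp - 1)) - 1)) ∨
      (S.idx (F.head (S.adj (S.path (S.dp - 1)) - 1)) ≠ 0 ∧
        S.bounds (S.bp - 1) ≤ S.idx (F.head (S.adj (S.path (S.dp - 1)) - 1)))) :
    SearchInv F m h { S with
      adj := Function.update S.adj (S.path (S.dp - 1)) (link (S.adj (S.path (S.dp - 1)) - 1)) } := by
  set x := S.path (S.dp - 1) with hx
  have hT := hS.path_touched (S.dp - 1) (by omega)
  have hact := hS.adj_active x hT ha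
  have htl := hS.adj_tail x hT ha
  refine ⟨hS.count_le, hS.idx_nodes, hS.parent_nodes, hS.touched_nodes, hS.visited, hS.idx_ne,
    hS.parent_lt, hS.closed, hS.same, hS.reach, hS.bounds_pos, hS.bounds_le, hS.bounds_mono,
    hS.bp_pos, hS.bounds_zero, hS.segment, hS.path_mono, hS.path_touched, hS.path_idx,
    hS.path_parent, ?_, hS.path_of_bounds, ?_, ?_, ?_, ?_⟩
  · intro j hj hne
    by_cases hjx : S.nodes j = x
    · exact ⟨S.dp - 1, by simp only; omega, hjx.symm⟩
    · simp only [Function.update_of_ne hjx] at hne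
      exact hS.path_of_adj j hj hne
  · intro y hy hne
    by_cases hyx : y = x
    · subst hyx
      simp only [Function.update_self] at hne ⊢
      exact hl.active _ hact hne
    · simp only [Function.update_of_ne hyx] at hne ⊢
      exact hS.adj_active y hy hne
  · intro y hy hne
    by_cases hyx : y = x
    · rw [hyx] at hne ⊢
      simp only [Function.update_self] at hne ⊢
      rw [hl.tail _ hact hne, htl]
    · simp only [Function.update_of_ne hyx] at hne ⊢
      exact hS.adj_tail y hy hne
  · intro i hi h0
    by_cases hyx : F.tail i = x
    · rw [hyx] at h0
      exact absurd h0 (hS.path_idx _ (by omega))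
    · simp only [Function.update_of_ne hyx]
      exact hS.unexplored i hi h0
  · intro i hi hle hp
    by_cases hyx : F.tail i = x
    · simp only [hyx, Function.update_self] at hle hp ⊢
      rcases Nat.lt_trichotomy i (S.adj x - 1) with hlt | heq | hgt
      · have := hl.max _ hact i hi (by rw [hyx, htl]) hlt
        omega
      · rw [heq]
        rcases hor with ho | ⟨ho1, ho2⟩
        · exact .inl ho
        · refine .inr ⟨ho1, fun k hk _ => ?_⟩
          rcases Nat.lt_or_ge k (S.bp - 1) with hk1 | hk1
          · exact (hS.bounds_mono k (S.bp - 1) hk1 (by omega)).le.trans ho2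
          · obtain rfl : k = S.bp - 1 := by omega
            exact ho2
      · have := hS.explored i hi (by rw [hyx]; omega) (by rw [hyx]; exact hp)
        rwa [hyx] at this
    · simp only [Function.update_of_ne hyx] at hle
      exact hS.explored i hi hle hp

/-- The topmost block of the path is exhausted but does not begin a segment: it leaves the path. -/
theorem retreat (hS : SearchInv F m h S) (hd : 0 < S.dp) (ha : S.adj (S.path (S.dp - 1)) = 0)
    (hne : S.idx (S.path (S.dp - 1)) ≠ S.bounds (S.bp - 1)) :
    SearchInv F m h { S with dp := S.dp - 1 } := by
  have lt : ∀ {k}, k < S.dp - 1 → k < S.dp := by omega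
  refine ⟨hS.count_le, hS.idx_nodes, hS.parent_nodes, hS.touched_nodes, hS.visited, hS.idx_ne,
    hS.parent_lt, hS.closed, hS.same, hS.reach, hS.bounds_pos, hS.bounds_le, hS.bounds_mono,
    hS.bp_pos, hS.bounds_zero, hS.segment, fun k k' h1 h2 => hS.path_mono k k' h1 (lt h2),
    fun k hk => hS.path_touched k (lt hk), fun k hk => hS.path_idx k (lt hk),
    fun k hk => hS.path_parent k (lt hk), ?_, ?_, hS.adj_active, hS.adj_tail, hS.unexplored,
    hS.explored⟩
  · intro j hj hj0
    obtain ⟨k, hk, he⟩ := hS.path_of_adj j hj hj0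
    refine ⟨k, ?_, he⟩
    have : k ≠ S.dp - 1 := fun hk => hj0 (by rw [← he, hk, ha])
    simp only; omega
  · intro k hk
    obtain ⟨k', hk', he⟩ := hS.path_of_bounds k hk
    refine ⟨k', ?_, he⟩
    have h1 := hS.bounds_pos k hk
    have h2 := hS.bounds_le k hk
    have h3 := hS.idx_nodes (S.bounds k - 1) (by omega)
    have : k' ≠ S.dp - 1 := by
      rintro rfl
      rw [← he] at h3
      simp only at hk
      have h4 := hS.bounds_le_idx hd (by omega)
      rcases Nat.lt_or_ge k (S.bp - 1) with hk1 | hk1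
      · have := hS.bounds_mono k (S.bp - 1) hk1 (by omega); omega
      · obtain rfl : k = S.bp - 1 := by omega
        omega
    simp only; omega

/-- The topmost block of the path is exhausted and begins the topmost segment: this segment is a
strong component. -/
theorem finish (hS : SearchInv F m h S) (hd : 0 < S.dp) (ha : S.adj (S.path (S.dp - 1)) = 0)
    (heq : S.idx (S.path (S.dp - 1)) = S.bounds (S.bp - 1)) {par : ℕ → ℕ}
    (h1 : ∀ j < S.sp, S.bounds (S.bp - 1) ≤ j + 1 → par (S.nodes j) = S.count)
    (h2 : ∀ x, F.Touched m x → (∀ j < S.sp, S.bounds (S.bp - 1) ≤ j + 1 → S.nodes j ≠ x) →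
      par x = S.parent x) :
    SearchInv F m h { S with
      parent := par, sp := S.bounds (S.bp - 1) - 1, bp := S.bp - 1, dp := S.dp - 1,
      count := S.count + 1 } := by
  have hb := hS.bp_pos' hd
  set b := S.bounds (S.bp - 1) with hbdef
  have hb1 : 1 ≤ b := hS.bounds_pos _ (by omega)
  have hb2 : b ≤ S.sp := hS.bounds_le _ (by omega)
  have hcl := hS.count_le
  -- A block is either one of the segment or keeps its parent.
  have dich : ∀ x, F.Touched m x → (∃ j < S.sp, b ≤ j + 1 ∧ S.nodes j = x) ∨
      (par x = S.parent x ∧ ∀ j < S.sp, b ≤ j + 1 → S.nodes j ≠ x) := by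
    intro x hxt
    by_cases hx : ∃ j < S.sp, b ≤ j + 1 ∧ S.nodes j = x
    · exact .inl hx
    · push Not at hx
      exact .inr ⟨h2 x hxt hx, hx⟩
  have low : ∀ k < b - 1, par (S.nodes k) = S.parent (S.nodes k) := by
    intro k hk
    refine h2 _ (hS.touched_nodes k (by omega)) fun j hj hbj he => ?_
    have e1 := hS.idx_nodes j hj
    have e2 := hS.idx_nodes k (by omega)
    rw [he] at e1
    omega
  have keep : ∀ x, F.Touched m x → F.count ≤ S.parent x → par x = S.parent x := by
    intro x hx hc
    rcases dich x hx with ⟨j, hj, hbj, rfl⟩ | ⟨hp, -⟩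
    · have := hS.parent_nodes j hj; omega
    · exact hp
  have old : ∀ x, F.Touched m x → par x < F.count → par x = S.parent x := by
    intro x hxt hx
    rcases dich x hxt with ⟨j, hj, hbj, rfl⟩ | ⟨hp, -⟩
    · have := h1 j hj hbj; omega
    · exact hp
  have pmono : ∀ k < S.dp - 1, S.idx (S.path k) < b := by
    intro k hk
    rw [← heq]; exact hS.path_mono k _ hk (by omega)
  have plow : ∀ k < S.dp - 1, par (S.path k) = S.parent (S.path k) := by
    intro k hk
    have e1 := hS.path_idx k (by omega)
    have e2 := hS.nodes_idx (k := k) (by omega)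
    have := pmono k hk
    rw [← e2]; exact low _ (by omega)
  have bmono : ∀ k < S.bp - 1, S.bounds k < b := fun k hk => hS.bounds_mono k _ hk (by omega)
  -- The members of the segment are exhausted.
  have exh : ∀ j < S.sp, b ≤ j + 1 → S.adj (S.nodes j) = 0 := by
    intro j hj hbj
    by_contra hne
    obtain ⟨k, hk, he⟩ := hS.path_of_adj j hj hne
    have e1 := hS.idx_nodes j hj
    rw [← he] at e1
    rcases Nat.lt_or_ge k (S.dp - 1) with hk1 | hk1
    · have := pmono k hk1; omega
    · obtain rfl : k = S.dp - 1 := by omega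
      exact hne (he ▸ ha)
  refine ⟨by simp only; omega, fun k hk => hS.idx_nodes k (by simp only at hk; omega), ?_,
    fun k hk => hS.touched_nodes k (by simp only at hk; omega), ?_, ?_, ?_, ?_, ?_,
    fun i j hij hj => hS.reach i j hij (by simp only at hj; omega),
    fun k hk => hS.bounds_pos k (by simp only at hk; omega),
    fun k hk => by have := bmono k hk; simp only; omega,
    fun k k' hk hk' => hS.bounds_mono k k' hk (by simp only at hk'; omega), ?_, ?_, ?_,
    fun k k' hk hk' => hS.path_mono k k' hk (by simp only at hk'; omega),
    fun k hk => hS.path_touched k (by simp only at hk; omega),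
    fun k hk => hS.path_idx k (by simp only at hk; omega), ?_, ?_, ?_, hS.adj_active,
    hS.adj_tail, hS.unexplored, ?_⟩
  · intro k hk
    simp only at hk ⊢
    rw [low k hk]; exact hS.parent_nodes k (by omega)
  · intro x hx hi hp
    simp only at hi hp ⊢
    have ho := old x hx hp
    rw [ho] at hp
    obtain ⟨e1, e2⟩ := hS.visited x hx hi hp
    refine ⟨?_, e2⟩
    by_contra hc
    have := h1 (S.idx x - 1) (by omega) (by omega)
    rw [e2] at this
    omega
  · intro x hx hp
    simp only at hp ⊢
    rcases dich x hx with ⟨j, hj, hbj, rfl⟩ | ⟨hpx, -⟩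
    · rw [hS.idx_nodes j hj]; omega
    · exact hS.idx_ne x hx (by omega)
  · intro x hx
    simp only
    rcases dich x hx with ⟨j, hj, hbj, rfl⟩ | ⟨hpx, -⟩
    · rw [h1 j hj hbj]; omega
    · have := hS.parent_lt x hx; omega
  · intro i hi hp
    simp only at hp ⊢
    rcases dich (F.tail i) (touched_tail hi.1) with ⟨j, hj, hbj, he⟩ | ⟨hpx, -⟩
    · have hpt := h1 j hj hbj
      rw [he] at hpt
      have hun := hS.parent_nodes j hj
      have hadj := exh j hj hbj
      rw [he] at hun hadj
      rcases hS.explored i hi (by omega) hun with hl | ⟨e1, e2⟩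
      · rw [keep _ (touched_head hi.1) hl, hpt]
        exact ⟨hl, (hS.parent_lt _ (touched_head hi.1)).le⟩
      · by_cases hc : F.count ≤ S.parent (F.head i)
        · rw [keep _ (touched_head hi.1) hc, hpt]
          exact ⟨hc, (hS.parent_lt _ (touched_head hi.1)).le⟩
        · obtain ⟨v1, v2⟩ := hS.visited _ (touched_head hi.1) e1 (by omega)
          have e3 := e2 (S.bp - 1) (by omega) (by
            have := hS.idx_nodes j hj
            rw [he] at this
            omega)
          have := h1 (S.idx (F.head i) - 1) (by omega) (by omega)
          rw [v2] at this
          omega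
    · rw [hpx] at hp ⊢
      obtain ⟨e1, e2⟩ := hS.closed i hi hp
      rw [keep _ (touched_head hi.1) e1]
      exact ⟨e1, e2⟩
  · intro x y hx hy hp he
    simp only at hp he
    rcases dich x hx with ⟨j, hj, hbj, rfl⟩ | ⟨hpx, -⟩
    · rcases dich y hy with ⟨j', hj', hbj', rfl⟩ | ⟨hpy, -⟩
      · exact (hS.reach_bounds hb hj hbj).trans (hS.reach _ _ (by omega) hj')
      · have := h1 j hj hbj
        have := hS.parent_lt y hy
        omega
    · rcases dich y hy with ⟨j', hj', hbj', rfl⟩ | ⟨hpy, -⟩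
      · have := h1 j' hj' hbj'
        have := hS.parent_lt x hx
        omega
      · exact hS.same x y hx hy (by omega) (by omega)
  · intro hsp
    simp only at hsp ⊢
    by_contra hc
    have e0 : S.bp - 1 = 0 := by omega
    have := hS.bounds_zero (by omega)
    rw [hbdef, e0] at hsp
    omega
  · intro hsp
    exact hS.bounds_zero (by omega)
  · intro k hk j hj hkj hk'
    simp only at hk hj hkj hk' ⊢
    refine hS.segment k (by omega) j (by omega) hkj fun k' e1 e2 => ?_
    rcases Nat.lt_or_ge k' (S.bp - 1) with hk1 | hk1
    · exact hk' k' e1 hk1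
    · obtain rfl : k' = S.bp - 1 := by omega
      omega
  · intro k hk
    simp only at hk ⊢
    rw [plow k hk]; exact hS.path_parent k (by omega)
  · intro j hj hne
    simp only at hj hne ⊢
    obtain ⟨k, hk, he⟩ := hS.path_of_adj j (by omega) hne
    refine ⟨k, ?_, he⟩
    have : k ≠ S.dp - 1 := fun hk => hne (by rw [← he, hk, ha])
    omega
  · intro k hk
    simp only at hk ⊢
    obtain ⟨k', hk', he⟩ := hS.path_of_bounds k (by omega)
    refine ⟨k', ?_, he⟩
    have e1 := bmono k hk
    have e2 := hS.bounds_pos k (by omega)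
    have e3 := hS.idx_nodes (S.bounds k - 1) (by omega)
    have : k' ≠ S.dp - 1 := by
      rintro rfl
      rw [← he] at e3
      omega
    omega
  · intro i hi hle hp
    simp only at hle hp ⊢
    have ho := old _ (touched_tail hi.1) hp
    rw [ho] at hp
    rcases hS.explored i hi hle hp with hl | ⟨e1, e2⟩
    · left; rw [keep _ (touched_head hi.1) hl]; exact hl
    · exact .inr ⟨e1, fun k hk => e2 k (by omega)⟩

/-- When the path is empty, so is the stack. -/
theorem sp_eq_zero (hS : SearchInv F m h S) (hd : S.dp = 0) : S.sp = 0 := by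
  by_contra hc
  obtain ⟨k, hk, -⟩ := hS.path_of_bounds 0 (hS.bp_pos (by omega))
  omega

end SearchInv

end Forest

end MinBalance

/-! ### Symbolic execution -/

namespace MinBalance

instance : Coe Reg Opd := ⟨Opd.reg⟩

instance : Coe Instr Code := ⟨Code.ins⟩

instance (c : ℕ) : OfNat Opd c := ⟨Opd.const c⟩

infixr:60 " ;; " => Code.seq

section Simp

variable {W base cap : ℕ} {s : AS} {Q : AS → Prop}

@[simp] theorem Opd.val_reg (r : Reg) : Opd.val s (.reg r) = s.v r := rfl

@[simp] theorem Opd.val_ofNat (c : ℕ) : Opd.val s ofNat(c) = OfNat.ofNat c := rfl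

@[simp] theorem wp_seq_iff (p q : Code) : wp W base cap (p ;; q) s Q ↔
    wp W base cap p s fun s' => wp W base cap q s' Q := Iff.rfl

@[simp] theorem wp_ite_iff (b : Tst) (p q : Code) : wp W base cap (.ite b p q) s Q ↔
    (b.holds s → wp W base cap p s.wait Q) ∧ (¬ b.holds s → wp W base cap q s.wait Q) := Iff.rfl

@[simp] theorem wp_mov (r : Reg) (x : Opd) : wp W base cap (.ins (.mov r x)) s Q ↔
    Q (s.set r (x.val s) 1) := by simp [wp, Instr.pre, Instr.post]

@[simp] theorem wp_add (r : Reg) (x y : Opd) : wp W base cap (.ins (.add r x y)) s Q ↔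
    x.val s + y.val s < W ∧ Q (s.set r (x.val s + y.val s) 1) := Iff.rfl

@[simp] theorem wp_sub (r : Reg) (x y : Opd) : wp W base cap (.ins (.sub r x y)) s Q ↔
    y.val s ≤ x.val s ∧ Q (s.set r (x.val s - y.val s) 1) := Iff.rfl

@[simp] theorem wp_half (r : Reg) (x : Opd) : wp W base cap (.ins (.half r x)) s Q ↔
    Q (s.set r (x.val s / 2) 1) := by simp [wp, Instr.pre, Instr.post]

@[simp] theorem wp_ld (r : Reg) (k : Arr) (x : Opd) : wp W base cap (.ins (.ld r k x)) s Q ↔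
    x.val s < cap ∧ Q (s.set r (s.a k (x.val s)) 4) := Iff.rfl

@[simp] theorem wp_st (k : Arr) (x y : Opd) : wp W base cap (.ins (.st k x y)) s Q ↔
    x.val s < cap ∧ Q (s.put k (x.val s) (y.val s)) := Iff.rfl

@[simp] theorem wp_ldl (r : Reg) (x : Opd) : wp W base cap (.ins (.ldl r x)) s Q ↔
    x.val s < base ∧ Q (s.set r (s.low (x.val s)) 1) := Iff.rfl

@[simp] theorem wp_stl (x y : Opd) : wp W base cap (.ins (.stl x y)) s Q ↔
    x.val s < base ∧ Q (s.putLow (x.val s) (y.val s)) := Iff.rfl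

@[simp] theorem holds_eq (x y : Opd) : Tst.holds s (.eq x y) ↔ x.val s = y.val s := Iff.rfl

@[simp] theorem holds_ne (x y : Opd) : Tst.holds s (.ne x y) ↔ x.val s ≠ y.val s := Iff.rfl

@[simp] theorem holds_lt (x y : Opd) : Tst.holds s (.lt x y) ↔ x.val s < y.val s := Iff.rfl

@[simp] theorem set_v_self (r : Reg) (x c : ℕ) : (s.set r x c).v r = x := by simp [AS.set]

@[simp] theorem set_v_ne {r r' : Reg} (h : r' ≠ r) (x c : ℕ) : (s.set r x c).v r' = s.v r' := by
  simp [AS.set, h]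

@[simp] theorem set_a (r : Reg) (x c : ℕ) : (s.set r x c).a = s.a := rfl

@[simp] theorem set_low (r : Reg) (x c : ℕ) : (s.set r x c).low = s.low := rfl

@[simp] theorem set_tick (r : Reg) (x c : ℕ) : (s.set r x c).tick = s.tick + c := rfl

@[simp] theorem put_v (k : Arr) (i x : ℕ) : (s.put k i x).v = s.v := rfl

@[simp] theorem put_a_self (k : Arr) (i x : ℕ) :
    (s.put k i x).a k = upd (s.a k) i x := by simp [AS.put]

@[simp] theorem put_a_ne {k k' : Arr} (h : k' ≠ k) (i x : ℕ) : (s.put k i x).a k' = s.a k' := by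
  simp [AS.put, h]

@[simp] theorem put_low (k : Arr) (i x : ℕ) : (s.put k i x).low = s.low := rfl

@[simp] theorem put_tick (k : Arr) (i x : ℕ) : (s.put k i x).tick = s.tick + 4 := rfl

@[simp] theorem putLow_v (i x : ℕ) : (s.putLow i x).v = s.v := rfl

@[simp] theorem putLow_a (i x : ℕ) : (s.putLow i x).a = s.a := rfl

@[simp] theorem putLow_low (i x : ℕ) :
    (s.putLow i x).low = upd s.low i x := rfl

@[simp] theorem putLow_tick (i x : ℕ) : (s.putLow i x).tick = s.tick + 1 := rfl

@[simp] theorem wait_v : s.wait.v = s.v := rfl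

@[simp] theorem wait_a : s.wait.a = s.a := rfl

@[simp] theorem wait_low : s.wait.low = s.low := rfl

@[simp] theorem wait_tick : s.wait.tick = s.tick + 1 := rfl

end Simp

/-- Outside the variables `rs` and the arrays `ks`, the states `s` and `s'` agree. -/
structure Frame (rs : List Reg) (ks : List Arr) (s s' : AS) : Prop where
  v : ∀ r, r ∉ rs → s'.v r = s.v r
  a : ∀ k, k ∉ ks → s'.a k = s.a k
  low : s'.low = s.low

section FrameSimp

variable {rs : List Reg} {ks : List Arr} {s s' : AS}

@[simp] theorem Frame.refl : Frame rs ks s s := ⟨fun _ _ => rfl, fun _ _ => rfl, rfl⟩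

@[simp] theorem frame_set {r : Reg} (hr : r ∈ rs) (x c : ℕ) :
    Frame rs ks s (s'.set r x c) ↔ Frame rs ks s s' := by
  have : ∀ r', r' ∉ rs → (s'.set r x c).v r' = s'.v r' :=
    fun r' h => set_v_ne (fun he => h (by rwa [he])) x c
  exact ⟨fun h => ⟨fun r' hr' => by rw [← h.v r' hr', this r' hr'], h.a, h.low⟩,
    fun h => ⟨fun r' hr' => by rw [← h.v r' hr', this r' hr'], h.a, h.low⟩⟩

@[simp] theorem frame_put {k : Arr} (hk : k ∈ ks) (i x : ℕ) :
    Frame rs ks s (s'.put k i x) ↔ Frame rs ks s s' := by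
  have : ∀ k', k' ∉ ks → (s'.put k i x).a k' = s'.a k' :=
    fun k' h => put_a_ne (fun he => h (by rwa [he])) i x
  exact ⟨fun h => ⟨h.v, fun k' hk' => by rw [← h.a k' hk', this k' hk'], h.low⟩,
    fun h => ⟨h.v, fun k' hk' => by rw [← h.a k' hk', this k' hk'], h.low⟩⟩

@[simp] theorem frame_wait : Frame rs ks s s'.wait ↔ Frame rs ks s s' :=
  ⟨fun h => ⟨h.v, h.a, h.low⟩, fun h => ⟨h.v, h.a, h.low⟩⟩

theorem Frame.trans {s'' : AS} (h : Frame rs ks s s') (h' : Frame rs ks s' s'') :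
    Frame rs ks s s'' :=
  ⟨fun r hr => (h'.v r hr).trans (h.v r hr), fun k hk => (h'.a k hk).trans (h.a k hk),
    h'.low.trans h.low⟩

theorem Frame.mono {rs' : List Reg} {ks' : List Arr} (h : Frame rs ks s s')
    (hr : ∀ r ∈ rs, r ∈ rs') (hk : ∀ k ∈ ks, k ∈ ks') : Frame rs' ks' s s' :=
  ⟨fun r h' => h.v r fun h'' => h' (hr r h''), fun k h' => h.a k fun h'' => h' (hk k h''), h.low⟩

end FrameSimp

/-! ### Reading the input -/

open Reg Arr Instr Tst in
/-- Copy the input into arrays and initialize the permutation of the arcs. -/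
def copyInput : Code :=
  mov i 0 ;; mov j 0 ;;
  .loop (lt i m)
    (ldl t j ;; st inTail i t ;; add j j 1 ;;
     ldl t j ;; st inHead i t ;; add j j 1 ;;
     ldl t j ;; st inCost i t ;; add j j 1 ;;
     st perm i i ;; add i i 1)

section

variable {W base cap : ℕ}

theorem wp_copyInput {s : AS} {m : ℕ} (hm : s.v .m = m) (h1 : 3 * m ≤ base) (h2 : m ≤ cap)
    (h3 : 3 * m < W) :
    wp W base cap copyInput s fun s' =>
      Frame [.i, .j, .t] [.inTail, .inHead, .inCost, .perm] s s' ∧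
      (∀ i < m, s'.a .inTail i = s.low (3 * i) ∧ s'.a .inHead i = s.low (3 * i + 1) ∧
        s'.a .inCost i = s.low (3 * i + 2) ∧ s'.a .perm i = i) ∧
      s'.tick ≤ s.tick + 28 * m + 3 := by
  simp only [copyInput, wp_seq_iff, wp_mov]
  refine wp_loop (fun s' => Frame [.i, .j, .t] [.inTail, .inHead, .inCost, .perm] s s' ∧
      s'.v .i ≤ m ∧ s'.v .j = 3 * s'.v .i ∧
      (∀ i < s'.v .i, s'.a .inTail i = s.low (3 * i) ∧ s'.a .inHead i = s.low (3 * i + 1) ∧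
        s'.a .inCost i = s.low (3 * i + 2) ∧ s'.a .perm i = i) ∧
      s'.tick ≤ s.tick + 28 * s'.v .i + 2) (s.tick + 28 * m + 2) ?_ ?_ ?_ ?_
  · simp
  · rintro s' ⟨-, h1, -, -, h2⟩; omega
  · rintro s' ⟨hf, hi, hj, hs, ht⟩ hb
    have e1 : s'.v .m = m := by rw [hf.v _ (by decide), hm]
    have e2 := hf.low
    simp [e1] at hb
    simp [hf, hj, e2]
    and_intros
    any_goals omega
    intro i hi'
    rcases Nat.lt_or_eq_of_le hi' with hlt | rfl
    · have := hs i hlt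
      simpa [hlt.ne] using this
    · simp [add_assoc]
  · rintro s' ⟨hf, hi, hj, hs, ht⟩ hb
    have e1 : s'.v .m = m := by rw [hf.v _ (by decide), hm]
    simp [e1] at hb
    obtain rfl : s'.v .i = m := by omega
    exact ⟨by simpa using hf, by simpa using hs, by simp; omega⟩

end

end MinBalance

/-! ### Sorting the arcs -/

namespace MinBalance

/-- `f` is sorted by `z` on each of the intervals of length `w` into which the indices below `m` are
divided. -/
def SortedRuns (m w : ℕ) (z f : ℕ → ℕ) : Prop :=
  ∀ c a b, c * w ≤ a → a ≤ b → b < (c + 1) * w → b < m → z (f a) ≤ z (f b)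

/-- `f` maps the indices below `m` onto themselves. -/
def Rearranges (m : ℕ) (f : ℕ → ℕ) : Prop :=
  (∀ k < m, f k < m) ∧ ∀ a < m, ∃ k < m, f k = a

/-- The invariant for merging the runs of `f` on `[k₀, iE)` and on `[iE, jE)` into `g`, when the
entries before `i` and before `j` have been merged into the entries before `k`. -/
structure MergeInv (m w : ℕ) (z f g : ℕ → ℕ) (k₀ iE jE i j k : ℕ) : Prop where
  iE_eq : iE = min m (k₀ + w)
  jE_eq : jE = min m (iE + w)
  start : ∃ c, k₀ = c * (w + w)
  i_ge : k₀ ≤ i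
  i_le : i ≤ iE
  j_ge : iE ≤ j
  j_le : j ≤ jE
  sum_eq : i + j = k + iE
  lt : ∀ b < k, g b < m
  surj : ∀ a, a < i ∨ (iE ≤ a ∧ a < j) → ∃ b < k, g b = f a
  sorted : ∀ c a b, c * (w + w) ≤ a → a ≤ b → b < (c + 1) * (w + w) → b < k → z (g a) ≤ z (g b)
  below : ∀ b, k₀ ≤ b → b < k → ∀ a, (i ≤ a ∧ a < iE) ∨ (j ≤ a ∧ a < jE) → z (g b) ≤ z (f a)

/-- Merge the entry `p`, which is the next one of one of the two runs. -/
theorem MergeInv.take {m w : ℕ} {z f g : ℕ → ℕ} {k₀ iE jE i j k : ℕ}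
    (h : MergeInv m w z f g k₀ iE jE i j k) {p i' j' : ℕ}
    (hp : (p = i ∧ i < iE ∧ i' = i + 1 ∧ j' = j) ∨ (p = j ∧ j < jE ∧ i' = i ∧ j' = j + 1))
    (hf : f p < m)
    (hz : ∀ a, (i ≤ a ∧ a < iE) ∨ (j ≤ a ∧ a < jE) → z (f p) ≤ z (f a)) :
    MergeInv m w z f (upd g k (f p)) k₀ iE jE i' j' (k + 1) := by
  obtain ⟨h1, h2, ⟨c₀, h3⟩, h4, h5, h6, h7, h8, h9, h10, h11, h12⟩ := h
  have eqg : ∀ b, b < k → upd g k (f p) b = g b :=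
    fun b hb => upd_of_ne _ _ (by omega)
  refine ⟨h1, h2, ⟨c₀, h3⟩, by omega, by omega, by omega, by omega, by omega, ?_, ?_, ?_, ?_⟩
  · intro b hb
    rcases Nat.lt_succ_iff_lt_or_eq.1 hb with hb | rfl
    · rw [eqg b hb]; exact h9 b hb
    · simpa using hf
  · intro a ha
    by_cases hap : a = p
    · exact ⟨k, by omega, by simp [hap]⟩
    · obtain ⟨b, hb, he⟩ := h10 a (by omega)
      exact ⟨b, by omega, by rw [eqg b hb, he]⟩
  · intro c a b hca hab hbc hbk
    rcases Nat.lt_succ_iff_lt_or_eq.1 hbk with hb | rfl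
    · rw [eqg b hb, eqg a (by omega)]; exact h11 c a b hca hab hbc hb
    · rcases Nat.lt_or_eq_of_le hab with hab | rfl
      · have hcc : c = c₀ := by
          have e1 : b < (c₀ + 1) * (w + w) := by rw [add_mul]; omega
          have e2 : c₀ * (w + w) ≤ b := by omega
          have l1 : c < c₀ + 1 := Nat.lt_of_mul_lt_mul_right (hca.trans_lt (hab.trans e1))
          have l2 : c₀ < c + 1 := Nat.lt_of_mul_lt_mul_right (e2.trans_lt hbc)
          omega
        rw [eqg a hab, upd_self]
        exact h12 a (by rw [h3, ← hcc]; exact hca) hab p (by omega)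
      · exact le_rfl
  · intro b hb hbk a ha
    rcases Nat.lt_succ_iff_lt_or_eq.1 hbk with hb' | rfl
    · rw [eqg b hb']; exact h12 b hb hb' a (by omega)
    · rw [upd_self]; exact hz a (by omega)

/-- All the runs of `f` before `k` have been merged into `g`. -/
structure RunsMerged (m w : ℕ) (z f g : ℕ → ℕ) (k : ℕ) : Prop where
  boundary : k = m ∨ ∃ c, k = c * (w + w)
  lt : ∀ b < k, g b < m
  surj : ∀ a < k, ∃ b < k, g b = f a
  sorted : ∀ c a b, c * (w + w) ≤ a → a ≤ b → b < (c + 1) * (w + w) → b < k → z (g a) ≤ z (g b)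

theorem RunsMerged.start {m w : ℕ} {z f g : ℕ → ℕ} {k iE jE : ℕ} (h : RunsMerged m w z f g k)
    (hk : k < m) (hiE : iE = min m (k + w)) (hjE : jE = min m (iE + w)) :
    MergeInv m w z f g k iE jE k iE k :=
  ⟨hiE, hjE, h.boundary.resolve_left hk.ne, le_rfl, by omega, le_rfl, by omega, by omega, h.lt,
    fun a ha => h.surj a (by omega), h.sorted, fun b hb1 hb2 => by omega⟩

theorem MergeInv.runsMerged {m w : ℕ} {z f g : ℕ → ℕ} {k₀ iE jE i j k : ℕ}
    (h : MergeInv m w z f g k₀ iE jE i j k) (hk : k = jE) : RunsMerged m w z f g k := by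
  obtain ⟨h1, h2, ⟨c₀, h3⟩, h4, h5, h6, h7, h8, h9, h10, h11, h12⟩ := h
  refine ⟨?_, h9, fun a ha => h10 a (by omega), h11⟩
  rcases Nat.lt_or_ge (k₀ + w + w) m with hlt | hge
  · exact .inr ⟨c₀ + 1, by rw [add_mul, ← h3]; omega⟩
  · exact .inl (by omega)

/-- The entries of each of the two runs that are being merged are sorted. -/
theorem MergeInv.runs_sorted {m w : ℕ} {z f g : ℕ → ℕ} {k₀ iE jE i j k : ℕ}
    (h : MergeInv m w z f g k₀ iE jE i j k) (hs : SortedRuns m w z f) :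
    (∀ a b, i ≤ a → a ≤ b → b < iE → z (f a) ≤ z (f b)) ∧
      ∀ a b, j ≤ a → a ≤ b → b < jE → z (f a) ≤ z (f b) := by
  obtain ⟨h1, h2, ⟨c₀, h3⟩, h4, h5, h6, h7, h8, h9, h10, h11, h12⟩ := h
  constructor
  · intro a b ha hab hbE
    refine hs (2 * c₀) a b ?_ hab ?_ (by omega)
    · calc 2 * c₀ * w = k₀ := by rw [h3]; ring
        _ ≤ a := by omega
    · calc b < k₀ + w := by omega
        _ = _ := by rw [h3]; ring
  · intro a b ha hab hbE
    by_cases hlast : k₀ + w ≤ m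
    · refine hs (2 * c₀ + 1) a b ?_ hab ?_ (by omega)
      · calc (2 * c₀ + 1) * w = k₀ + w := by rw [h3]; ring
          _ ≤ a := by omega
      · calc b < k₀ + w + w := by omega
          _ = _ := by rw [h3]; ring
    · omega

open Reg Arr Instr Tst in
/-- Start merging the next pair of runs if the last one is finished. -/
def startRuns : Code :=
  .ite (eq k next)
    (mov i k ;; add iEnd k width ;; .ite (lt m iEnd) (mov iEnd m) (mov t t) ;;
     mov j iEnd ;; add jEnd j width ;; .ite (lt m jEnd) (mov jEnd m) (mov t t) ;; mov next jEnd)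
    (mov t t)

open Reg Arr Instr Tst in
/-- Take the smaller of the first entries of the two runs. -/
def mergeNext : Code :=
  .ite (lt i iEnd)
    (.ite (lt j jEnd)
      (ld p perm i ;; ld q perm j ;; ld x inCost p ;; ld y inCost q ;;
       .ite (lt y x) (mov p q ;; add j j 1) (add i i 1))
      (ld p perm i ;; add i i 1))
    (ld p perm j ;; add j j 1) ;;
  st merged k p ;; add k k 1

open Reg Arr Instr Tst in
/-- Copy the merged runs back. -/
def copyBack : Code :=
  mov i 0 ;; .loop (lt i m) (ld p merged i ;; st perm i p ;; add i i 1)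

open Reg Arr Instr Tst in
/-- Merge the sorted runs of length `width` in pairs. -/
def mergePass : Code :=
  (mov k 0 ;; mov next 0 ;; .loop (lt k m) (startRuns ;; mergeNext)) ;; copyBack

open Reg Arr Instr Tst in
/-- Sort the arcs by their costs. -/
def sortArcs : Code :=
  mov width 1 ;; .loop (lt width m) (mergePass ;; add width width width)

section

variable {W base cap : ℕ}

/-- The variables that merging changes. -/
abbrev mergeRegs : List Reg := [.k, .next, .i, .j, .iEnd, .jEnd, .p, .q, .x, .y, .t]

/-- Two runs are being merged. -/
def Merging (m w : ℕ) (z f : ℕ → ℕ) (s : AS) : Prop :=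
  s.v .k < s.v .next ∧ s.v .next = s.v .jEnd ∧ ∃ k₀, MergeInv m w z f (s.a .merged) k₀
    (s.v .iEnd) (s.v .jEnd) (s.v .i) (s.v .j) (s.v .k)

theorem wp_startRuns {s₀ s : AS} {m w : ℕ} {z f : ℕ → ℕ} (hf : Frame mergeRegs [.merged] s₀ s)
    (hm : s₀.v .m = m) (hw : s₀.v .width = w) (hw1 : 1 ≤ w) (hwm : w ≤ m) (h3 : 2 * m < W)
    (hk : s.v .k < m)
    (h : (s.v .k = s.v .next ∧ RunsMerged m w z f (s.a .merged) (s.v .k)) ∨ Merging m w z f s) :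
    wp W base cap startRuns s fun s' => Frame mergeRegs [.merged] s₀ s' ∧ s'.v .k = s.v .k ∧
      s'.tick ≤ s.tick + 10 ∧ Merging m w z f s' := by
  have e1 : s.v .m = m := by rw [hf.v _ (by decide), hm]
  have e2 : s.v .width = w := by rw [hf.v _ (by decide), hw]
  simp only [startRuns, wp_ite_iff, holds_eq, Opd.val_reg]
  refine ⟨fun hn => ?_, fun hn => ?_⟩
  · rcases h with ⟨-, h⟩ | ⟨h, -⟩
    swap
    · omega
    have key : ∀ iE jE, iE = min m (s.v .k + w) → jE = min m (iE + w) →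
        s.v .k < jE ∧ ∃ k₀, MergeInv m w z f (s.a .merged) k₀ iE jE (s.v .k) iE (s.v .k) :=
      fun iE jE hiE hjE => ⟨by omega, _, h.start hk hiE hjE⟩
    simp [e1, e2, hf, Merging]
    refine ⟨by omega, fun hlt => ⟨by omega, fun hlt2 => key _ _ (by omega) (by omega),
      fun hlt2 => ?_⟩, fun hlt => ⟨by omega, fun hlt2 => key _ _ (by omega) (by omega),
      fun hlt2 => key _ _ (by omega) (by omega)⟩⟩
    omega
  · rcases h with ⟨h, -⟩ | h
    · omega
    · simpa [hf, Merging] using h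

theorem wp_mergeNext {s₀ s : AS} {m w : ℕ} {z f : ℕ → ℕ} (hf : Frame mergeRegs [.merged] s₀ s)
    (hfe : s₀.a .perm = f) (hz : s₀.a .inCost = z) (h2 : m ≤ cap) (h3 : 2 * m < W)
    (hp : ∀ k < m, f k < m) (hs : SortedRuns m w z f) (hM : Merging m w z f s) :
    wp W base cap mergeNext s fun s' => Frame mergeRegs [.merged] s₀ s' ∧
      s'.v .k = s.v .k + 1 ∧ s'.v .k ≤ m ∧ s'.tick ≤ s.tick + 27 ∧
      ((s'.v .k = s'.v .next ∧ RunsMerged m w z f (s'.a .merged) (s'.v .k)) ∨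
        Merging m w z f s') := by
  obtain ⟨hk, hn, k₀, hM⟩ := hM
  have e3 : s.a .perm = f := by rw [hf.a _ (by decide), hfe]
  have e4 : s.a .inCost = z := by rw [hf.a _ (by decide), hz]
  have b1 := hM.iE_eq
  have b2 := hM.jE_eq
  have b3 := hM.i_le
  have b4 := hM.j_le
  have b6 := hM.j_ge
  have b7 := hM.sum_eq
  obtain ⟨left, right⟩ := hM.runs_sorted hs
  have final : ∀ g i' j', MergeInv m w z f g k₀ (s.v .iEnd) (s.v .jEnd) i' j' (s.v .k + 1) →
      (s.v .k + 1 = s.v .jEnd ∧ RunsMerged m w z f g (s.v .k + 1)) ∨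
      (s.v .k + 1 < s.v .jEnd ∧ ∃ k₀, MergeInv m w z f g k₀
        (s.v .iEnd) (s.v .jEnd) i' j' (s.v .k + 1)) := by
    intro g i' j' hM'
    rcases Nat.lt_or_ge (s.v .k + 1) (s.v .jEnd) with hlt | hge
    · exact .inr ⟨hlt, k₀, hM'⟩
    · exact .inl ⟨by omega, hM'.runsMerged (by omega)⟩
  have tL : ∀ hi : s.v .i < s.v .iEnd,
      (s.v .j < s.v .jEnd → z (f (s.v .i)) ≤ z (f (s.v .j))) → _ := fun hi hle =>
    final _ _ _ <| hM.take (.inl ⟨rfl, hi, rfl, rfl⟩) (hp _ (by omega)) fun a ha => by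
      rcases ha with ⟨ha1, ha2⟩ | ⟨ha1, ha2⟩
      · exact left _ _ le_rfl ha1 ha2
      · exact (hle (by omega)).trans (right _ _ le_rfl ha1 ha2)
  have tR : ∀ hj : s.v .j < s.v .jEnd,
      (s.v .i < s.v .iEnd → z (f (s.v .j)) ≤ z (f (s.v .i))) → _ := fun hi hle =>
    final _ _ _ <| hM.take (.inr ⟨rfl, hi, rfl, rfl⟩) (hp _ (by omega)) fun a ha => by
      rcases ha with ⟨ha1, ha2⟩ | ⟨ha1, ha2⟩
      · exact (hle (by omega)).trans (left _ _ le_rfl ha1 ha2)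
      · exact right _ _ le_rfl ha1 ha2
  simp only [mergeNext, wp_seq_iff, wp_ite_iff, holds_lt, Opd.val_reg, wait_v]
  refine ⟨fun hi => ⟨fun hj => ?_, fun hj => ?_⟩, fun hi => ?_⟩
  · have m1 := hp (s.v .i) (by omega)
    have m2 := hp (s.v .j) (by omega)
    simp [e3, e4, hf, hn, Merging]
    refine ⟨by omega, by omega, by omega, by omega, fun hlt => ?_, fun hlt => ?_⟩
    · and_intros
      any_goals omega
      exact tR hj fun _ => hlt.le
    · and_intros
      any_goals omega
      exact tL hi fun _ => hlt
  · simp [e3, hf, hn, Merging]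
    and_intros
    any_goals omega
    exact tL hi fun h => absurd h hj
  · simp [e3, hf, hn, Merging]
    and_intros
    any_goals omega
    exact tR (by omega) fun h => absurd h hi

theorem wp_copyBack {s : AS} {m : ℕ} (hm : s.v .m = m) (h2 : m ≤ cap) (h3 : 2 * m < W) :
    wp W base cap copyBack s fun s' => Frame [.i, .p] [.perm] s s' ∧
      (∀ b < m, s'.a .perm b = s.a .merged b) ∧ s'.tick ≤ s.tick + 15 * m + 2 := by
  simp only [copyBack, wp_seq_iff, wp_mov]
  refine wp_loop (fun s' => Frame [.i, .p] [.perm] s s' ∧ s'.v .i ≤ m ∧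
    (∀ b < s'.v .i, s'.a .perm b = s.a .merged b) ∧
    s'.tick ≤ s.tick + 15 * s'.v .i + 1) (s.tick + 15 * m + 1) ?_ ?_ ?_ ?_
  · simp
  · rintro s' ⟨-, h1, -, h2⟩; omega
  · rintro s' ⟨hf, hi, hc, ht⟩ hb
    have e1 : s'.v .m = m := by rw [hf.v _ (by decide), hm]
    have e2 : s'.a .merged = s.a .merged := hf.a _ (by decide)
    simp [e1] at hb
    simp [hf, e2]
    and_intros
    any_goals omega
    intro b hb
    rcases Nat.lt_or_eq_of_le hb with hlt | rfl
    · rw [upd_of_ne _ _ hlt.ne, hc b hlt]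
    · simp
  · rintro s' ⟨hf, hi, hc, ht⟩ hb
    have e1 : s'.v .m = m := by rw [hf.v _ (by decide), hm]
    simp [e1] at hb
    obtain him : s'.v .i = m := by omega
    rw [him] at hc ht
    exact ⟨by simpa using hf, hc, by simp; omega⟩

theorem wp_mergePass {s : AS} {m w : ℕ} (hm : s.v .m = m) (hw : s.v .width = w) (hw1 : 1 ≤ w)
    (hwm : w ≤ m) (h2 : m ≤ cap) (h3 : 2 * m < W) (hp : Rearranges m (s.a .perm))
    (hs : SortedRuns m w (s.a .inCost) (s.a .perm)) :
    wp W base cap mergePass s fun s' =>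
      Frame mergeRegs [.perm, .merged] s s' ∧
      Rearranges m (s'.a .perm) ∧ SortedRuns m (w + w) (s.a .inCost) (s'.a .perm) ∧
      s'.tick ≤ s.tick + 60 * m + 5 := by
  refine wp_seq (fun s' => Frame mergeRegs [.merged] s s' ∧ s'.tick ≤ s.tick + 45 * m + 3 ∧
      RunsMerged m w (s.a .inCost) (s.a .perm) (s'.a .merged) m) ?_ ?_
  · simp only [wp_seq_iff, wp_mov]
    refine wp_loop (fun s' => Frame mergeRegs [.merged] s s' ∧
      s'.tick ≤ s.tick + 45 * s'.v .k + 2 ∧ s'.v .k ≤ m ∧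
      ((s'.v .k = s'.v .next ∧
        RunsMerged m w (s.a .inCost) (s.a .perm) (s'.a .merged) (s'.v .k)) ∨
      Merging m w (s.a .inCost) (s.a .perm) s')) (s.tick + 45 * m + 2) ?_ ?_ ?_ ?_
    · simp
      exact .inl ⟨.inr ⟨0, by simp⟩, by simp, by simp, by simp⟩
    · rintro s' ⟨-, h1, h2, -⟩; omega
    · rintro s' ⟨hf, ht, hk, hs'⟩ hb
      have e1 : s'.v .m = m := by rw [hf.v _ (by decide), hm]
      simp [e1] at hb
      refine wp_seq _ (wp_startRuns (s₀ := s) (by simpa using hf) hm hw hw1 hwm h3 hb hs') ?_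
      rintro s'' ⟨hf', hk', ht', hM⟩
      refine wp_mono _ ?_ (wp_mergeNext hf' rfl rfl h2 h3 hp.1 hs hM)
      rintro s3 ⟨g1, g2, g3, g4, g5⟩
      simp at ht' hk'
      exact ⟨g1, by omega, g3, g5⟩
    · rintro s' ⟨hf, ht, hk, hs'⟩ hb
      have e1 : s'.v .m = m := by rw [hf.v _ (by decide), hm]
      simp [e1] at hb
      obtain hkm : s'.v .k = m := by omega
      refine ⟨by simpa using hf, by simp; omega, ?_⟩
      rcases hs' with ⟨-, h⟩ | ⟨g1, g2, k₀, hM⟩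
      · rwa [hkm] at h
      · have := hM.jE_eq; omega
  · rintro s' ⟨hf, ht, hM⟩
    refine wp_mono _ ?_ (wp_copyBack (m := m) (by rw [hf.v _ (by decide), hm]) h2 h3)
    rintro s'' ⟨hf', hc, ht'⟩
    refine ⟨(hf.mono (by simp) (by simp)).trans (hf'.mono (by simp) (by simp)),
      ⟨fun k hk => ?_, fun a ha => ?_⟩, fun c a b h1 h2 h3 h4 => ?_, by omega⟩
    · rw [hc k hk]; exact hM.lt k hk
    · obtain ⟨k, hk, rfl⟩ := hp.2 a ha
      obtain ⟨b, hb, he⟩ := hM.surj k hk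
      exact ⟨b, hb, by rw [hc b hb, he]⟩
    · rw [hc a (by omega), hc b h4]
      exact hM.sorted c a b h1 h2 h3 h4

theorem wp_sortArcs {s : AS} {m : ℕ} (hm : s.v .m = m) (h2 : m ≤ cap) (h3 : 2 * m < W)
    (hp : Rearranges m (s.a .perm)) :
    wp W base cap sortArcs s fun s' =>
      Frame [.width, .k, .next, .i, .j, .iEnd, .jEnd, .p, .q, .x, .y, .t] [.perm, .merged] s s' ∧
      Rearranges m (s'.a .perm) ∧
      (∀ a b, a ≤ b → b < m → s.a .inCost (s'.a .perm a) ≤ s.a .inCost (s'.a .perm b)) ∧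
      s'.tick ≤ s.tick + (60 * m + 10) * Nat.clog 2 m + 2 := by
  simp only [sortArcs, wp_seq_iff, wp_mov]
  refine wp_loop (fun s' =>
      Frame [.width, .k, .next, .i, .j, .iEnd, .jEnd, .p, .q, .x, .y, .t] [.perm, .merged] s s' ∧
      Rearranges m (s'.a .perm) ∧
      ∃ r, r ≤ Nat.clog 2 m ∧ s'.v .width = 2 ^ r ∧
        SortedRuns m (2 ^ r) (s.a .inCost) (s'.a .perm) ∧
        s'.tick ≤ s.tick + (60 * m + 10) * r + 1)
      (s.tick + (60 * m + 10) * Nat.clog 2 m + 1) ?_ ?_ ?_ ?_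
  · refine ⟨by simp, hp, 0, by omega, by simp, fun c a b h1 h2 h3 _ => ?_, by simp⟩
    obtain rfl : a = b := by simp at h1 h3; omega
    exact le_rfl
  · rintro s' ⟨-, -, r, h1, -, -, h2⟩
    have := Nat.mul_le_mul_left (60 * m + 10) h1
    omega
  · rintro s' ⟨hf, hp', r, hr, hw, hs, ht⟩ hb
    have e1 : s'.v .m = m := by rw [hf.v _ (by decide), hm]
    have e2 : s'.a .inCost = s.a .inCost := hf.a _ (by decide)
    simp [e1, hw] at hb
    refine wp_seq _ (wp_mergePass (m := m) (w := 2 ^ r) (by simpa using e1) (by simpa using hw)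
      Nat.one_le_two_pow hb.le h2 h3 (by simpa using hp') (by simpa [e2] using hs)) ?_
    rintro s'' ⟨hf', hp'', hs'', ht'⟩
    have hf3 := hf.trans ((frame_wait.2 Frame.refl).trans (hf'.mono (by simp) (by simp)))
    have e3 : s''.v .width = 2 ^ r := by rw [hf'.v _ (by decide)]; simpa using hw
    simp only [wait_a, wait_tick, e2] at hs'' ht'
    simp [hf3, e3, hp'']
    refine ⟨by omega, r + 1, ?_, by rw [pow_succ]; omega, ?_, ?_⟩
    · exact (Nat.lt_clog_iff_pow_lt (by norm_num)).2 hb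
    · rw [pow_succ, mul_two]; exact hs''
    · rw [mul_add]; omega
  · rintro s' ⟨hf, hp', r, hr, hw, hs, ht⟩ hb
    have e1 : s'.v .m = m := by rw [hf.v _ (by decide), hm]
    simp [e1, hw] at hb
    refine ⟨by simpa using hf, hp', fun a b hab hbm => ?_, ?_⟩
    · exact hs 0 a b (by simp) hab (by omega) hbm
    · have := Nat.mul_le_mul_left (60 * m + 10) hr
      simp; omega

end

end MinBalance

/-! ### Setting up the hierarchy -/

namespace MinBalance

open Reg Arr Instr Tst in
/-- Let `pw` be the least power of two that is at least `m`. -/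
def powerOfTwo : Code := mov pw 1 ;; .loop (lt pw m) (add pw pw pw)

open Reg Arr Instr Tst in
/-- Store the ends and the costs of the arcs in sorted order. -/
def gatherArcs : Code :=
  mov i 0 ;; mov z 0 ;;
  .loop (lt i pw)
    (.ite (lt i m)
      (ld p perm i ;; ld x inTail p ;; add x x 1 ;; st tail i x ;;
       ld x inHead p ;; add x x 1 ;; st head i x ;; ld z inCost p)
      (mov t t) ;;
     st cost i z ;; add i i 1)

open Reg Arr Instr Tst in
/-- The blocks of all nodes and of single nodes. -/
def initBlocks : Code :=
  st size 0 n ;; add nn n 1 ;; mov i 1 ;; .loop (lt i nn) (st size i 1 ;; add i i 1)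

section

variable {W base cap : ℕ}

theorem two_pow_clog_lt {m : ℕ} (hm : 2 ≤ m) : 2 ^ Nat.clog 2 m < 2 * m := by
  have h1 : Nat.clog 2 m ≠ 0 := (Nat.clog_pos (by norm_num) hm).ne'
  obtain ⟨r, hr⟩ := Nat.exists_eq_succ_of_ne_zero h1
  have := (Nat.lt_clog_iff_pow_lt (b := 2) (by norm_num)).1 (show r < Nat.clog 2 m by omega)
  rw [hr, pow_succ]; omega

theorem wp_powerOfTwo {s : AS} {m : ℕ} (hm : s.v .m = m) (h3 : 2 * m < W) :
    wp W base cap powerOfTwo s fun s' => Frame [.pw] [] s s' ∧ s'.v .pw = 2 ^ Nat.clog 2 m ∧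
      s'.tick ≤ s.tick + 2 * m + 2 := by
  simp only [powerOfTwo, wp_seq_iff, wp_mov]
  have hclog : Nat.clog 2 m ≤ m := (Nat.clog_le_iff_le_pow (by norm_num)).2 Nat.lt_two_pow_self.le
  refine wp_loop (fun s' => Frame [.pw] [] s s' ∧ ∃ r ≤ Nat.clog 2 m, s'.v .pw = 2 ^ r ∧
    s'.tick ≤ s.tick + 2 * r + 1) (s.tick + 2 * m + 1) ?_ ?_ ?_ ?_
  · exact ⟨by simp, 0, by simp, by simp, by simp⟩
  · rintro s' ⟨-, r, h1, -, h2⟩; omega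
  · rintro s' ⟨hf, r, hr, hw, ht⟩ hb
    have e1 : s'.v .m = m := by rw [hf.v _ (by decide), hm]
    simp [e1, hw] at hb
    simp only [wp_add, Opd.val_reg, wait_v, hw]
    refine ⟨by omega, by simp [hf], r + 1, (Nat.lt_clog_iff_pow_lt (by norm_num)).2 hb, ?_, ?_⟩
    · simp [pow_succ, mul_two]
    · simp; omega
  · rintro s' ⟨hf, r, hr, hw, ht⟩ hb
    have e1 : s'.v .m = m := by rw [hf.v _ (by decide), hm]
    simp [e1, hw] at hb
    obtain rfl : r = Nat.clog 2 m := le_antisymm hr ((Nat.clog_le_iff_le_pow (by norm_num)).2 hb)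
    exact ⟨by simpa using hf, hw, by simp; omega⟩

theorem wp_gatherArcs {s : AS} {m pw : ℕ} (hm : s.v .m = m) (hpw : s.v .pw = pw) (hmpw : m ≤ pw)
    (hpw2 : pw ≤ 2 * m) (h2 : 2 * m ≤ cap) (h3 : 2 * m < W)
    (hp : ∀ k < m, s.a .perm k < m) (ht : ∀ k < m, s.a .inTail k + 1 < W)
    (hh : ∀ k < m, s.a .inHead k + 1 < W) :
    wp W base cap gatherArcs s fun s' => Frame [.i, .z, .p, .x, .t] [.tail, .head, .cost] s s' ∧
      (∀ i < m, s'.a .tail i = s.a .inTail (s.a .perm i) + 1 ∧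
        s'.a .head i = s.a .inHead (s.a .perm i) + 1) ∧
      (∀ i < pw, s'.a .cost i = s.a .inCost (s.a .perm (min i (m - 1)))) ∧
      s'.tick ≤ s.tick + 80 * m + 3 := by
  simp only [gatherArcs, wp_seq_iff, wp_mov]
  refine wp_loop (fun s' => Frame [.i, .z, .p, .x, .t] [.tail, .head, .cost] s s' ∧ s'.v .i ≤ pw ∧
      (∀ i < s'.v .i, i < m → s'.a .tail i = s.a .inTail (s.a .perm i) + 1 ∧
        s'.a .head i = s.a .inHead (s.a .perm i) + 1) ∧
      (∀ i < s'.v .i, s'.a .cost i = s.a .inCost (s.a .perm (min i (m - 1)))) ∧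
      (0 < s'.v .i → s'.v .z = s.a .inCost (s.a .perm (min (s'.v .i - 1) (m - 1)))) ∧
      s'.tick ≤ s.tick + 40 * s'.v .i + 2) (s.tick + 80 * m + 2) ?_ ?_ ?_ ?_
  · simp
  · rintro s' ⟨-, h1, -, -, -, h2⟩; omega
  · rintro s' ⟨hf, hi, hs, hc, hz, ht'⟩ hb
    have e1 : s'.v .m = m := by rw [hf.v _ (by decide), hm]
    have e2 : s'.v .pw = pw := by rw [hf.v _ (by decide), hpw]
    have e3 : s'.a .perm = s.a .perm := hf.a _ (by decide)
    have e4 : s'.a .inTail = s.a .inTail := hf.a _ (by decide)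
    have e5 : s'.a .inHead = s.a .inHead := hf.a _ (by decide)
    have e6 : s'.a .inCost = s.a .inCost := hf.a _ (by decide)
    simp [e2] at hb
    simp [hf, e1, e3, e4, e5, e6]
    refine ⟨fun hlt => ?_, fun hge => ?_⟩
    · have q1 := hp _ hlt
      have q2 := ht _ q1
      have q3 := hh _ q1
      have q4 : min (s'.v .i) (m - 1) = s'.v .i := by omega
      and_intros
      any_goals omega
      · intro i hi' him
        rcases Nat.lt_or_eq_of_le hi' with hlt | rfl
        · simpa [hlt.ne] using hs i hlt him
        · simp
      · intro i hi'
        rcases Nat.lt_or_eq_of_le hi' with hlt | rfl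
        · simpa [hlt.ne] using hc i hlt
        · simp [q4]
      · rw [q4]
    · have q4 : min (s'.v .i) (m - 1) = min (s'.v .i - 1) (m - 1) := by omega
      have q5 := hz (by omega)
      and_intros
      any_goals omega
      · intro i hi' him
        exact hs i (by omega) him
      · intro i hi'
        rcases Nat.lt_or_eq_of_le hi' with hlt | rfl
        · simpa [hlt.ne] using hc i hlt
        · simp [q4, q5]
      · rw [q4, q5]
  · rintro s' ⟨hf, hi, hs, hc, hz, ht'⟩ hb
    have e2 : s'.v .pw = pw := by rw [hf.v _ (by decide), hpw]
    simp [e2] at hb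
    obtain hpi : s'.v .i = pw := by omega
    rw [hpi] at hs hc ht'
    exact ⟨by simpa using hf, fun i hi => hs i (by omega) hi, hc, by simp; omega⟩

theorem wp_initBlocks {s : AS} {n : ℕ} (hn : s.v .n = n) (h2 : n < cap) (h3 : n + 2 < W) :
    wp W base cap initBlocks s fun s' => Frame [.i, .nn] [.size] s s' ∧ s'.v .nn = n + 1 ∧
      (s'.a .size 0 = n) ∧ (∀ x, 1 ≤ x → x ≤ n → s'.a .size x = 1) ∧
      (∀ x, n < x → s'.a .size x = s.a .size x) ∧
      s'.tick ≤ s.tick + 7 * n + 10 := by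
  simp only [initBlocks, wp_seq_iff, wp_mov, wp_st, wp_add]
  refine ⟨by simp; omega, by simp [hn]; omega, ?_⟩
  refine wp_loop (fun s' => Frame [.i, .nn] [.size] s s' ∧ s'.v .nn = n + 1 ∧
      (s'.a .size 0 = n) ∧ 1 ≤ s'.v .i ∧ s'.v .i ≤ n + 1 ∧
      (∀ x, 1 ≤ x → x < s'.v .i → s'.a .size x = 1) ∧
      (∀ x, n < x → s'.a .size x = s.a .size x) ∧
      s'.tick ≤ s.tick + 7 * s'.v .i) (s.tick + 7 * n + 7) ?_ ?_ ?_ ?_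
  · simp [hn]
    refine ⟨fun x h1 h2 => by omega, fun x hx => ?_⟩
    rw [upd_of_ne _ _ (by omega)]
  · rintro s' ⟨-, -, -, -, h1, -, -, h2⟩; omega
  · rintro s' ⟨hf, hnn, h0, hi1, hi2, hs, hu, ht⟩ hb
    simp [hnn] at hb
    simp [hf, hnn]
    and_intros
    any_goals omega
    · rw [upd_of_ne _ _ (by omega), h0]
    · intro x h1 h2
      rcases Nat.lt_or_eq_of_le h2 with hlt | rfl
      · simpa [hlt.ne] using hs x h1 hlt
      · simp
    · intro x hx
      rw [upd_of_ne _ _ (by omega), hu x hx]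
  · rintro s' ⟨hf, hnn, h0, hi1, hi2, hs, hu, ht⟩ hb
    simp [hnn] at hb
    exact ⟨by simpa using hf, hnn, h0, fun x h1 h2 => hs x h1 (by omega), hu, by simp; omega⟩

end

end MinBalance

/-! ### Forming the block of a component -/

namespace MinBalance

open Finset

/-- The hierarchy of blocks that is stored in the arrays. -/
def AS.forest (s : AS) : Forest where
  tail := s.a .tail
  head := s.a .head
  parent := s.a .parent
  level := s.a .level
  size := s.a .size
  count := s.v .nn

/-- The state of the search that is stored in the arrays. -/
def AS.search (s : AS) : Forest.Search where
  idx := s.a .idx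
  nodes := s.a .nodes
  bounds := s.a .bounds
  path := s.a .path
  adj := s.a .adj
  parent := s.a .parent
  sp := s.v .sp
  bp := s.v .bp
  dp := s.v .dp
  count := s.v .nn

/-- The log is a list of pairs of a block `c j` and a parent `p j`. Processing it from its end adds to
the potential of each block that of the parent. All sums that occur are at most `B`, and the final
potential has the property `Q`. -/
def Unrolls (B : ℕ) (Q : (ℕ → ℕ) → Prop) (c p : ℕ → ℕ) : ℕ → (ℕ → ℕ) → Prop
  | 0, φ => Q φ
  | k + 1, φ => φ (c k) + φ (p k) ≤ B ∧ Unrolls B Q c p k (upd φ (c k) (φ (c k) + φ (p k)))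

theorem Unrolls.congr {B : ℕ} {Q : (ℕ → ℕ) → Prop} {c p c' p' : ℕ → ℕ} {k : ℕ}
    (hc : ∀ j < k, c' j = c j) (hp : ∀ j < k, p' j = p j) :
    ∀ {φ : ℕ → ℕ}, Unrolls B Q c p k φ → Unrolls B Q c' p' k φ := by
  induction k with
  | zero => exact fun h => h
  | succ k ih =>
    intro φ h
    simp only [Unrolls, hc k (by omega), hp k (by omega)] at h ⊢
    exact ⟨h.1, ih (fun j hj => hc j (by omega)) (fun j hj => hp j (by omega)) h.2⟩

/-- The blocks formed during a search in the forest `F`, when the last one may still be incomplete.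
If the potential that results from the log of the search is bounded by `B`, then the whole log
can be processed if the log before the search can. -/
structure Blocks (F : Forest) (m h B : ℕ) (P : (ℕ → ℕ) → Prop) (Q : (ℕ → ℕ) → Prop) (s : AS) :
    Prop where
  count_le : F.count ≤ s.v .nn
  parent_old : ∀ x < F.count, s.a .parent x < F.count → s.a .parent x = F.parent x
  parent_untouched : ∀ x < F.count, ¬ F.Touched m x → s.a .parent x = F.parent x
  level_old : ∀ x < F.count, s.a .level x = F.level x
  size_old : ∀ x < F.count, s.a .size x = F.size x
  level_new : ∀ x, F.Touched m x → F.count ≤ s.a .parent x →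
    s.a .level (s.a .parent x) = F.level x + h
  parent_new : ∀ x, F.Touched m x → F.count ≤ s.a .parent x →
    s.a .parent (s.a .parent x) = F.parent x
  used : ∀ b, F.count ≤ b → b < s.v .nn → ∃ x, F.Touched m x ∧ s.a .parent x = b
  size_sum : ∀ M p, ∑ x ∈ Ico 1 M with s.a .parent x = p, s.a .size x ≤ s.a .size p
  size_zero : ∀ x, s.v .nn < x → s.a .size x = 0
  log_le : ∀ j < s.v .ln, s.a .logChild j ≤ s.v .nn ∧ s.a .logParent j ≤ s.v .nn
  log : ∀ φ, (∀ x, 1 ≤ x → x < F.count → F.wrap s.forest φ x ≤ B) →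
    P (F.wrap s.forest φ) → Unrolls B Q (s.a .logChild) (s.a .logParent) (s.v .ln) φ

section

variable {F : Forest} {m h B : ℕ} {P Q : (ℕ → ℕ) → Prop} {s s' : AS}

theorem wrap_forest (φ : ℕ → ℕ) (x : ℕ) : F.wrap s.forest φ x =
    if x < F.count ∧ F.count ≤ s.a .parent x then φ x + φ (s.a .parent x) else φ x := rfl

theorem sum_eq_add_add {A : Finset ℕ} {z b : ℕ} (hzb : z ≠ b) (f : ℕ → ℕ) :
    ∑ x ∈ A, f x = (∑ x ∈ (A.erase z).erase b, f x) + (if z ∈ A then f z else 0) +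
      if b ∈ A then f b else 0 := by
  have h1 : ∀ (A : Finset ℕ) (z : ℕ),
      ∑ x ∈ A, f x = (∑ x ∈ A.erase z, f x) + if z ∈ A then f z else 0 := by
    intro A z
    split_ifs with h
    · exact (sum_erase_add _ _ h).symm
    · rw [erase_eq_of_notMem h, add_zero]
  rw [h1 A z, h1 (A.erase z) b]
  simp only [mem_erase, ne_eq, hzb.symm, not_false_eq_true, true_and]
  omega

/-- Moving a block `z` with parent `q` into the child `b` of `q` preserves the inequality between the
size of a block and the sizes of its children. -/
theorem size_sum_move {par size : ℕ → ℕ} {z b : ℕ} (hz1 : 1 ≤ z) (hzb : z < b)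
    (hq : par z ≠ b) (hb : size b = 0 ∨ par b = par z)
    (h : ∀ M p, ∑ x ∈ Ico 1 M with par x = p, size x ≤ size p) (M p : ℕ) :
    ∑ x ∈ Ico 1 M with upd (upd par b (par z)) z b x = p, upd size b (size b + size z) x ≤
      upd size b (size b + size z) p := by
  have key := h M p
  rw [sum_filter, sum_eq_add_add hzb.ne] at key ⊢
  have hsum : ∑ x ∈ ((Ico 1 M).erase z).erase b, (if upd (upd par b (par z)) z b x = p then
      upd size b (size b + size z) x else 0) =
      ∑ x ∈ ((Ico 1 M).erase z).erase b, if par x = p then size x else 0 := by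
    refine sum_congr rfl fun x hx => ?_
    simp only [mem_erase] at hx
    rw [upd_of_ne _ _ hx.2.1, upd_of_ne _ _ hx.1, upd_of_ne _ _ hx.1]
  rw [hsum]
  simp only [mem_Ico, upd_self, upd_of_ne _ _ hzb.ne', upd_of_ne _ _ hzb.ne] at key ⊢
  by_cases hpb : p = b
  · subst hpb
    rw [upd_self]
    split_ifs at key ⊢ <;> omega
  · rw [upd_of_ne _ _ hpb]
    rcases hb with hb | hb <;> split_ifs at key ⊢ <;> omega

/-- Adding a block `z` to the block under construction. -/
theorem Blocks.assign (hB : Blocks F m h B P Q s) {z : ℕ} (hz : F.Touched m z) (hz1 : 1 ≤ z)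
    (hzc : z < F.count) (hpz : s.a .parent z < F.count)
    (hb : s.a .size (s.v .nn) = 0 ∨ s.a .parent (s.v .nn) = F.parent z)
    (heq : ∀ x, F.Touched m x → s.a .parent x = s.v .nn → F.level x = F.level z ∧
      F.parent x = F.parent z) (hlt : ∀ x, F.Touched m x → x < F.count)
    (h1 : s'.a .parent = upd (upd (s.a .parent) (s.v .nn) (s.a .parent z)) z (s.v .nn))
    (h2 : s'.a .level = upd (s.a .level) (s.v .nn) (s.a .level z + h))
    (h3 : s'.a .size = upd (s.a .size) (s.v .nn) (s.a .size (s.v .nn) + s.a .size z))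
    (h4 : s'.a .logChild = upd (s.a .logChild) (s.v .ln) z)
    (h5 : s'.a .logParent = upd (s.a .logParent) (s.v .ln) (s.v .nn))
    (h6 : s'.v .ln = s.v .ln + 1) (h7 : s'.v .nn = s.v .nn) : Blocks F m h B P Q s' := by
  have hcl := hB.count_le
  have hpz' := hB.parent_old z hzc hpz
  have hzb : z < s.v .nn := by omega
  have par : ∀ x, x < F.count → x ≠ z → s'.a .parent x = s.a .parent x := by
    intro x hx hxz
    rw [h1, upd_of_ne _ _ hxz, upd_of_ne _ _ (by omega)]
  have parz : s'.a .parent z = s.v .nn := by rw [h1, upd_self]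
  have parb : s'.a .parent (s.v .nn) = F.parent z := by
    rw [h1, upd_of_ne _ _ hzb.ne', upd_self, hpz']
  have levb : s'.a .level (s.v .nn) = F.level z + h := by
    rw [h2, upd_self, hB.level_old z hzc]
  refine ⟨by omega, ?_, ?_, ?_, ?_, ?_, ?_, ?_, ?_, ?_, ?_, ?_⟩
  · intro x hx hp
    by_cases hxz : x = z
    · subst hxz; omega
    · rw [par x hx hxz] at hp ⊢
      exact hB.parent_old x hx hp
  · intro x hx ht
    rw [par x hx (fun hxz => ht (hxz ▸ hz)), hB.parent_untouched x hx ht]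
  · intro x hx
    rw [h2, upd_of_ne _ _ (by omega), hB.level_old x hx]
  · intro x hx
    rw [h3, upd_of_ne _ _ (by omega), hB.size_old x hx]
  · intro x hx hp
    by_cases hxz : x = z
    · subst hxz; rw [parz, levb]
    · rw [par x (hlt x hx) hxz] at hp ⊢
      by_cases hxb : s.a .parent x = s.v .nn
      · rw [hxb, levb, (heq x hx hxb).1]
      · rw [h2, upd_of_ne _ _ hxb]
        exact hB.level_new x hx hp
  · intro x hx hp
    by_cases hxz : x = z
    · subst hxz; rw [parz, parb]
    · rw [par x (hlt x hx) hxz] at hp ⊢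
      by_cases hxb : s.a .parent x = s.v .nn
      · rw [hxb, parb, (heq x hx hxb).2]
      · rw [h1, upd_of_ne _ _ (by omega), upd_of_ne _ _ hxb]
        exact hB.parent_new x hx hp
  · intro b hb hbn
    obtain ⟨x, hx, hxb⟩ := hB.used b hb (by omega)
    refine ⟨x, hx, ?_⟩
    rw [par x (hlt x hx) (by rintro rfl; omega), hxb]
  · intro M p
    rw [h1, h3]
    exact size_sum_move hz1 hzb (by omega) (by omega) hB.size_sum M p
  · intro x hx
    rw [h3, upd_of_ne _ _ (by omega)]
    exact hB.size_zero x (by omega)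
  · intro j hj
    rw [h4, h5, h7]
    rcases Nat.lt_succ_iff_lt_or_eq.1 (h6 ▸ hj) with hj | rfl
    · rw [upd_of_ne _ _ hj.ne, upd_of_ne _ _ hj.ne]
      exact hB.log_le j hj
    · rw [upd_self, upd_self]
      exact ⟨hzb.le, le_rfl⟩
  · intro φ hbd hφ
    have hwz : F.wrap s'.forest φ z = φ z + φ (s.v .nn) := by
      rw [wrap_forest, parz]
      rw [if_pos ⟨hzc, hcl⟩]
    have hw : F.wrap s'.forest φ = F.wrap s.forest (upd φ z (φ z + φ (s.v .nn))) := by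
      funext x
      by_cases hxz : x = z
      · subst hxz
        rw [hwz, wrap_forest, if_neg (by omega), upd_self]
      · by_cases hx : x < F.count
        · simp only [wrap_forest, par x hx hxz, upd_of_ne _ _ hxz]
          split_ifs with hc
          · rw [upd_of_ne _ _ (by omega)]
          · rfl
        · simp [wrap_forest, hx, hxz]
    rw [h6]
    simp only [Unrolls, h4, h5, upd_self]
    refine ⟨hwz ▸ hbd z hz1 hzc, ?_⟩
    rw [hw] at hbd hφ
    exact (hB.log _ hbd hφ).congr (fun j hj => upd_of_ne _ _ (by omega))
      (fun j hj => upd_of_ne _ _ (by omega))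

theorem Forest.Hierarchy.eq_of_steps {G : SortedArcs} {H : ℕ} (hF : F.Hierarchy G H) {x y : ℕ}
    (hxy : F.Steps G.m h x y) : F.level y = F.level x ∧ F.parent y = F.parent x := by
  induction hxy with
  | refl => exact ⟨rfl, rfl⟩
  | tail _ hs ih =>
    obtain ⟨i, ⟨hi, -⟩, rfl, rfl⟩ := hs
    rw [← hF.level_eq i hi, ← hF.parent_eq i hi]
    exact ih

end

end MinBalance

/-! ### The program that searches for components -/

namespace MinBalance

open Finset

open Reg Arr Instr Tst in
/-- Move the topmost block of the stack into the new block `nn`. -/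
def assignTop : Code :=
  sub sp sp 1 ;; ld z nodes sp ;; ld t parent z ;; st parent nn t ;; st parent z nn ;;
  ld t level z ;; add t t h ;; st level nn t ;;
  ld t size z ;; ld s size nn ;; add t s t ;; st size nn t ;;
  st logChild ln z ;; st logParent ln nn ;; add ln ln 1

open Reg Arr Instr Tst in
/-- Make the topmost segment, which begins at the height `u`, a new block. -/
def finishSegment : Code :=
  sub u u 1 ;; .loop (lt u sp) assignTop ;; sub bp bp 1 ;; sub dp dp 1 ;; add nn nn 1

/-- The parameters of a search: the blocks have been formed down to the width `2 * h`, and words and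
arrays are large enough. -/
structure Room (G : SortedArcs) (F : Forest) (h l W cap : ℕ) : Prop where
  hierarchy : F.Hierarchy G (2 * h)
  cap_lt : cap < W
  n_lt : G.n < W
  pw_lt : G.pw < W
  ends_le : 2 * G.m ≤ cap
  count_lt : F.count + 2 * G.m < cap
  log_le : l + 2 * G.m ≤ cap

open Classical in
/-- The number of ends of arcs that the search has not visited. -/
noncomputable def unvisited (F : Forest) (m : ℕ) (idx : ℕ → ℕ) : ℕ :=
  #{x ∈ range F.count | F.Touched m x ∧ idx x = 0}

/-- The number of arcs that the search has not explored. -/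
def unexplored (F : Forest) (m : ℕ) (adj : ℕ → ℕ) : ℕ := #{i ∈ range m | i < adj (F.tail i)}

/-- The invariant of the search program. -/
structure Progress (G : SortedArcs) (F : Forest) (h B l : ℕ) (P Q : (ℕ → ℕ) → Prop) (s : AS) :
    Prop where
  m_eq : s.v .m = G.m
  h_eq : s.v .h = h
  nn0_eq : s.v .nn0 = F.count
  tail_eq : s.a .tail = F.tail
  head_eq : s.a .head = F.head
  linked : F.Linked G.m h (s.a .link)
  search : F.SearchInv G.m h s.search
  blocks : Blocks F G.m h B P Q s
  size_nn : s.a .size (s.v .nn) = 0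
  le_log : l ≤ s.v .ln
  log_le : s.v .ln + s.v .sp + unvisited F G.m (s.a .idx) ≤ l + 2 * G.m
  count_le : s.v .nn + s.v .bp + unvisited F G.m (s.a .idx) ≤ F.count + 2 * G.m
  path_le : s.v .dp + unvisited F G.m (s.a .idx) ≤ 2 * G.m

/-- The potential function of the running time of the search: every step takes at most 100 units of
time for each unit by which the sum decreases. An unvisited block counts four times, because pushing
it increases the heights of three stacks. -/
noncomputable def work (G : SortedArcs) (F : Forest) (s : AS) : ℕ :=
  100 * (4 * unvisited F G.m (s.a .idx) + s.v .sp + s.v .bp + s.v .dp +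
    unexplored F G.m (s.a .adj))

section

variable {G : SortedArcs} {F : Forest} {h B l W base cap : ℕ} {P Q : (ℕ → ℕ) → Prop} {s s' : AS}

theorem Blocks.congr {m : ℕ} (hB : Blocks F m h B P Q s) (h1 : s'.a .parent = s.a .parent)
    (h2 : s'.a .level = s.a .level) (h3 : s'.a .size = s.a .size)
    (h4 : s'.a .logChild = s.a .logChild) (h5 : s'.a .logParent = s.a .logParent)
    (h6 : s'.v .nn = s.v .nn) (h7 : s'.v .ln = s.v .ln) : Blocks F m h B P Q s' := by
  have hw : ∀ φ, F.wrap s'.forest φ = F.wrap s.forest φ := fun φ => by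
    funext x; simp only [wrap_forest, h1]
  obtain ⟨a1, a2, a3, a4, a5, a6, a7, a8, a9, a10, a11, a12⟩ := hB
  refine ⟨?_, ?_, ?_, ?_, ?_, ?_, ?_, ?_, ?_, ?_, ?_, ?_⟩ <;>
    simp only [h1, h2, h3, h4, h5, h6, h7, hw] <;> assumption

theorem Progress.congr (hP : Progress G F h B l P Q s)
    (hf : Frame [.i, .x, .y, .z, .s, .t, .u, .e] [] s s') : Progress G F h B l P Q s' := by
  have ha : ∀ k, s'.a k = s.a k := fun k => hf.a k (by simp)
  have hv : ∀ r, r ∉ [Reg.i, .x, .y, .z, .s, .t, .u, .e] → s'.v r = s.v r := hf.v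
  have hS : s'.search = s.search := by
    simp only [AS.search, ha, hv .sp (by decide), hv .bp (by decide), hv .dp (by decide),
      hv .nn (by decide)]
  obtain ⟨a1, a2, a3, a4, a5, a6, a7, a8, a9, a10, a11, a12, a13⟩ := hP
  refine ⟨?_, ?_, ?_, ?_, ?_, ?_, ?_, a8.congr (ha _) (ha _) (ha _) (ha _) (ha _)
    (hv _ (by decide)) (hv _ (by decide)), ?_, ?_, ?_, ?_, ?_⟩ <;>
    simp only [hS, ha, hv .m (by decide), hv .h (by decide), hv .nn0 (by decide),
      hv .ln (by decide), hv .sp (by decide), hv .bp (by decide), hv .dp (by decide),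
      hv .nn (by decide)] <;> assumption

theorem unvisited_update {m y : ℕ} {idx : ℕ → ℕ} (hy : F.Touched m y) (hlt : y < F.count)
    (h0 : idx y = 0) (k : ℕ) : unvisited F m (upd idx y (k + 1)) + 1 = unvisited F m idx := by
  classical
  unfold unvisited
  have : (range F.count).filter (fun x => F.Touched m x ∧ upd idx y (k + 1) x = 0) =
      ((range F.count).filter (fun x => F.Touched m x ∧ idx x = 0)).erase y := by
    ext x
    by_cases hx : x = y
    · subst hx; simp
    · simp [hx]
  have hmem : y ∈ (range F.count).filter (fun x => F.Touched m x ∧ idx x = 0) := by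
    simp [hy, hlt, h0]
  rw [this, card_erase_add_one hmem]

theorem unexplored_update {m x k : ℕ} {adj : ℕ → ℕ} (h0 : adj x ≠ 0) (hm : adj x - 1 < m)
    (hx : F.tail (adj x - 1) = x) (hk : k ≤ adj x - 1) :
    unexplored F m (upd adj x k) + 1 ≤ unexplored F m adj := by
  unfold unexplored
  refine card_lt_card ?_
  rw [ssubset_iff_of_subset]
  · refine ⟨adj x - 1, ?_, ?_⟩
    · simp only [mem_filter, mem_range, hx]; omega
    · simp only [mem_filter, mem_range, hx, upd_self]; omega
  · intro i
    simp only [mem_filter, mem_range]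
    by_cases hix : F.tail i = x
    · rw [hix, upd_self]; omega
    · rw [upd_of_ne _ _ hix]; exact id

/-- The invariant of the loop that forms a block of the topmost segment. -/
structure Assigning (G : SortedArcs) (F : Forest) (h B l : ℕ) (P Q : (ℕ → ℕ) → Prop) (s s' : AS) :
    Prop where
  frame : Frame [.z, .s, .t, .sp, .ln] [.parent, .level, .size, .logChild, .logParent] s s'
  blocks : Blocks F G.m h B P Q s'
  sp_ge : s.v .u ≤ s'.v .sp
  sp_le : s'.v .sp ≤ s.v .sp
  members : ∀ j, s'.v .sp ≤ j → j < s.v .sp → s'.a .parent (s.a .nodes j) = s.v .nn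
  others : ∀ x, F.Touched G.m x → (∀ j, s'.v .sp ≤ j → j < s.v .sp → s.a .nodes j ≠ x) →
    s'.a .parent x = s.a .parent x
  size_nn : s'.a .size (s.v .nn) = 0 ∨
    s'.a .parent (s.v .nn) = F.parent (s.a .path (s.v .dp - 1))
  ln_eq : s'.v .ln + s'.v .sp = s.v .ln + s.v .sp
  tick_le : s'.tick + 50 * s'.v .sp ≤ s.tick + 50 * s.v .sp

/-- The members of a segment reach each other, so that they agree in parent and level, and the values
stored for the new block do not depend on the member. -/
theorem wp_assignTop (hR : Room G F h l W cap) (hP : Progress G F h B l P Q s) (hd : 0 < s.v .dp)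
    (hu : s.v .u = s.a .bounds (s.v .bp - 1) - 1) (hA : Assigning G F h B l P Q s s')
    (hlt : s'.v .u < s'.v .sp) :
    wp W base cap assignTop s'.wait (Assigning G F h B l P Q s) := by
  obtain ⟨hf, hB, hge, hle, hmem, hoth, hnn, hln, htick⟩ := hA
  have hS := hP.search
  have hb := hS.bp_pos' hd
  have hbound := hS.bounds_le (s.v .bp - 1) (by simp only [AS.search] at hb ⊢; omega)
  have hbpos := hS.bounds_pos (s.v .bp - 1) (by simp only [AS.search] at hb ⊢; omega)
  simp only [AS.search] at hbound hbpos
  have e1 : s'.v .u = s.v .u := hf.v _ (by decide)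
  have e2 : s'.v .nn = s.v .nn := hf.v _ (by decide)
  have e3 : s'.v .h = h := by rw [hf.v _ (by decide), hP.h_eq]
  have e4 : s'.a .nodes = s.a .nodes := hf.a _ (by decide)
  rw [e1] at hlt
  set j := s'.v .sp - 1 with hj
  set z := s.a .nodes j with hz
  have hjs : j < s.v .sp := by omega
  have hzt : F.Touched G.m z := hS.touched_nodes j hjs
  have hz1 := hR.hierarchy.touched_pos hzt
  have hzc := hR.hierarchy.touched_lt hzt
  have hidx : ∀ k < s.v .sp, s.a .idx (s.a .nodes k) = k + 1 := hS.idx_nodes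
  have hpar : s'.a .parent z = s.a .parent z := by
    refine hoth z hzt fun k hk hk' he => ?_
    have h1 := hidx k hk'
    have h2 := hidx j hjs
    rw [he, hz, h2] at h1
    omega
  have hpz : s.a .parent z < F.count := hS.parent_nodes j hjs
  have hpz' : s'.a .parent z = F.parent z := hB.parent_old z hzc (by omega)
  have hlevz : s'.a .level z = F.level z := hB.level_old z hzc
  -- All members of the segment have the parent and the level of the topmost block of the path.
  have hst : ∀ k < s.v .sp, s.a .bounds (s.v .bp - 1) ≤ k + 1 →
      F.level (s.a .path (s.v .dp - 1)) = F.level (s.a .nodes k) ∧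
      F.parent (s.a .path (s.v .dp - 1)) = F.parent (s.a .nodes k) := fun k hk _ =>
    hR.hierarchy.eq_of_steps (hS.reach_top hd hk)
  have hz2 := hst j hjs (by omega)
  have hnlt : ∀ x, F.Touched G.m x → x < F.count := fun x hx => hR.hierarchy.touched_lt hx
  have hcl := hB.count_le
  rw [e2] at hcl
  have hcnt := hP.count_le
  have hlog := hP.log_le
  have hRc := hR.count_lt
  have hRl := hR.log_le
  have hRe := hR.ends_le
  have hlev := hR.hierarchy.level_le z hz1 hzc
  have hRp := hR.pw_lt
  have hRn := hR.n_lt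
  have hRw := hR.cap_lt
  -- The size of the new block does not exceed that of its parent.
  have hsz : s'.a .size (s.v .nn) + s'.a .size z ≤ G.n := by
    have hmove := size_sum_move hz1 (show z < s.v .nn by omega) (par := s'.a .parent) (by omega)
      (by rw [hpz', ← hz2.2]; exact hnn) hB.size_sum
    have hP0 := hR.hierarchy.parent_lt z hz1 hzc
    have := hmove (s.v .nn + 1) (F.parent z)
    rw [hpz', upd_of_ne _ _ (by omega), hB.size_old _ hP0] at this
    have hin : s.v .nn ∈ (Ico 1 (s.v .nn + 1)).filter
        (fun x => upd (upd (s'.a .parent) (s.v .nn) (F.parent z)) z (s.v .nn) x = F.parent z) := by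
      simp only [mem_filter, mem_Ico]
      refine ⟨by omega, ?_⟩
      rw [upd_of_ne _ _ (by omega), upd_self]
    have h1 := single_le_sum (f := upd (s'.a .size) (s.v .nn)
      (s'.a .size (s.v .nn) + s'.a .size z)) (fun _ _ => Nat.zero_le _) hin
    simp only [upd_self] at h1
    exact h1.trans (this.trans (hR.hierarchy.size_le _ hP0))
  have hzn : z ≠ s.v .nn := by omega
  simp [assignTop, e2, e3, e4, ← hj, ← hz, hpz', hlevz]
  and_intros
  any_goals omega
  have hpn : s'.a .parent z < F.count := by omega
  refine ⟨by simp [hf], hB.assign hzt hz1 hzc hpn ?_ ?_ hnlt ?_ ?_ ?_ ?_ ?_ ?_ ?_, ?_, ?_, ?_, ?_,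
    ?_, ?_, ?_⟩
  · rw [e2, ← hz2.2]; exact hnn
  · intro x hx hpx
    rw [e2] at hpx
    by_cases hex : ∃ k, s'.v .sp ≤ k ∧ k < s.v .sp ∧ s.a .nodes k = x
    · obtain ⟨k, hk1, hk2, rfl⟩ := hex
      have := hst k hk2 (by omega)
      exact ⟨this.1.symm.trans hz2.1, this.2.symm.trans hz2.2⟩
    · have h1 := hoth x hx fun k h1 h2 h3 => hex ⟨k, h1, h2, h3⟩
      have h2 : s.a .parent x < s.v .nn := hS.parent_lt x hx
      omega
  · simp [e2, hpz']
  · simp [e2, hlevz]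
  · simp [e2]
  · simp
  · simp [e2]
  · simp
  · simp
  · simp; omega
  · simp; omega
  · intro k hk1 hk2
    simp at hk1 ⊢
    rcases Nat.eq_or_lt_of_le hk1 with rfl | hk1
    · rw [← hz, upd_self]
    · have h1 : s.a .nodes k ≠ z := fun he => by
        have h1 := hidx k hk2
        rw [he, hz, hidx j hjs] at h1
        omega
      have h2 := hnlt _ (hS.touched_nodes k hk2)
      simp only [AS.search] at h2
      rw [upd_of_ne _ _ h1, upd_of_ne _ _ (by omega)]
      exact hmem k (by omega) hk2
  · intro x hx hk
    have := hnlt x hx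
    simp at hk ⊢
    have h1 : x ≠ z := fun he => hk j le_rfl hjs (he ▸ hz.symm)
    rw [upd_of_ne _ _ h1, upd_of_ne _ _ (by omega)]
    exact hoth x hx fun k h1 h2 => hk k (by omega) h2
  · right
    simp
    rw [upd_of_ne _ _ (by omega), upd_self, hz2.2]
  · simp; omega
  · simp; omega

end

end MinBalance

namespace MinBalance

open Finset

section

variable {G : SortedArcs} {F : Forest} {h B l W base cap : ℕ} {P Q : (ℕ → ℕ) → Prop} {s s' : AS}

theorem wp_finishSegment (hR : Room G F h l W cap) (hP : Progress G F h B l P Q s)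
    (hd : 0 < s.v .dp) (ha : s.a .adj (s.a .path (s.v .dp - 1)) = 0)
    (heq : s.a .idx (s.a .path (s.v .dp - 1)) = s.a .bounds (s.v .bp - 1))
    (hu : s.v .u = s.a .bounds (s.v .bp - 1)) :
    wp W base cap finishSegment s fun s' => Progress G F h B l P Q s' ∧
      Frame [.z, .s, .t, .u, .sp, .bp, .dp, .nn, .ln]
        [.parent, .level, .size, .logChild, .logParent] s s' ∧
      s'.tick + 100 * (s'.v .sp + s'.v .bp + s'.v .dp) + 190 ≤
        s.tick + 100 * (s.v .sp + s.v .bp + s.v .dp) := by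
  have hS := hP.search
  have hb := hS.bp_pos' hd
  have hb' : 0 < s.v .bp := hb
  have hbpos : 1 ≤ s.a .bounds (s.v .bp - 1) := hS.bounds_pos (s.v .bp - 1) (by
    simp only [AS.search]; omega)
  have hble : s.a .bounds (s.v .bp - 1) ≤ s.v .sp := hS.bounds_le (s.v .bp - 1) (by
    simp only [AS.search]; omega)
  simp only [finishSegment, wp_seq_iff, wp_sub, Opd.val_reg, Opd.val_ofNat]
  refine ⟨by omega, ?_⟩
  set s1 := s.set .u (s.v .u - 1) 1 with hs1
  have hP1 : Progress G F h B l P Q s1 := hP.congr (by simp [hs1])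
  have hu1 : s1.v .u = s1.a .bounds (s1.v .bp - 1) - 1 := by simp [hs1, hu]
  refine wp_loop (Assigning G F h B l P Q s1) (s1.tick + 50 * s1.v .sp)
    ⟨by simp, hP1.blocks, by simp [hs1]; omega, le_rfl, fun j h1 h2 => by omega, fun _ _ _ => rfl,
      .inl hP1.size_nn, rfl, le_rfl⟩ (fun s' hA => by have := hA.tick_le; omega)
    (fun s' hA hlt => wp_assignTop hR hP1 hd hu1 hA (by simpa using hlt)) ?_
  intro s' hA hlt
  have f1 : ∀ r, r ∉ [Reg.z, .s, .t, .sp, .ln] → r ≠ .u → s'.v r = s.v r := fun r hr hru => by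
    rw [hA.frame.v r hr, hs1, set_v_ne hru]
  have f2 : ∀ k, k ∉ [Arr.parent, .level, .size, .logChild, .logParent] → s'.a k = s.a k :=
    hA.frame.a
  have e2 : s'.v .nn = s.v .nn := f1 _ (by decide) (by decide)
  have e3 : s'.v .bp = s.v .bp := f1 _ (by decide) (by decide)
  have e4 : s'.v .dp = s.v .dp := f1 _ (by decide) (by decide)
  have esp : s'.v .sp = s.a .bounds (s.v .bp - 1) - 1 := by
    have h1 := hA.sp_ge
    have h2 : s'.v .u = s1.v .u := hA.frame.v _ (by decide)
    simp [h2] at hlt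
    simp [hs1] at hlt h1
    omega
  have hmem := hA.members
  have hoth := hA.others
  have hln := hA.ln_eq
  have htick := hA.tick_le
  simp [hs1] at hmem hoth hln htick
  have hcnt := hP.count_le
  have hlog := hP.log_le
  have hpath := hP.path_le
  have hRc := hR.count_lt
  have hRw := hR.cap_lt
  have hcl := hA.blocks.count_le
  simp [e2, e3, e4]
  and_intros
  any_goals omega
  · have hsearch := hS.finish hd ha heq (par := s'.a .parent)
      (fun j hj hbj => hmem j (by simp only [AS.search] at hbj; omega) hj)
      (fun x hx hj => hoth x hx fun j h1 h2 => hj j h2 (by simp only [AS.search]; omega))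
    simp only [AS.search] at hsearch
    constructor
    · simp [f1 .m (by decide) (by decide), hP.m_eq]
    · simp [f1 .h (by decide) (by decide), hP.h_eq]
    · simp [f1 .nn0 (by decide) (by decide), hP.nn0_eq]
    · simp [f2 .tail (by decide), hP.tail_eq]
    · simp [f2 .head (by decide), hP.head_eq]
    · simpa [f2 .link (by decide)] using hP.linked
    · simp [AS.search, f2 .idx (by decide), f2 .nodes (by decide), f2 .bounds (by decide),
        f2 .path (by decide), f2 .adj (by decide), esp]
      exact hsearch
    · obtain ⟨a1, a2, a3, a4, a5, a6, a7, a8, a9, a10, a11, a12⟩ := hA.blocks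
      refine ⟨?_, a2, a3, a4, a5, a6, a7, ?_, a9, ?_, ?_, ?_⟩
      · simp; omega
      · intro b hb1 hb2
        simp at hb2 ⊢
        rcases Nat.lt_or_eq_of_le hb2 with hb2 | rfl
        · exact a8 b hb1 (by omega)
        · exact ⟨s.a .nodes (s.a .bounds (s.v .bp - 1) - 1), hS.touched_nodes _ (by
            simp only [AS.search]; omega), hmem _ (by omega) (by omega)⟩
      · intro x hx
        simp at hx ⊢
        exact a10 x (by omega)
      · intro j hj
        have := a11 j hj
        simp; omega
      · simp only [set_v_ne, set_a, wait_a, wait_v, ne_eq, reduceCtorEq, not_false_eq_true]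
        exact a12
    · have := hA.blocks.size_zero (s.v .nn + 1) (by omega)
      simpa using this
    · have := hP.le_log
      simp; omega
    · simp [f2 .idx (by decide)]; omega
    · simp [f2 .idx (by decide)]; omega
    · simp [f2 .idx (by decide)]; omega
  · refine ⟨fun r hr => ?_, fun k hk => f2 k hk, ?_⟩
    · simp only [List.mem_cons, List.not_mem_nil, not_or, or_false] at hr
      rw [f1 r (by simp [hr]) (by simp [hr])]
    · exact hA.frame.low

end

end MinBalance

namespace MinBalance

open Finset

open Reg Arr Instr Tst in
/-- Push the unvisited block `y`. -/
def pushBlock : Code :=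
  st nodes sp y ;; add sp sp 1 ;; st idx y sp ;; st bounds bp sp ;; add bp bp 1 ;;
  st path dp y ;; add dp dp 1

open Reg Arr Instr Tst in
/-- Proceed to the next arc in the chain after the arc `e` with tail `x`. -/
def nextArc : Code := ld t link e ;; st adj x t

open Reg Arr Instr Tst in
/-- Explore an arc of the topmost block `x` of the path, or remove `x` from the path. -/
def searchStep : Code :=
  sub t dp 1 ;; ld x path t ;; sub u bp 1 ;; ld u bounds u ;; ld e adj x ;;
  .ite (eq e 0)
    (ld t idx x ;; .ite (eq t u) finishSegment (sub dp dp 1))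
    (sub e e 1 ;; ld y head e ;; ld t idx y ;;
     .ite (eq t 0) pushBlock
       (ld z parent y ;; .ite (lt z nn0) (.ite (lt t u) (sub bp bp 1) nextArc) nextArc))

open Reg Arr Instr Tst in
/-- Search from the block `y` if it has not been visited. -/
def visit : Code :=
  ld t idx y ;; .ite (eq t 0) (pushBlock ;; .loop (lt 0 dp) searchStep) (mov t t)

open Reg Arr Instr Tst in
/-- Form the blocks of all components. -/
def searchAll : Code :=
  mov i 0 ;;
  .loop (lt i m) (ld y tail i ;; visit ;; ld y head i ;; visit ;; add i i 1)

section

variable {G : SortedArcs} {F : Forest} {h B l W base cap : ℕ} {P Q : (ℕ → ℕ) → Prop} {s s' : AS}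

theorem Progress.update (hP : Progress G F h B l P Q s)
    (hf : Frame [.x, .y, .z, .s, .t, .u, .e, .sp, .bp, .dp]
      [.idx, .nodes, .bounds, .path, .adj] s s')
    (hS : F.SearchInv G.m h s'.search)
    (h1 : s'.v .sp + unvisited F G.m (s'.a .idx) ≤ s.v .sp + unvisited F G.m (s.a .idx))
    (h2 : s'.v .bp + unvisited F G.m (s'.a .idx) ≤ s.v .bp + unvisited F G.m (s.a .idx))
    (h3 : s'.v .dp + unvisited F G.m (s'.a .idx) ≤ s.v .dp + unvisited F G.m (s.a .idx)) :
    Progress G F h B l P Q s' := by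
  have hl := hf.v .ln (by decide)
  have hn := hf.v .nn (by decide)
  have hs := hf.a .size (by decide)
  constructor
  · rw [hf.v _ (by decide), hP.m_eq]
  · rw [hf.v _ (by decide), hP.h_eq]
  · rw [hf.v _ (by decide), hP.nn0_eq]
  · rw [hf.a _ (by decide), hP.tail_eq]
  · rw [hf.a _ (by decide), hP.head_eq]
  · rw [hf.a _ (by decide)]; exact hP.linked
  · exact hS
  · exact hP.blocks.congr (hf.a _ (by decide)) (hf.a _ (by decide)) hs (hf.a _ (by decide))
      (hf.a _ (by decide)) hn hl
  · rw [hs, hn, hP.size_nn]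
  · rw [hl]; exact hP.le_log
  · have := hP.log_le; omega
  · have := hP.count_le; omega
  · have := hP.path_le; omega

theorem wp_pushBlock (hR : Room G F h l W cap) (hP : Progress G F h B l P Q s)
    (hy : F.Touched G.m (s.v .y)) (h0 : s.a .idx (s.v .y) = 0)
    (hr : ∀ j < s.v .sp, F.Steps G.m h (s.a .nodes j) (s.v .y)) :
    wp W base cap pushBlock s fun s' => Progress G F h B l P Q s' ∧
      Frame [.sp, .bp, .dp] [.idx, .nodes, .bounds, .path] s s' ∧
      s'.a .idx = upd (s.a .idx) (s.v .y) (s.v .sp + 1) ∧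
      s'.tick + work G F s' + 50 ≤ s.tick + work G F s := by
  have hyc := hR.hierarchy.touched_lt hy
  have hU := unvisited_update hy hyc h0 (s.v .sp)
  have hcnt := hP.count_le
  have hlog := hP.log_le
  have hl := hP.le_log
  have hpath := hP.path_le
  have hRc := hR.count_lt
  have hRe := hR.ends_le
  have hRw := hR.cap_lt
  have hcl := hP.blocks.count_le
  simp [pushBlock]
  and_intros
  any_goals omega
  · refine hP.update (by simp) ?_ ?_ ?_ ?_
    · have := hP.search.push hy h0 hr
      simp [AS.search]
      exact this
    · simp; omega
    · simp; omega
    · simp; omega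
  · simp [work]; omega

/-- A step is paid for by the decrease of `work`. The cases of an exhausted block are a finished
segment and a retreat; those of an arc are a push, a merge of segments and an arc to be skipped. -/
theorem wp_searchStep (hR : Room G F h l W cap) (hP : Progress G F h B l P Q s)
    (hd : 0 < s.v .dp) :
    wp W base cap searchStep s.wait fun s' => Progress G F h B l P Q s' ∧
      Frame [.x, .y, .z, .s, .t, .u, .e, .sp, .bp, .dp, .nn, .ln]
        [.idx, .nodes, .bounds, .path, .adj, .parent, .level, .size, .logChild, .logParent] s s' ∧
      (∀ x, s.a .idx x ≠ 0 → s'.a .idx x ≠ 0) ∧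
      s'.tick + work G F s' ≤ s.tick + work G F s := by
  have hS := hP.search
  have hb' := hS.bp_pos' hd
  have hcnt := hP.count_le
  have hlog := hP.log_le
  have hl := hP.le_log
  have hpath := hP.path_le
  have hRc := hR.count_lt
  have hRe := hR.ends_le
  have hRw := hR.cap_lt
  have hcl := hP.blocks.count_le
  have hb : 0 < s.v .bp := hb'
  have hx : F.Touched G.m (s.a .path (s.v .dp - 1)) := hS.path_touched (s.v .dp - 1) (by
    simp only [AS.search]; omega)
  have hxc := hR.hierarchy.touched_lt hx
  simp only [searchStep, wp_seq_iff, wp_sub, wp_ld, wp_ite_iff]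
  simp [hP.nn0_eq, hP.head_eq]
  have hbd : s.a .bounds (s.v .bp - 1) ≤ s.v .sp := hS.bounds_le (s.v .bp - 1) (by
    simp only [AS.search]; omega)
  and_intros
  any_goals omega
  · intro ha
    refine ⟨by omega, fun heq => ?_, fun hne => ?_⟩
    · refine wp_mono _ ?_ (wp_finishSegment hR (hP.congr (by simp)) (by simpa using hd)
        (by simpa using ha) (by simpa using heq) (by simp))
      rintro s' ⟨h1, h2, h3⟩
      have e1 := h2.a .idx (by decide)
      have e2 := h2.a .adj (by decide)
      simp at e1 e2
      refine ⟨h1, ?_, ?_, ?_⟩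
      · exact (show Frame _ _ s _ by simp).trans (h2.mono (by simp) (by simp))
      · intro x hx; rw [e1]; exact hx
      · simp at h3
        simp only [work, e1, e2]; omega
    · refine ⟨by omega, hP.update (by simp) ?_ ?_ ?_ ?_, ?_⟩
      · simp [AS.search]
        exact hS.retreat hd ha hne
      · simp
      · simp
      · simp
      · simp [work]; omega
  · intro ha
    have hact : F.Active G.m h (s.a .adj (s.a .path (s.v .dp - 1)) - 1) :=
      hS.adj_active _ hx ha
    have htl : F.tail (s.a .adj (s.a .path (s.v .dp - 1)) - 1) = s.a .path (s.v .dp - 1) :=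
      hS.adj_tail _ hx ha
    have hem := hact.1
    have hyt := Forest.touched_head (F := F) hem
    have hyc := hR.hierarchy.touched_lt hyt
    have hstep : F.Step G.m h (s.a .path (s.v .dp - 1))
        (F.head (s.a .adj (s.a .path (s.v .dp - 1)) - 1)) := ⟨_, hact, htl, rfl⟩
    have hadv : ∀ s' : AS,
        Frame [.x, .y, .z, .s, .t, .u, .e] [.adj] s s' →
        s'.a .adj = upd (s.a .adj) (s.a .path (s.v .dp - 1))
          (s.a .link (s.a .adj (s.a .path (s.v .dp - 1)) - 1)) →
        s'.tick ≤ s.tick + 50 →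
        (F.count ≤ s.a .parent (F.head (s.a .adj (s.a .path (s.v .dp - 1)) - 1)) ∨
          (s.a .idx (F.head (s.a .adj (s.a .path (s.v .dp - 1)) - 1)) ≠ 0 ∧
          s.a .bounds (s.v .bp - 1) ≤
            s.a .idx (F.head (s.a .adj (s.a .path (s.v .dp - 1)) - 1)))) →
        Progress G F h B l P Q s' ∧ s'.tick + work G F s' ≤ s.tick + work G F s := by
      intro s' hf had ht hor
      have hsp := hf.v .sp (by decide)
      have hbp := hf.v .bp (by decide)
      have hdp := hf.v .dp (by decide)
      have hidx := hf.a .idx (by decide)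
      refine ⟨hP.update (hf.mono (by simp) (by simp)) ?_ ?_ ?_ ?_, ?_⟩
      · have := hS.advance hP.linked hd ha hor
        have he : s'.search = { s.search with
            adj := upd (s.a .adj) (s.a .path (s.v .dp - 1))
              (s.a .link (s.a .adj (s.a .path (s.v .dp - 1)) - 1)) } := by
          simp only [AS.search, hsp, hbp, hdp, hidx, had, hf.a .nodes (by decide),
            hf.a .bounds (by decide), hf.a .path (by decide), hf.a .parent (by decide),
            hf.v .nn (by decide)]
        rw [he]
        exact this
      · rw [hsp, hidx]
      · rw [hbp, hidx]
      · rw [hdp, hidx]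
      · have := unexplored_update (m := G.m) ha hem htl (hP.linked.le _ hact)
        simp only [work, hsp, hbp, hdp, hidx, had]
        omega
    have hec : s.a .adj (s.a .path (s.v .dp - 1)) - 1 < cap := by omega
    refine ⟨by omega, by omega, by omega, fun h0 => ?_, fun h0 =>
      ⟨by omega, fun hlt => ?_, fun hge => ?_⟩⟩
    · refine wp_mono _ ?_ (wp_pushBlock hR (hP.congr (by simp)) (by simpa using hyt)
        (by simpa using h0) ?_)
      swap
      · simp only [wait_v, set_v_ne, set_v_self, set_a, wait_a, ne_eq, reduceCtorEq,
          not_false_eq_true]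
        exact fun j hj => (hS.reach_top hd hj).tail hstep
      rintro s' ⟨h1, h2, h3, h4⟩
      simp at h3
      refine ⟨h1, ?_, ?_, ?_⟩
      · exact (show Frame _ _ s _ by simp).trans (h2.mono (by simp) (by simp))
      · intro x hx
        by_cases hxy : x = F.head (s.a .adj (s.a .path (s.v .dp - 1)) - 1)
        · rw [h3, hxy]; simp
        · rw [h3, upd_of_ne _ _ hxy]; exact hx
      · simp [work] at h4 ⊢
        omega
    · refine ⟨fun hm => ⟨by omega, hP.update (by simp) ?_ ?_ ?_ ?_, ?_⟩, fun hm => ?_⟩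
      · simp [AS.search]
        exact hS.merge hd hyt hstep h0 hlt hm
      · simp
      · simp
      · simp
      · simp [work]; omega
      · simp [nextArc]
        refine ⟨hec, by omega, hadv _ (by simp) (by simp) (by simp)
          (.inr ⟨h0, by omega⟩)⟩
    · simp [nextArc]
      refine ⟨hec, by omega, hadv _ (by simp) (by simp) (by simp) (.inl (by omega))⟩

theorem wp_visit (hR : Room G F h l W cap) (hP : Progress G F h B l P Q s)
    (hd : s.v .dp = 0) (hy : F.Touched G.m (s.v .y)) :
    wp W base cap visit s fun s' => Progress G F h B l P Q s' ∧ s'.v .dp = 0 ∧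
      Frame [.x, .y, .z, .s, .t, .u, .e, .sp, .bp, .dp, .nn, .ln]
        [.idx, .nodes, .bounds, .path, .adj, .parent, .level, .size, .logChild, .logParent] s s' ∧
      (∀ x, s.a .idx x ≠ 0 ∨ x = s.v .y → s'.a .idx x ≠ 0) ∧
      s'.tick + work G F s' ≤ s.tick + work G F s + 6 := by
  have hyc := hR.hierarchy.touched_lt hy
  have hRc := hR.count_lt
  simp [visit]
  refine ⟨by omega, fun h0 => ?_, fun h0 => ?_⟩
  · refine wp_mono _ ?_ (wp_pushBlock hR (hP.congr (by simp)) (by simpa using hy)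
        (by simpa using h0) ?_)
    swap
    · have : s.v .sp = 0 := hP.search.sp_eq_zero hd
      simp [this]
    rintro s1 ⟨h1, h2, h3, h4⟩
    simp at h3
    refine wp_loop (fun s' => Progress G F h B l P Q s' ∧
      Frame [.x, .y, .z, .s, .t, .u, .e, .sp, .bp, .dp, .nn, .ln]
        [.idx, .nodes, .bounds, .path, .adj, .parent, .level, .size, .logChild, .logParent] s s' ∧
      (∀ x, s.a .idx x ≠ 0 ∨ x = s.v .y → s'.a .idx x ≠ 0) ∧
      s'.tick + work G F s' ≤ s.tick + work G F s) (s.tick + work G F s) ?_ ?_ ?_ ?_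
    · refine ⟨h1, ?_, ?_, ?_⟩
      · exact (show Frame _ _ s _ by simp).trans (h2.mono (by simp) (by simp))
      · intro x hx
        rw [h3]
        by_cases hxy : x = s.v .y
        · rw [hxy]; simp
        · rw [upd_of_ne _ _ hxy]; exact hx.resolve_right hxy
      · simp [work] at h4 ⊢
        omega
    · rintro s' ⟨-, -, -, h⟩; omega
    · rintro s' ⟨g1, g2, g3, g4⟩ hb
      simp at hb
      refine wp_mono _ ?_ (wp_searchStep hR g1 hb)
      rintro s2 ⟨k1, k2, k3, k4⟩
      exact ⟨k1, g2.trans k2, fun x hx => k3 x (g3 x hx), by omega⟩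
    · rintro s' ⟨g1, g2, g3, g4⟩ hb
      simp at hb
      exact ⟨g1.congr (by simp), by simpa using hb, by simpa using g2, by simpa using g3, by
        simp [work] at g4 ⊢; omega⟩
  · refine ⟨hP.congr (by simp), hd, ?_, ?_⟩
    · rintro x (hx | rfl)
      exacts [hx, h0]
    · simp [work]; omega

/-- The search visits all ends of arcs. -/
theorem wp_searchAll (hR : Room G F h l W cap) (hP : Progress G F h B l P Q s)
    (hd : s.v .dp = 0) :
    wp W base cap searchAll s fun s' => Progress G F h B l P Q s' ∧ s'.v .dp = 0 ∧
      Frame [.i, .x, .y, .z, .s, .t, .u, .e, .sp, .bp, .dp, .nn, .ln]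
        [.idx, .nodes, .bounds, .path, .adj, .parent, .level, .size, .logChild, .logParent] s s' ∧
      (∀ x, F.Touched G.m x → s'.a .idx x ≠ 0) ∧
      s'.tick ≤ s.tick + work G F s + 22 * G.m + 2 := by
  have hRe := hR.ends_le
  have hRc := hR.count_lt
  have hRw := hR.cap_lt
  simp only [searchAll, wp_seq_iff, wp_mov]
  refine wp_loop (fun s' => Progress G F h B l P Q s' ∧ s'.v .dp = 0 ∧
      Frame [.i, .x, .y, .z, .s, .t, .u, .e, .sp, .bp, .dp, .nn, .ln]
        [.idx, .nodes, .bounds, .path, .adj, .parent, .level, .size, .logChild, .logParent] s s' ∧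
      s'.v .i ≤ G.m ∧
      (∀ i < s'.v .i, s'.a .idx (F.tail i) ≠ 0 ∧ s'.a .idx (F.head i) ≠ 0) ∧
      s'.tick + work G F s' ≤ s.tick + work G F s + 22 * s'.v .i + 1)
    (s.tick + work G F s + 22 * G.m + 1) ?_ ?_ ?_ ?_
  · refine ⟨hP.congr (by simp), by simpa using hd, by simp, by simp, by simp, ?_⟩
    simp [work]; omega
  · rintro s' ⟨-, -, -, h1, -, h2⟩; omega
  · rintro s' ⟨g1, g2, g3, g4, g5, g6⟩ hb
    simp [g1.m_eq] at hb
    simp only [wp_seq_iff, wp_ld, wait_v, Opd.val_reg, wait_a, g1.tail_eq]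
    refine ⟨by omega, ?_⟩
    refine wp_mono _ ?_ (wp_visit hR (g1.congr (by simp)) (by simpa using g2)
      (by simpa using Forest.touched_tail hb))
    rintro s1 ⟨k1, k2, k3, k4, k5⟩
    have e1 : s1.v .i = s'.v .i := by rw [k3.v _ (by decide)]; simp
    simp only [k1.head_eq, e1]
    refine ⟨by omega, ?_⟩
    refine wp_mono _ ?_ (wp_visit hR (k1.congr (by simp)) (by simpa using k2)
      (by simpa using Forest.touched_head hb))
    rintro s2 ⟨l1, l2, l3, l4, l5⟩
    have e2 : s2.v .i = s'.v .i := by rw [l3.v _ (by decide)]; simp [e1]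
    simp at k4 l4
    simp [work] at k5 l5 g6
    simp [e2]
    and_intros
    any_goals omega
    · exact l1.congr (by simp)
    · refine Frame.trans g3 (Frame.trans (s' := s1) ?_ (Frame.trans (s' := s2) ?_ (by simp)))
      · exact (show Frame _ _ s' _ by simp).trans (k3.mono (by simp) (by simp))
      · exact (show Frame _ _ s1 _ by simp).trans (l3.mono (by simp) (by simp))
    · intro i hi
      rcases Nat.lt_or_eq_of_le hi with hi | rfl
      · exact ⟨l4 _ (.inl (k4 _ (.inl (g5 i hi).1))), l4 _ (.inl (k4 _ (.inl (g5 i hi).2)))⟩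
      · exact ⟨l4 _ (.inl (k4 _ (.inr rfl))), l4 _ (.inr rfl)⟩
    · simp [work]; omega
  · rintro s' ⟨g1, g2, g3, g4, g5, g6⟩ hb
    simp [g1.m_eq] at hb
    obtain hi : s'.v .i = G.m := by omega
    rw [hi] at g5 g6
    refine ⟨g1.congr (by simp), by simpa using g2, by simpa using g3, ?_, by simp; omega⟩
    rintro x ⟨i, hi, rfl | rfl⟩
    exacts [(g5 i hi).1, (g5 i hi).2]

end

end MinBalance

/-! ### Rounds -/

namespace MinBalance

open Finset

open Reg Arr Instr Tst in
/-- Mark all ends of arcs as unvisited. -/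
def resetSearch : Code :=
  mov i 0 ;;
  .loop (lt i m)
    (ld x tail i ;; st adj x 0 ;; st idx x 0 ;; ld x head i ;; st adj x 0 ;; st idx x 0 ;;
     add i i 1)

open Reg Arr Instr Tst in
/-- Chain the active arcs with the same tail. -/
def linkArcs : Code :=
  mov i 0 ;;
  .loop (lt i m)
    (ld x tail i ;; ld y level x ;; add y y h ;; mov j i ;; add i i 1 ;;
     .ite (lt j y) (ld y adj x ;; st link j y ;; st adj x i) (mov t t))

open Reg Arr Instr Tst in
/-- Initialize the stacks of the search. -/
def beginSearch : Code := mov nn0 nn ;; mov sp 0 ;; mov bp 0 ;; mov dp 0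

open Reg Arr Instr Tst in
/-- Move the ends of arcs between different new blocks to these blocks. -/
def relabelArcs : Code :=
  mov i 0 ;;
  .loop (lt i m)
    (ld x tail i ;; ld x parent x ;; ld y head i ;; ld y parent y ;;
     .ite (ne x y) (st tail i x ;; st head i y) (mov t t) ;; add i i 1)

/-- Refine the hierarchy of blocks by one level of width `h`. -/
def refineRound : Code :=
  resetSearch ;; linkArcs ;; beginSearch ;; searchAll ;; relabelArcs

/-- The state between rounds. -/
structure Ready (G : SortedArcs) (H : ℕ) (Q : (ℕ → ℕ) → Prop) (s : AS) : Prop where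
  m_eq : s.v .m = G.m
  hierarchy : s.forest.Hierarchy G H
  parent_zero : s.a .parent 0 = 0
  size_sum : ∀ M p, ∑ x ∈ Ico 1 M with s.a .parent x = p, s.a .size x ≤ s.a .size p
  size_zero : ∀ x, s.v .nn ≤ x → s.a .size x = 0
  log_le : ∀ j < s.v .ln, s.a .logChild j ≤ s.v .nn ∧ s.a .logParent j ≤ s.v .nn
  log : ∀ φ, s.forest.Good G H φ →
    Unrolls (G.n * G.cost (G.pw - 1)) Q (s.a .logChild) (s.a .logParent) (s.v .ln) φ

section

variable {G : SortedArcs} {F : Forest} {h B l W base cap : ℕ} {P Q : (ℕ → ℕ) → Prop} {s s' : AS}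

theorem wp_resetSearch {m : ℕ} (hm : s.v .m = m) (h1 : ∀ i < m, s.a .tail i < cap)
    (h2 : ∀ i < m, s.a .head i < cap) (h3 : m ≤ cap) (h4 : m < W) :
    wp W base cap resetSearch s fun s' => Frame [.i, .x] [.adj, .idx] s s' ∧
      (∀ i < m, s'.a .adj (s.a .tail i) = 0 ∧ s'.a .idx (s.a .tail i) = 0 ∧
        s'.a .adj (s.a .head i) = 0 ∧ s'.a .idx (s.a .head i) = 0) ∧
      s'.tick ≤ s.tick + 26 * m + 2 := by
  simp only [resetSearch, wp_seq_iff, wp_mov]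
  have key : ∀ (f : ℕ → ℕ) (a b : ℕ), f b = 0 → upd f a 0 b = 0 := fun f a b h => by
    by_cases hab : b = a
    · rw [hab, upd_self]
    · rw [upd_of_ne _ _ hab, h]
  refine wp_loop (fun s' => Frame [.i, .x] [.adj, .idx] s s' ∧ s'.v .i ≤ m ∧
      (∀ i < s'.v .i, s'.a .adj (s.a .tail i) = 0 ∧ s'.a .idx (s.a .tail i) = 0 ∧
        s'.a .adj (s.a .head i) = 0 ∧ s'.a .idx (s.a .head i) = 0) ∧
      s'.tick ≤ s.tick + 26 * s'.v .i + 1) (s.tick + 26 * m + 1) ?_ ?_ ?_ ?_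
  · simp
  · rintro s' ⟨-, h1, -, h2⟩; omega
  · rintro s' ⟨hf, hi, hs, ht⟩ hb
    have e1 : s'.v .m = m := by rw [hf.v _ (by decide), hm]
    have e2 : s'.a .tail = s.a .tail := hf.a _ (by decide)
    have e3 : s'.a .head = s.a .head := hf.a _ (by decide)
    simp [e1] at hb
    have := h1 _ hb
    have := h2 _ hb
    simp [hf, e2, e3]
    and_intros
    any_goals omega
    intro i hi'
    rcases Nat.lt_or_eq_of_le hi' with hlt | rfl
    · obtain ⟨q1, q2, q3, q4⟩ := hs i hlt
      exact ⟨key _ _ _ (key _ _ _ q1), key _ _ _ (key _ _ _ q2), key _ _ _ (key _ _ _ q3),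
        key _ _ _ (key _ _ _ q4)⟩
    · exact ⟨key _ _ _ (upd_self ..), key _ _ _ (upd_self ..), upd_self .., upd_self ..⟩
  · rintro s' ⟨hf, hi, hs, ht⟩ hb
    have e1 : s'.v .m = m := by rw [hf.v _ (by decide), hm]
    simp [e1] at hb
    obtain hi : s'.v .i = m := by omega
    rw [hi] at hs ht
    exact ⟨by simpa using hf, hs, by simp; omega⟩

theorem wp_linkArcs (hR : Room G F h l W cap) (hm : s.v .m = G.m) (hh : s.v .h = h)
    (htl : s.a .tail = F.tail) (hlv : s.a .level = F.level)
    (h0 : ∀ i < G.m, s.a .adj (F.tail i) = 0 ∧ s.a .adj (F.head i) = 0) :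
    wp W base cap linkArcs s fun s' => Frame [.i, .j, .x, .y, .t] [.adj, .link] s s' ∧
      F.Linked G.m h (s'.a .link) ∧
      (∀ x, F.Touched G.m x → s'.a .adj x ≠ 0 →
        F.Active G.m h (s'.a .adj x - 1) ∧ F.tail (s'.a .adj x - 1) = x) ∧
      (∀ i, F.Active G.m h i → i < s'.a .adj (F.tail i)) ∧
      s'.tick ≤ s.tick + 25 * G.m + 2 := by
  have hRe := hR.ends_le
  have hRc := hR.count_lt
  have hRw := hR.cap_lt
  simp only [linkArcs, wp_seq_iff, wp_mov]
  refine wp_loop (fun s' => Frame [.i, .j, .x, .y, .t] [.adj, .link] s s' ∧ s'.v .i ≤ G.m ∧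
      (∀ x, F.Touched G.m x → s'.a .adj x ≠ 0 →
        F.Active G.m h (s'.a .adj x - 1) ∧ F.tail (s'.a .adj x - 1) = x ∧ s'.a .adj x ≤ s'.v .i) ∧
      (∀ i < s'.v .i, F.Active G.m h i → i < s'.a .adj (F.tail i)) ∧
      (∀ i < s'.v .i, F.Active G.m h i → s'.a .link i ≤ i ∧
        (s'.a .link i ≠ 0 → F.Active G.m h (s'.a .link i - 1) ∧
          F.tail (s'.a .link i - 1) = F.tail i) ∧
        ∀ j, F.Active G.m h j → F.tail j = F.tail i → j < i → j < s'.a .link i) ∧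
      s'.tick ≤ s.tick + 25 * s'.v .i + 1) (s.tick + 25 * G.m + 1) ?_ ?_ ?_ ?_
  · refine ⟨by simp, by simp, ?_, by simp, by simp, by simp⟩
    rintro x ⟨i, hi, rfl | rfl⟩ hne
    exacts [absurd (h0 i hi).1 hne, absurd (h0 i hi).2 hne]
  · rintro s' ⟨-, h1, -, -, -, h2⟩; omega
  · rintro s' ⟨hf, hi, ha, hb, hc, ht⟩ hlt
    have e1 : s'.v .m = G.m := by rw [hf.v _ (by decide), hm]
    have e2 : s'.a .tail = F.tail := by rw [hf.a _ (by decide), htl]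
    have e3 : s'.a .level = F.level := by rw [hf.a _ (by decide), hlv]
    have e4 : s'.v .h = h := by rw [hf.v _ (by decide), hh]
    simp [e1] at hlt
    have hxt := Forest.touched_tail (F := F) hlt
    have hxc := hR.hierarchy.touched_lt hxt
    have hlev := hR.hierarchy.level_le _ (hR.hierarchy.touched_pos hxt) hxc
    have hRp := hR.pw_lt
    simp [hf, e2, e3, e4]
    refine ⟨by omega, by omega, by omega, by omega, fun hact => ?_, fun hna => ?_⟩
    · refine ⟨by omega, by omega, by omega, by omega, ?_, ?_, ?_, by omega⟩
      · intro x hx hne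
        by_cases hxx : x = F.tail (s'.v .i)
        · subst hxx
          simp only [upd_self]
          exact ⟨⟨hlt, hact⟩, rfl, by omega⟩
        · rw [upd_of_ne _ _ hxx] at hne ⊢
          obtain ⟨q1, q2, q3⟩ := ha x hx hne
          exact ⟨q1, q2, by omega⟩
      · intro i hi' hia
        by_cases hxx : F.tail i = F.tail (s'.v .i)
        · rw [hxx, upd_self]; omega
        · rw [upd_of_ne _ _ hxx]
          rcases Nat.lt_or_eq_of_le hi' with hi' | rfl
          · exact hb i hi' hia
          · exact absurd rfl hxx
      · intro i hi' hia
        rcases Nat.lt_or_eq_of_le hi' with hi' | rfl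
        · rw [upd_of_ne _ _ (by omega)]
          exact hc i hi' hia
        · rw [upd_self]
          refine ⟨?_, fun hne => ?_, fun j hj hjt hji => ?_⟩
          · by_cases hz : s'.a .adj (F.tail (s'.v .i)) = 0
            · omega
            · exact (ha _ hxt hz).2.2
          · exact ⟨(ha _ hxt hne).1, (ha _ hxt hne).2.1⟩
          · rw [← hjt]; exact hb j hji hj
    · refine ⟨by omega, ?_, ?_, ?_, by omega⟩
      · intro x hx hne
        obtain ⟨q1, q2, q3⟩ := ha x hx hne
        exact ⟨q1, q2, by omega⟩
      · intro i hi' hia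
        rcases Nat.lt_or_eq_of_le hi' with hi' | rfl
        · exact hb i hi' hia
        · have := hia.2; omega
      · intro i hi' hia
        rcases Nat.lt_or_eq_of_le hi' with hi' | rfl
        · exact hc i hi' hia
        · have := hia.2; omega
  · rintro s' ⟨hf, hi, ha, hb, hc, ht⟩ hlt
    have e1 : s'.v .m = G.m := by rw [hf.v _ (by decide), hm]
    simp [e1] at hlt
    obtain hi : s'.v .i = G.m := by omega
    rw [hi] at ha hb hc ht
    refine ⟨by simpa using hf, ⟨fun i hi hne => ((hc i hi.1 hi).2.1 hne).1,
      fun i hi hne => ((hc i hi.1 hi).2.1 hne).2, fun i hi => (hc i hi.1 hi).1,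
      fun i hi => (hc i hi.1 hi).2.2⟩, fun x hx hne => ⟨(ha x hx hne).1, (ha x hx hne).2.1⟩,
      fun i hi => hb i hi.1 hi, by simp; omega⟩

theorem wp_relabelArcs {m : ℕ} (hm : s.v .m = m) (h1 : ∀ i < m, s.a .tail i < cap)
    (h2 : ∀ i < m, s.a .head i < cap) (h3 : m ≤ cap) (h4 : m < W) :
    wp W base cap relabelArcs s fun s' => Frame [.i, .x, .y, .t] [.tail, .head] s s' ∧
      s'.forest = s.forest.relabel m ∧ s'.tick ≤ s.tick + 30 * m + 2 := by
  simp only [relabelArcs, wp_seq_iff, wp_mov]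
  refine wp_loop (fun s' => Frame [.i, .x, .y, .t] [.tail, .head] s s' ∧ s'.v .i ≤ m ∧
      (∀ i, s'.a .tail i = if i < s'.v .i then (s.forest.relabel m).tail i else s.a .tail i) ∧
      (∀ i, s'.a .head i = if i < s'.v .i then (s.forest.relabel m).head i else s.a .head i) ∧
      s'.tick ≤ s.tick + 30 * s'.v .i + 1) (s.tick + 30 * m + 1) ?_ ?_ ?_ ?_
  · simp
  · rintro s' ⟨-, h1, -, -, h2⟩; omega
  · rintro s' ⟨hf, hi, ha, hb, ht⟩ hlt
    have e1 : s'.v .m = m := by rw [hf.v _ (by decide), hm]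
    have e2 : s'.a .parent = s.a .parent := hf.a _ (by decide)
    have e3 : s'.a .tail (s'.v .i) = s.a .tail (s'.v .i) := by rw [ha, if_neg (lt_irrefl _)]
    have e4 : s'.a .head (s'.v .i) = s.a .head (s'.v .i) := by rw [hb, if_neg (lt_irrefl _)]
    simp [e1] at hlt
    have := h1 _ hlt
    have := h2 _ hlt
    simp [hf, e2, e3, e4]
    refine ⟨by omega, by omega, by omega, by omega, fun hne => ?_, fun he => ?_⟩
    · refine ⟨by omega, by omega, by omega, fun i => ?_, fun i => ?_, by omega⟩
      · by_cases hi' : i = s'.v .i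
        · subst hi'
          simp [Forest.relabel, AS.forest, hlt, hne]
        · rw [upd_of_ne _ _ hi', ha]
          congr 1
          exact propext (by omega)
      · by_cases hi' : i = s'.v .i
        · subst hi'
          simp [Forest.relabel, AS.forest, hlt, hne]
        · rw [upd_of_ne _ _ hi', hb]
          congr 1
          exact propext (by omega)
    · refine ⟨by omega, by omega, fun i => ?_, fun i => ?_, by omega⟩
      · by_cases hi' : i = s'.v .i
        · subst hi'
          simp [Forest.relabel, AS.forest, he, e3]
        · rw [ha]
          congr 1
          exact propext (by omega)
      · by_cases hi' : i = s'.v .i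
        · subst hi'
          simp [Forest.relabel, AS.forest, he, e4]
        · rw [hb]
          congr 1
          exact propext (by omega)
  · rintro s' ⟨hf, hi, ha, hb, ht⟩ hlt
    have e1 : s'.v .m = m := by rw [hf.v _ (by decide), hm]
    simp [e1] at hlt
    obtain hi : s'.v .i = m := by omega
    refine ⟨by simpa using hf, ?_, by simp; omega⟩
    have q1 : s'.a .tail = (s.forest.relabel m).tail := by
      funext i
      rw [ha, hi]
      split_ifs with hc
      · rfl
      · simp [Forest.relabel, AS.forest, hc]
    have q2 : s'.a .head = (s.forest.relabel m).head := by
      funext i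
      rw [hb, hi]
      split_ifs with hc
      · rfl
      · simp [Forest.relabel, AS.forest, hc]
    simp only [AS.forest, wait_a, wait_v, q1, q2, hf.a .parent (by decide),
      hf.a .level (by decide), hf.a .size (by decide), hf.v .nn (by decide)]
    rfl

end

end MinBalance

namespace MinBalance

open Finset

section

variable {G : SortedArcs} {F : Forest} {h B l W base cap : ℕ} {P Q : (ℕ → ℕ) → Prop} {s s' : AS}

theorem unvisited_le (idx : ℕ → ℕ) (m : ℕ) : unvisited F m idx ≤ 2 * m := by
  classical
  unfold unvisited
  calc _ ≤ #((range m).image F.tail ∪ (range m).image F.head) := by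
        refine card_le_card fun x hx => ?_
        simp only [mem_filter, mem_union, mem_image, mem_range] at hx ⊢
        obtain ⟨i, hi, h | h⟩ := hx.2.1
        exacts [.inl ⟨i, hi, h⟩, .inr ⟨i, hi, h⟩]
    _ ≤ m + m := (card_union_le _ _).trans (add_le_add
        (card_image_le.trans (card_range m).le) (card_image_le.trans (card_range m).le))
    _ = 2 * m := by ring

theorem unexplored_le (adj : ℕ → ℕ) (m : ℕ) : unexplored F m adj ≤ m :=
  (card_filter_le _ _).trans (card_range m).le

/-- The invariant of the search holds at its beginning. -/
theorem Ready.progress (hP : Ready G (2 * h) Q s)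
    (hf : Frame [.i, .j, .x, .y, .t, .nn0, .sp, .bp, .dp] [.adj, .idx, .link] s s')
    (hh : s.v .h = h) (h0 : s'.v .nn0 = s.v .nn) (hsp : s'.v .sp = 0) (hbp : s'.v .bp = 0)
    (hdp : s'.v .dp = 0)
    (hidx : ∀ x, s.forest.Touched G.m x → s'.a .idx x = 0)
    (hlink : s.forest.Linked G.m h (s'.a .link))
    (hadj : ∀ x, s.forest.Touched G.m x → s'.a .adj x ≠ 0 →
        s.forest.Active G.m h (s'.a .adj x - 1) ∧ s.forest.tail (s'.a .adj x - 1) = x)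
    (hun : ∀ i, s.forest.Active G.m h i → i < s'.a .adj (s.forest.tail i)) :
    Progress G s.forest h (G.n * G.cost (G.pw - 1)) (s.v .ln)
      (Unrolls (G.n * G.cost (G.pw - 1)) Q (s.a .logChild) (s.a .logParent) (s.v .ln)) Q s' := by
  have hH := hP.hierarchy
  have epar : s'.a .parent = s.a .parent := hf.a _ (by decide)
  have enn : s'.v .nn = s.v .nn := hf.v _ (by decide)
  have hpar : ∀ x < s.v .nn, s.a .parent x < s.v .nn := by
    intro x hx
    rcases Nat.eq_zero_or_pos x with rfl | h1
    · rw [hP.parent_zero]; omega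
    · exact hH.parent_lt x h1 hx
  have htp : ∀ x, s.forest.Touched G.m x → s.a .parent x < s.v .nn := fun x hx =>
    hpar x (hH.touched_lt hx)
  have hU := unvisited_le (F := s.forest) (s'.a .idx) G.m
  constructor
  · rw [hf.v _ (by decide), hP.m_eq]
  · rw [hf.v _ (by decide), hh]
  · exact h0
  · exact hf.a _ (by decide)
  · exact hf.a _ (by decide)
  · exact hlink
  · constructor <;> simp only [AS.search, hsp, hbp, hdp, epar, enn] <;> try omega
    · exact le_rfl
    · exact fun x hx hne => absurd (hidx x hx) hne
    · exact fun x hx hc => absurd (htp x hx) (by simp only [AS.forest] at hc; omega)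
    · exact fun i hi hc => absurd (htp _ (Forest.touched_tail hi.1)) (by
        simp only [AS.forest] at hc ⊢; omega)
    · exact fun x y hx _ hc => absurd (htp x hx) (by simp only [AS.forest] at hc; omega)
    · exact fun x hx hne => (hadj x hx hne).1
    · exact fun x hx hne => (hadj x hx hne).2
    · exact fun i hi _ => hun i hi
    · exact fun i hi hc => absurd (hun i hi) (by omega)
  · have hb : Blocks s.forest G.m h (G.n * G.cost (G.pw - 1)) (Unrolls (G.n * G.cost (G.pw - 1)) Q
        (s.a .logChild) (s.a .logParent) (s.v .ln)) Q s := by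
      refine ⟨le_rfl, fun _ _ _ => rfl, fun _ _ _ => rfl, fun _ _ => rfl, fun _ _ => rfl,
        fun x hx hc => absurd (htp x hx) (by simp only [AS.forest] at hc; omega),
        fun x hx hc => absurd (htp x hx) (by simp only [AS.forest] at hc; omega),
        fun b h1 h2 => absurd h2 (by simp only [AS.forest] at h1; omega), hP.size_sum,
        fun x hx => hP.size_zero x hx.le, hP.log_le, fun φ _ hφ => ?_⟩
      have : s.forest.wrap s.forest φ = φ := by
        funext x
        rw [wrap_forest, if_neg]
        rintro ⟨h1, h2⟩
        have := hpar x h1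
        simp only [AS.forest] at h2
        omega
      rwa [this] at hφ
    exact hb.congr epar (hf.a _ (by decide)) (hf.a _ (by decide)) (hf.a _ (by decide))
      (hf.a _ (by decide)) enn (hf.v _ (by decide))
  · rw [enn, hf.a .size (by decide)]; exact hP.size_zero _ le_rfl
  · rw [hf.v .ln (by decide)]
  · rw [hf.v .ln (by decide)]; omega
  · have : s.forest.count = s.v .nn := rfl
    omega
  · omega

/-- A completed search yields the condensed hierarchy. -/
theorem Progress.condenses (hP : Progress G F h B l P Q s) (hd : s.v .dp = 0)
    (hall : ∀ x, F.Touched G.m x → s.a .idx x ≠ 0) :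
    F.Condenses G.m h s.forest := by
  have hS := hP.search
  have hB := hP.blocks
  have hsp : s.v .sp = 0 := hS.sp_eq_zero hd
  have hge : ∀ x, F.Touched G.m x → F.count ≤ s.a .parent x := by
    intro x hx
    by_contra hc
    have h1 : s.a .idx x ≤ s.v .sp := (hS.visited x hx (hall x hx) (not_le.1 hc)).1
    exact hall x hx (by omega)
  exact ⟨hP.tail_eq, hP.head_eq, hB.count_le, hge, hS.parent_lt, hB.parent_untouched,
    hB.level_old, hB.size_old, fun x hx => hB.level_new x hx (hge x hx),
    fun x hx => hB.parent_new x hx (hge x hx), hB.used,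
    fun x y hx hy => hS.same x y hx hy (hge x hx),
    fun i hi => (hS.closed i hi (hge _ (Forest.touched_tail hi.1))).2,
    fun p => hB.size_sum (s.v .nn) p⟩

theorem wp_refineRound (hR : Room G s.forest h (s.v .ln) W cap) (hh : s.v .h = h) (h1 : 1 ≤ h)
    (hP : Ready G (2 * h) Q s) :
    wp W base cap refineRound s fun s' => Ready G h Q s' ∧
      Frame [.i, .j, .x, .y, .z, .s, .t, .u, .e, .nn0, .sp, .bp, .dp, .nn, .ln]
        [.tail, .head, .link, .idx, .nodes, .bounds, .path, .adj, .parent, .level, .size,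
          .logChild, .logParent] s s' ∧
      s'.v .nn ≤ s.v .nn + 2 * G.m ∧ s'.v .ln ≤ s.v .ln + 2 * G.m ∧
      s'.tick ≤ s.tick + 1010 * G.m + 20 := by
  have hH := hP.hierarchy
  have hcnt := hR.count_lt
  have hRe := hR.ends_le
  have hRw := hR.cap_lt
  have htail : ∀ i < G.m, s.a .tail i < s.v .nn := hH.tail_lt
  have hhead : ∀ i < G.m, s.a .head i < s.v .nn := hH.head_lt
  have hcnt' : s.v .nn + 2 * G.m < cap := hcnt
  simp only [refineRound, wp_seq_iff]
  refine wp_mono _ ?_ (wp_resetSearch hP.m_eq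
    (fun i hi => by have := htail i hi; omega) (fun i hi => by have := hhead i hi; omega)
    (by omega) (by omega))
  rintro s1 ⟨f1, r1, t1⟩
  refine wp_mono _ ?_ (wp_linkArcs (F := s.forest) hR (by rw [f1.v _ (by decide), hP.m_eq])
    (by rw [f1.v _ (by decide), hh]) (f1.a _ (by decide)) (f1.a _ (by decide))
    (fun i hi => ⟨(r1 i hi).1, (r1 i hi).2.2.1⟩))
  rintro s2 ⟨f2, r2, r3, r4, t2⟩
  simp only [beginSearch, wp_seq_iff, wp_mov, Opd.val_reg, Opd.val_ofNat]
  have fr : Frame [.i, .j, .x, .y, .t, .nn0, .sp, .bp, .dp] [.adj, .idx, .link] s s2 :=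
    Frame.trans (f1.mono (by simp) (by simp)) (f2.mono (by simp) (by simp))
  have enn : s2.v .nn = s.v .nn := fr.v _ (by decide)
  have hprog := hP.progress (s' := (((s2.set .nn0 (s2.v .nn) 1).set .sp 0 1).set .bp 0 1).set
    .dp 0 1) (by simp [fr]) hh (by simp [enn]) (by simp) (by simp) (by simp)
    (by
      rintro x ⟨i, hi, rfl | rfl⟩
      · simpa [f2.a .idx (by decide), AS.forest] using (r1 i hi).2.1
      · simpa [f2.a .idx (by decide), AS.forest] using (r1 i hi).2.2.2)
    (by simpa using r2) (by simpa using r3) (by simpa using r4)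
  refine wp_mono _ ?_ (wp_searchAll hR hprog (by simp))
  rintro s4 ⟨p4, d4, f4, v4, t4⟩
  have f4' : Frame [.i, .j, .x, .y, .z, .s, .t, .u, .e, .nn0, .sp, .bp, .dp, .nn, .ln]
        [.tail, .head, .link, .idx, .nodes, .bounds, .path, .adj, .parent, .level, .size,
          .logChild, .logParent] s s4 :=
    Frame.trans (s' := (((s2.set .nn0 (s2.v .nn) 1).set .sp 0 1).set .bp 0 1).set .dp 0 1)
      (by simpa using fr.mono (by simp) (by simp)) (f4.mono (by simp) (by simp))
  have hcond := p4.condenses d4 v4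
  have hnn : s4.v .nn ≤ s.v .nn + 2 * G.m := by
    have := p4.count_le; simp only [AS.forest] at this; omega
  have hln : s4.v .ln ≤ s.v .ln + 2 * G.m := by
    have := p4.log_le; omega
  have e4t : s4.a .tail = s.a .tail := p4.tail_eq
  have e4h : s4.a .head = s.a .head := p4.head_eq
  refine wp_mono _ ?_ (wp_relabelArcs p4.m_eq
    (fun i hi => by rw [e4t]; have := htail i hi; omega)
    (fun i hi => by rw [e4h]; have := hhead i hi; omega) (by omega) (by omega))
  rintro s5 ⟨f5, q5, t5⟩
  refine ⟨⟨by rw [f5.v _ (by decide), p4.m_eq], ?_, ?_, ?_, ?_, ?_, ?_⟩,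
    f4'.trans (f5.mono (by simp) (by simp)), ?_, ?_, ?_⟩
  · rw [q5]
    exact hH.condense hcond
  · have : ¬ s.forest.Touched G.m 0 := fun h => by have := hH.touched_pos h; omega
    rw [f5.a .parent (by decide), p4.blocks.parent_untouched 0 hH.count_pos this]
    exact hP.parent_zero
  · rw [f5.a .parent (by decide), f5.a .size (by decide)]
    exact p4.blocks.size_sum
  · intro x hx
    rw [f5.v .nn (by decide)] at hx
    rw [f5.a .size (by decide)]
    rcases Nat.eq_or_lt_of_le hx with rfl | hx
    · exact p4.size_nn
    · exact p4.blocks.size_zero x hx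
  · rw [f5.a .logChild (by decide), f5.a .logParent (by decide), f5.v .ln (by decide),
      f5.v .nn (by decide)]
    exact p4.blocks.log_le
  · intro φ hφ
    rw [q5] at hφ
    have hg := hφ.condense h1 hH hcond
    rw [f5.a .logChild (by decide), f5.a .logParent (by decide), f5.v .ln (by decide)]
    refine p4.blocks.log φ (fun x hx hxc => (hg.bound x hx hxc).trans ?_) (hP.log _ hg)
    have hlev := hH.level_le x hx hxc
    exact Nat.mul_le_mul ((Nat.sub_le _ _).trans
      (hH.size_le _ (hH.parent_lt x hx hxc))) (G.cost_mono _ _ (by omega) (by omega))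
  · rw [f5.v .nn (by decide)]; exact hnn
  · rw [f5.v .ln (by decide)]; exact hln
  · have h2 := unvisited_le (F := s.forest) (s2.a .idx) G.m
    have h3 := unexplored_le (F := s.forest) (s2.a .adj) G.m
    simp [work] at t4
    omega

end

end MinBalance

/-! ### The complete refinement and the potential -/

namespace MinBalance

open Finset

open Reg Arr Instr Tst in
/-- Refine the hierarchy down to width `1`. -/
def refineAll : Code := half h pw ;; .loop (lt 0 h) (refineRound ;; half h h)

open Reg Arr Instr Tst in
/-- Multiply `acc` by `fac`, with result `mult`. -/
def multiply : Code :=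
  mov mult 0 ;;
  .loop (lt 0 acc)
    (half t acc ;; add u t t ;; .ite (lt u acc) (add mult mult fac) (mov t t) ;;
     add fac fac fac ;; mov acc t)

open Reg Arr Instr Tst in
/-- Compute the potential of the blocks of the finest hierarchy. -/
def setPotential : Code :=
  mov x 1 ;;
  .loop (lt x nn)
    (ld p parent x ;; ld acc sum p ;; ld t size x ;; add t acc t ;; st sum p t ;;
     ld t level x ;; ld fac cost t ;; multiply ;; st pot x mult ;; add x x 1)

open Reg Arr Instr Tst in
/-- Process the log. -/
def unrollLog : Code :=
  .loop (lt 0 ln)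
    (sub ln ln 1 ;; ld x logChild ln ;; ld s logParent ln ;; ld t pot s ;; ld u pot x ;;
     add t u t ;; st pot x t)

open Reg Arr Instr Tst in
/-- Scale the denominator by a power of two that is at least `2 * n`. -/
def scaleDenominator : Code :=
  add u n n ;; mov t 1 ;; .loop (lt t u) (add t t t ;; add d d d)

open Reg Arr Instr Tst in
/-- Write the output. -/
def writeOutput : Code :=
  mov i 0 ;; .loop (lt i n) (add t i 1 ;; ld x pot t ;; stl i x ;; add i i 1) ;; mov n d

section

variable {G : SortedArcs} {W base cap : ℕ} {Q : (ℕ → ℕ) → Prop} {s : AS}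

theorem wp_refineAll {L : ℕ} (hpw : s.v .pw = 2 ^ L) (hG : G.pw = 2 ^ L)
    (hP : Ready G (2 ^ L) Q s) (hc : s.v .nn + 2 * G.m * L < cap) (hl : s.v .ln = 0)
    (hm : 2 * G.m ≤ cap) (hW : cap < W) (hn : G.n < W) (hpW : 2 ^ L < W) :
    wp W base cap refineAll s fun s' => Ready G 1 Q s' ∧
      Frame [.h, .i, .j, .x, .y, .z, .s, .t, .u, .e, .nn0, .sp, .bp, .dp, .nn, .ln]
        [.tail, .head, .link, .idx, .nodes, .bounds, .path, .adj, .parent, .level, .size,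
          .logChild, .logParent] s s' ∧
      s'.v .nn ≤ s.v .nn + 2 * G.m * L ∧ s'.v .ln ≤ 2 * G.m * L ∧
      s'.tick ≤ s.tick + (1010 * G.m + 22) * L + 2 := by
  simp only [refineAll, wp_seq_iff, wp_half, Opd.val_reg, hpw]
  refine wp_loop (fun s' => ∃ r ≤ L, s'.v .h = 2 ^ r / 2 ∧ Ready G (2 ^ r) Q s' ∧
      Frame [.h, .i, .j, .x, .y, .z, .s, .t, .u, .e, .nn0, .sp, .bp, .dp, .nn, .ln]
        [.tail, .head, .link, .idx, .nodes, .bounds, .path, .adj, .parent, .level, .size,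
          .logChild, .logParent] s s' ∧
      s'.v .nn ≤ s.v .nn + 2 * G.m * (L - r) ∧ s'.v .ln ≤ 2 * G.m * (L - r) ∧
      s'.tick ≤ s.tick + (1010 * G.m + 22) * (L - r) + 1)
    (s.tick + (1010 * G.m + 22) * L + 1) ?_ ?_ ?_ ?_
  · refine ⟨L, le_rfl, by simp, ⟨hP.m_eq, hP.hierarchy, hP.parent_zero, hP.size_sum, hP.size_zero,
      hP.log_le, hP.log⟩, by simp, by simp, by simp [hl], by simp⟩
  · rintro s' ⟨r, -, -, -, -, -, -, ht⟩
    have : (1010 * G.m + 22) * (L - r) ≤ (1010 * G.m + 22) * L :=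
      Nat.mul_le_mul_left _ (Nat.sub_le _ _)
    omega
  · rintro s' ⟨r, hr, hh, hPr, hf, hnn, hln, ht⟩ hb
    simp [hh] at hb
    obtain ⟨q, rfl⟩ : ∃ q, r = q + 1 := ⟨r - 1, by
      rcases Nat.eq_zero_or_pos r with rfl | h
      · simp at hb
      · omega⟩
    have hq : L - q = L - (q + 1) + 1 := by omega
    have hhq : s'.v .h = 2 ^ q := by rw [hh, pow_succ, Nat.mul_div_cancel _ (by norm_num)]
    have hmul : 2 * G.m * (L - q) ≤ 2 * G.m * L := Nat.mul_le_mul_left _ (Nat.sub_le _ _)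
    rw [hq, mul_add] at hmul
    have hP' : Ready G (2 * 2 ^ q) Q s'.wait := by
      rw [pow_succ, mul_comm] at hPr
      exact ⟨hPr.m_eq, hPr.hierarchy, hPr.parent_zero, hPr.size_sum, hPr.size_zero, hPr.log_le,
        hPr.log⟩
    rw [wp_seq_iff]
    refine wp_mono _ ?_ (wp_refineRound (s := s'.wait) (h := 2 ^ q)
      ⟨hP'.hierarchy, hW, hn, hG ▸ hpW, hm, ?_, ?_⟩ hhq Nat.one_le_two_pow hP')
    · rintro s1 ⟨p1, f1, n1, l1, t1⟩
      simp only [wp_half, Opd.val_reg]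
      have eh : s1.v .h = 2 ^ q := by rw [f1.v _ (by decide)]; exact hhq
      simp at n1 l1 t1
      refine ⟨q, by omega, by simp [eh], ⟨p1.m_eq, p1.hierarchy, p1.parent_zero, p1.size_sum,
        p1.size_zero, p1.log_le, p1.log⟩, ?_, ?_, ?_, ?_⟩
      · refine (frame_set (by simp) _ _).2 (hf.trans (Frame.trans (s' := s'.wait)
          (frame_wait.2 Frame.refl) (f1.mono (by simp) (by simp))))
      · simp [hq, mul_add]; omega
      · simp [hq, mul_add]; omega
      · simp [hq, mul_add]; omega
    · change s'.v .nn + _ < cap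
      omega
    · change s'.v .ln + _ ≤ cap
      omega
  · rintro s' ⟨r, hr, hh, hPr, hf, hnn, hln, ht⟩ hb
    simp [hh] at hb
    obtain rfl : r = 0 := by
      by_contra hc
      obtain ⟨q, rfl⟩ := Nat.exists_eq_succ_of_ne_zero hc
      have := Nat.one_le_two_pow (n := q)
      rw [pow_succ] at hb
      omega
    exact ⟨⟨hPr.m_eq, hPr.hierarchy, hPr.parent_zero, hPr.size_sum, hPr.size_zero, hPr.log_le,
      hPr.log⟩, by simpa using hf, by simpa using hnn, by simpa using hln, by simp at ht ⊢; omega⟩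

theorem wp_multiply {R : ℕ} (hR : s.v .acc < 2 ^ R) (h1 : 2 * (s.v .acc * s.v .fac) < W)
    (h2 : s.v .acc < W) :
    wp W base cap multiply s fun s' => Frame [.t, .u, .mult, .fac, .acc] [] s s' ∧
      s'.v .mult = s.v .acc * s.v .fac ∧ s'.tick ≤ s.tick + 7 * R + 2 := by
  simp only [multiply, wp_seq_iff, wp_mov]
  refine wp_loop (fun s' => Frame [.t, .u, .mult, .fac, .acc] [] s s' ∧
      s'.v .mult + s'.v .acc * s'.v .fac = s.v .acc * s.v .fac ∧ s'.v .acc ≤ s.v .acc ∧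
      ∃ r, s'.v .acc < 2 ^ r ∧ s'.tick + 7 * r ≤ s.tick + 7 * R + 1) (s.tick + 7 * R + 1)
    ?_ ?_ ?_ ?_
  · exact ⟨by simp, by simp, by simp, R, by simpa using hR, by simp; omega⟩
  · rintro s' ⟨-, -, -, r, -, h⟩; omega
  · rintro s' ⟨hf, he, hle, r, hr, ht⟩ hb
    simp at hb
    have hmul : s'.v .fac ≤ s'.v .acc * s'.v .fac := Nat.le_mul_of_pos_left _ hb
    obtain ⟨q, rfl⟩ : ∃ q, r = q + 1 := ⟨r - 1, by
      rcases Nat.eq_zero_or_pos r with rfl | h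
      · simp at hr; omega
      · omega⟩
    have hq : s'.v .acc / 2 < 2 ^ q := by rw [pow_succ] at hr; omega
    simp [hf]
    refine ⟨by omega, fun hlt => ?_, fun hge => ?_⟩
    · have e : s'.v .acc = 2 * (s'.v .acc / 2) + 1 := by omega
      refine ⟨by omega, by omega, ?_, by omega, q, hq, by omega⟩
      rw [← he]
      conv_rhs => rw [e]
      ring
    · have e : s'.v .acc = 2 * (s'.v .acc / 2) := by omega
      refine ⟨by omega, ?_, by omega, q, hq, by omega⟩
      rw [← he]
      conv_rhs => rw [e]
      ring
  · rintro s' ⟨hf, he, hle, r, hr, ht⟩ hb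
    simp at hb
    rw [hb, zero_mul] at he
    exact ⟨by simpa using hf, by simpa using he, by simp; omega⟩

theorem wp_setPotential {R : ℕ} (hP : Ready G 1 Q s) (hnn : s.v .nn ≤ cap) (hcW : cap < W)
    (hpw : G.pw ≤ cap) (hnR : G.n < 2 ^ R) (hnW : G.n < W) (hW : 2 * (G.n * G.cost (G.pw - 1)) < W)
    (hsum : ∀ p, s.a .sum p = 0) (hcost : ∀ i < G.pw, s.a .cost i = G.cost i) :
    wp W base cap setPotential s fun s' =>
      Frame [.x, .p, .t, .u, .mult, .fac, .acc] [.sum, .pot] s s' ∧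
      (∀ x, 1 ≤ x → x < s.v .nn → s'.a .pot x = s.forest.basePotential G x) ∧
      s'.tick ≤ s.tick + (7 * R + 34) * s.v .nn + 2 := by
  have hH := hP.hierarchy
  simp only [setPotential, wp_seq_iff, wp_mov]
  refine wp_loop (fun s' => Frame [.x, .p, .t, .u, .mult, .fac, .acc] [.sum, .pot] s s' ∧
      1 ≤ s'.v .x ∧ s'.v .x ≤ s.v .nn ∧
      (∀ p, s'.a .sum p = ∑ y ∈ Ico 1 (s'.v .x) with s.a .parent y = p, s.a .size y) ∧
      (∀ x, 1 ≤ x → x < s'.v .x → s'.a .pot x = s.forest.basePotential G x) ∧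
      s'.tick ≤ s.tick + (7 * R + 34) * s'.v .x + 1) (s.tick + (7 * R + 34) * s.v .nn + 1)
    ?_ ?_ ?_ ?_
  · exact ⟨by simp, by simp, hH.count_pos, by simp [hsum],
      fun x h1 h2 => absurd h2 (by simpa using Nat.one_le_iff_ne_zero.1 h1), by simp⟩
  · rintro s' ⟨-, -, hx, -, -, ht⟩
    have := Nat.mul_le_mul_left (7 * R + 34) hx
    omega
  · rintro s' ⟨hf, hx1, hx2, hs, hp, ht⟩ hb
    have e1 : s'.v .nn = s.v .nn := hf.v _ (by decide)
    have e2 : s'.a .parent = s.a .parent := hf.a _ (by decide)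
    have e3 : s'.a .size = s.a .size := hf.a _ (by decide)
    have e4 : s'.a .level = s.a .level := hf.a _ (by decide)
    have e5 : s'.a .cost = s.a .cost := hf.a _ (by decide)
    simp [e1] at hb
    have hpar : s.a .parent (s'.v .x) < s.v .nn := hH.parent_lt _ hx1 hb
    have hlev : s.a .level (s'.v .x) + 1 ≤ G.pw := hH.level_le _ hx1 hb
    have hsz := (hP.size_sum (s'.v .x + 1) (s.a .parent (s'.v .x))).trans (hH.size_le _ hpar)
    have hins : ∀ p, ∑ y ∈ Ico 1 (s'.v .x + 1) with s.a .parent y = p, s.a .size y =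
        (∑ y ∈ Ico 1 (s'.v .x) with s.a .parent y = p, s.a .size y) +
          if s.a .parent (s'.v .x) = p then s.a .size (s'.v .x) else 0 := fun p => by
      rw [sum_filter, sum_filter, sum_Ico_succ_top hx1]
    rw [hins, if_pos rfl, ← hs] at hsz
    have hcm := G.cost_mono (s.a .level (s'.v .x)) (G.pw - 1) (by omega) (by omega)
    have hcl := hcost (s.a .level (s'.v .x)) (by omega)
    simp only [wp_seq_iff, wp_ld, wp_add, wp_st]
    simp [e2, e3, e4, e5]
    refine ⟨by omega, by omega, by omega, by omega, by omega, by omega, by omega, ?_⟩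
    refine wp_mono _ ?_ (wp_multiply (R := R) ?_ ?_ ?_)
    · rintro s1 ⟨f1, m1, t1⟩
      have e6 : s1.v .x = s'.v .x := by rw [f1.v _ (by decide)]; simp
      have e7 : s1.a .sum = upd (s'.a .sum) (s.a .parent (s'.v .x))
          (s'.a .sum (s.a .parent (s'.v .x)) + s.a .size (s'.v .x)) := by
        rw [f1.a _ (by simp)]; simp
      have e8 : s1.a .pot = s'.a .pot := by rw [f1.a _ (by simp)]; simp
      simp [hcl] at m1 t1
      simp [e6, e7, e8, m1]
      refine ⟨by omega, by omega, ?_, by omega, fun p => ?_, fun x h1 h2 => ?_, ?_⟩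
      · refine hf.trans (Frame.trans (s' := _) ?_ (f1.mono (by simp) (by simp)))
        simp
      · rw [hins]
        by_cases hpp : p = s.a .parent (s'.v .x)
        · subst hpp; rw [upd_self, if_pos rfl, hs]
        · rw [upd_of_ne _ _ hpp, if_neg (Ne.symm hpp), hs, add_zero]
      · rcases Nat.lt_or_eq_of_le h2 with h2 | rfl
        · rw [upd_of_ne _ _ h2.ne]; exact hp x h1 h2
        · rw [upd_self, hs]; rfl
      · rw [mul_add, mul_one]; omega
    · simp; omega
    · simp [hcl]
      refine lt_of_le_of_lt ?_ hW
      exact Nat.mul_le_mul_left _ (Nat.mul_le_mul (by omega) hcm)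
    · simp; omega
  · rintro s' ⟨hf, hx1, hx2, hs, hp, ht⟩ hb
    have e1 : s'.v .nn = s.v .nn := hf.v _ (by decide)
    simp [e1] at hb
    obtain hx : s'.v .x = s.v .nn := by omega
    rw [hx] at hp ht
    exact ⟨by simpa using hf, hp, by simp; omega⟩

theorem wp_unrollLog {B : ℕ} (hlog : ∀ j < s.v .ln, s.a .logChild j < cap ∧ s.a .logParent j < cap)
    (hln : s.v .ln ≤ cap) (hB : B < W)
    (hU : Unrolls B Q (s.a .logChild) (s.a .logParent) (s.v .ln) (s.a .pot)) :
    wp W base cap unrollLog s fun s' => Frame [.ln, .x, .s, .t, .u] [.pot] s s' ∧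
      Q (s'.a .pot) ∧ s'.tick ≤ s.tick + 23 * s.v .ln + 1 := by
  refine wp_loop (fun s' => Frame [.ln, .x, .s, .t, .u] [.pot] s s' ∧ s'.v .ln ≤ s.v .ln ∧
      Unrolls B Q (s.a .logChild) (s.a .logParent) (s'.v .ln) (s'.a .pot) ∧
      s'.tick + 23 * s'.v .ln ≤ s.tick + 23 * s.v .ln) (s.tick + 23 * s.v .ln) ?_ ?_ ?_ ?_
  · exact ⟨by simp, le_rfl, hU, le_rfl⟩
  · rintro s' ⟨-, -, -, h⟩; omega
  · rintro s' ⟨hf, hle, hU', ht⟩ hb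
    have e1 : s'.a .logChild = s.a .logChild := hf.a _ (by decide)
    have e2 : s'.a .logParent = s.a .logParent := hf.a _ (by decide)
    simp at hb
    obtain ⟨k, hk⟩ : ∃ k, s'.v .ln = k + 1 := ⟨s'.v .ln - 1, by omega⟩
    rw [hk] at hU'
    have := hlog k (by omega)
    have h1 := hU'.1
    simp [hf, e1, e2, hk]
    and_intros
    any_goals omega
    exact hU'.2
  · rintro s' ⟨hf, hle, hU', ht⟩ hb
    simp at hb
    rw [hb] at hU' ht
    exact ⟨by simpa using hf, hU', by simp; omega⟩

theorem wp_scaleDenominator {n d : ℕ} (hn : s.v .n = n) (hn1 : 1 ≤ n) (hd : s.v .d = d)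
    (h1 : 4 * n < W) (h2 : 4 * n * d < W) :
    wp W base cap scaleDenominator s fun s' => Frame [.u, .t, .d] [] s s' ∧
      (∃ k, s'.v .d = d * 2 ^ k ∧ 2 * n ≤ 2 ^ k ∧ 2 ^ k < 4 * n) ∧
      s'.tick ≤ s.tick + 12 * n + 3 := by
  simp only [scaleDenominator, wp_seq_iff, wp_mov, wp_add, Opd.val_reg, hn]
  refine ⟨by omega, ?_⟩
  refine wp_loop (fun s' => Frame [.u, .t, .d] [] s s' ∧ s'.v .u = n + n ∧
      (∃ k, s'.v .t = 2 ^ k ∧ s'.v .d = d * 2 ^ k ∧ 2 ^ k < 4 * n) ∧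
      s'.tick ≤ s.tick + 3 * s'.v .t + 2) (s.tick + 12 * n + 2) ?_ ?_ ?_ ?_
  · exact ⟨by simp, by simp, ⟨0, by simp, by simp [hd], by simp; omega⟩, by simp⟩
  · rintro s' ⟨-, -, ⟨k, h1, -, h2⟩, h3⟩; omega
  · rintro s' ⟨hf, hu, ⟨k, ht, hd', hk⟩, htk⟩ hb
    simp [hu, ht] at hb
    have hpos := Nat.one_le_two_pow (n := k)
    simp [hf, hu, ht, hd']
    refine ⟨by omega, ?_, ⟨k + 1, by rw [pow_succ]; omega, by rw [pow_succ]; ring, by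
      rw [pow_succ]; omega⟩, by omega⟩
    refine lt_of_le_of_lt ?_ h2
    calc d * 2 ^ k + d * 2 ^ k = (2 * 2 ^ k) * d := by ring
      _ ≤ 4 * n * d := Nat.mul_le_mul_right _ (by omega)
  · rintro s' ⟨hf, hu, ⟨k, ht, hd', hk⟩, htk⟩ hb
    simp [hu, ht] at hb
    exact ⟨by simpa using hf, ⟨k, by simpa using hd', by omega, hk⟩, by simp; omega⟩

theorem wp_writeOutput {n : ℕ} (hn : s.v .n = n) (h1 : n ≤ base) (h2 : n < cap) (h3 : n + 1 < W) :
    wp W base cap writeOutput s fun s' => s'.v .n = s.v .d ∧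
      (∀ i < n, s'.low i = s.a .pot (i + 1)) ∧ s'.tick ≤ s.tick + 8 * n + 3 := by
  simp only [writeOutput, wp_seq_iff, wp_mov]
  refine wp_loop (fun s' => s'.v .n = n ∧ s'.v .d = s.v .d ∧ s'.a = s.a ∧ s'.v .i ≤ n ∧
      (∀ i < s'.v .i, s'.low i = s.a .pot (i + 1)) ∧ s'.tick ≤ s.tick + 8 * s'.v .i + 1)
    (s.tick + 8 * n + 1) ?_ ?_ ?_ ?_
  · simp [hn]
  · rintro s' ⟨-, -, -, h1, -, h2⟩; omega
  · rintro s' ⟨hn', hd, ha, hi, hl, ht⟩ hb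
    simp [hn'] at hb
    simp [hn', hd, ha]
    and_intros
    any_goals omega
    intro i hi'
    rcases Nat.lt_or_eq_of_le hi' with hlt | rfl
    · rw [upd_of_ne _ _ hlt.ne]; exact hl i hlt
    · simp
  · rintro s' ⟨hn', hd, ha, hi, hl, ht⟩ hb
    simp [hn'] at hb
    obtain hi : s'.v .i = n := by omega
    rw [hi] at hl ht
    exact ⟨by simp [hd], hl, by simp; omega⟩

end

end MinBalance

/-! ### Cycles and min-balanced potentials -/

namespace MinBalance

section

variable {N A : Type*} {G : ArcDigraph N A}

/-- The list `p` of arcs is a walk from `a` to `b`. -/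
def IsWalk (G : ArcDigraph N A) : N → List A → N → Prop
  | a, [], b => a = b
  | a, e :: p, b => G.src e = a ∧ IsWalk G (G.tgt e) p b

theorem IsWalk.exists_suffix {a b x : N} {p : List A} (hp : IsWalk G a p b)
    (hx : x ∈ p.map G.src) : ∃ q, q <:+ p ∧ IsWalk G x q b := by
  induction p generalizing a with
  | nil => simp at hx
  | cons e p ih =>
    rw [List.map_cons, List.mem_cons] at hx
    rcases hx with rfl | hx
    · exact ⟨e :: p, List.suffix_rfl, rfl, hp.2⟩
    · obtain ⟨q, h1, h2⟩ := ih hp.2 hx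
      exact ⟨q, h1.trans (List.suffix_cons e p), h2⟩

/-- A node that can be reached can be reached by a simple path. -/
theorem exists_simple_path {P : A → Prop} {a b : N}
    (h : Relation.ReflTransGen (fun x y => ∃ e, P e ∧ G.src e = x ∧ G.tgt e = y) a b) :
    ∃ p, IsWalk G a p b ∧ (∀ e ∈ p, P e) ∧ (p.map G.src).Nodup ∧ b ∉ p.map G.src := by
  induction h using Relation.ReflTransGen.head_induction_on with
  | refl => exact ⟨[], rfl, by simp, by simp, by simp⟩
  | head hac _ ih =>
    obtain ⟨e, he, rfl, rfl⟩ := hac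
    obtain ⟨p, h1, h2, h3, h4⟩ := ih
    by_cases hb : G.src e = b
    · exact ⟨[], hb, by simp, by simp, by simp⟩
    by_cases hm : G.src e ∈ p.map G.src
    · obtain ⟨q, hq, hw⟩ := h1.exists_suffix hm
      have hs : q.map G.src <:+ p.map G.src := hq.map G.src
      exact ⟨q, hw, fun f hf => h2 f (hq.subset hf), h3.sublist hs.sublist,
        fun hc => h4 (hs.subset hc)⟩
    · refine ⟨e :: p, ⟨rfl, h1⟩, ?_, ?_, ?_⟩
      · intro f hf
        rcases List.mem_cons.1 hf with rfl | hf
        exacts [he, h2 f hf]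
      · rw [List.map_cons, List.nodup_cons]; exact ⟨hm, h3⟩
      · rw [List.map_cons, List.mem_cons, not_or]; exact ⟨fun hc => hb hc.symm, h4⟩

theorem IsWalk.isChain {e : A} {b : N} {p : List A} (hp : IsWalk G (G.tgt e) p b) :
    (e :: p).IsChain (fun e f => G.tgt e = G.src f) ∧
      G.tgt ((e :: p).getLast (List.cons_ne_nil e p)) = b := by
  induction p generalizing e with
  | nil => exact ⟨List.isChain_singleton _, hp⟩
  | cons f p ih =>
    obtain ⟨h1, h2⟩ := ih hp.2
    refine ⟨List.isChain_cons_cons.2 ⟨hp.1.symm, h1⟩, ?_⟩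
    rw [List.getLast_cons (List.cons_ne_nil f p)]
    exact h2

theorem IsWalk.sum_reducedCost (c : A → ℚ) (π : N → ℚ) {a b : N} {p : List A}
    (hp : IsWalk G a p b) :
    (p.map (G.reducedCost c π)).sum = (p.map c).sum + π a - π b := by
  induction p generalizing a with
  | nil => obtain rfl : a = b := hp; simp
  | cons e p ih =>
    rw [List.map_cons, List.sum_cons, List.map_cons, List.sum_cons, ih hp.2, ← hp.1,
      ArcDigraph.reducedCost]
    ring

end

/-- Sufficient condition for a potential to be min-balanced: the reduced cost of every arc is
nonnegative, and at least a fraction of the cost of each arc on some closed walk through it. -/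
theorem isMinBalanced_of_reach {n m : ℕ} {G : ArcDigraph (Fin n) (Fin m)} {c : Fin m → ℚ}
    {π : Fin n → ℚ} {ξ δ : ℚ} (hG : G.StronglyConnected) (hξ : 1 ≤ ξ)
    (hξδ : n ≤ ξ * δ) (h0 : ∀ e, 0 ≤ G.reducedCost c π e)
    (hreach : ∀ e, ∃ M : ℚ, δ * M ≤ G.reducedCost c π e ∧ c e ≤ M ∧
      Relation.ReflTransGen (fun x y => ∃ f, c f ≤ M ∧ G.src f = x ∧ G.tgt f = y)
        (G.tgt e) (G.src e)) (hc : ∀ e, 0 ≤ c e) :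
    G.IsMinBalanced ξ (G.reducedCost c π) := by
  refine ⟨hG, hξ, h0, fun e => ?_⟩
  obtain ⟨M, hM, heM, hr⟩ := hreach e
  obtain ⟨p, h1, h2, h3, h4⟩ := exists_simple_path hr
  obtain ⟨k1, k2⟩ := h1.isChain
  have hnd : ((e :: p).map G.src).Nodup := by
    rw [List.map_cons, List.nodup_cons]; exact ⟨h4, h3⟩
  refine ⟨e :: p, ⟨k1, ⟨List.cons_ne_nil e p, k2⟩, hnd⟩, List.mem_cons_self, fun f hf => ?_⟩
  have hlen : (e :: p).length ≤ n := by
    simpa using hnd.length_le_card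
  have hw : IsWalk G (G.src e) (e :: p) (G.src e) := ⟨rfl, h1⟩
  have hsum := hw.sum_reducedCost c π
  rw [add_sub_cancel_right] at hsum
  have hle : ((e :: p).map c).sum ≤ (e :: p).length • M := by
    have := List.sum_le_card_nsmul ((e :: p).map c) M (by
      intro x hx
      obtain ⟨f, hf, rfl⟩ := List.mem_map.1 hx
      rcases List.mem_cons.1 hf with rfl | hf
      exacts [heM, h2 f hf])
    simpa using this
  have hf1 : G.reducedCost c π f ≤ ((e :: p).map (G.reducedCost c π)).sum :=
    List.single_le_sum (by
      intro x hx
      obtain ⟨g, -, rfl⟩ := List.mem_map.1 hx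
      exact h0 g) _ (List.mem_map_of_mem hf)
  have hM0 : 0 ≤ M := (hc e).trans heM
  calc G.reducedCost c π f ≤ (e :: p).length • M := hf1.trans (hsum.le.trans hle)
    _ ≤ n * M := by
      rw [nsmul_eq_mul]
      exact mul_le_mul_of_nonneg_right (by exact_mod_cast hlen) hM0
    _ ≤ ξ * δ * M := mul_le_mul_of_nonneg_right hξδ hM0
    _ = ξ * (δ * M) := by ring
    _ ≤ ξ * G.reducedCost c π e := mul_le_mul_of_nonneg_left hM (by linarith)

/-- The property of the computed potential `φ`, as a function of blocks. -/
def Balances (S : SortedArcs) (φ : ℕ → ℕ) : Prop :=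
  ∀ i < S.m, ∃ l < S.pw, (i < l → φ (S.tgt i + 1) + S.cost l ≤ φ (S.src i + 1)) ∧
    (l ≤ i → φ (S.tgt i + 1) ≤ φ (S.src i + 1) + (S.n - 1) * S.cost l) ∧
    S.Reach (l + 1) (S.tgt i) (S.src i)

section

variable {n m : ℕ} (G : ArcDigraph (Fin n) (Fin m)) (z : Fin m → ℕ) (e : ℕ → Fin m)

/-- The sorted arcs of a digraph, given an enumeration of the arcs in the order of their costs. -/
def sortedArcs (he : ∀ i j, i ≤ j → z (e i) ≤ z (e j)) (pw : ℕ) (hpw : m ≤ pw) : SortedArcs where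
  n := n
  m := m
  pw := pw
  src i := G.src (e i)
  tgt i := G.tgt (e i)
  cost i := z (e i)
  m_le := hpw
  cost_mono i j h _ := he i j h

variable {G z e} {he : ∀ i j, i ≤ j → z (e i) ≤ z (e j)} {pw : ℕ} {hpw : m ≤ pw}

/-- With the denominator `d * 2 ^ k`, the reduced cost of arc `i` is at least the cost of the arc
`max l i`, which bounds the costs on a closed walk through arc `i`. -/
theorem Balances.isMinBalanced {φ : ℕ → ℕ} (hφ : Balances (sortedArcs G z e he pw hpw) φ)
    (hsurj : ∀ a, ∃ i < m, e i = a) (hn : 2 ≤ n) (hG : G.StronglyConnected) {d k : ℕ} (hd : 0 < d)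
    (h1 : 2 * n ≤ 2 ^ k) (h2 : 2 ^ k < 4 * n) {c : Fin m → ℚ} (hc : ∀ a, c a = (z a : ℚ) / d)
    {π : Fin n → ℚ} (hπ : ∀ v, π v = (φ (v + 1) : ℚ) / ((d * 2 ^ k : ℕ) : ℚ)) :
    G.IsMinBalanced (7 * (n : ℚ) ^ 2) (G.reducedCost c π) := by
  have hdq : (0 : ℚ) < d := by exact_mod_cast hd
  have hkq : (0 : ℚ) < 2 ^ k := by positivity
  have hnq : (2 : ℚ) ≤ n := by exact_mod_cast hn
  have h2q : (2 : ℚ) ^ k < 4 * n := by exact_mod_cast h2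
  have key : ∀ a, ∃ l, z (e l) ≤ 2 ^ k * d * G.reducedCost c π a ∧ z a ≤ z (e l) ∧
      (sortedArcs G z e he pw hpw).Reach (l + 1) (G.tgt a) (G.src a) := by
    intro a
    obtain ⟨i, hi, rfl⟩ := hsurj a
    obtain ⟨l, hl, ha, hb, hr⟩ := hφ i hi
    change i < l → φ (G.tgt (e i) + 1) + z (e l) ≤ φ (G.src (e i) + 1) at ha
    change l ≤ i → φ (G.tgt (e i) + 1) ≤ φ (G.src (e i) + 1) + (n - 1) * z (e l) at hb
    have hred : 2 ^ k * d * G.reducedCost c π (e i) =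
        2 ^ k * z (e i) + φ (G.src (e i) + 1) - φ (G.tgt (e i) + 1) := by
      rw [ArcDigraph.reducedCost, hc, hπ, hπ]
      push_cast
      field_simp
    rw [hred]
    rcases Nat.lt_or_ge i l with hil | hil
    · refine ⟨l, ?_, he _ _ hil.le, hr⟩
      have : (φ (G.tgt (e i) + 1) + z (e l) : ℚ) ≤ φ (G.src (e i) + 1) := by exact_mod_cast ha hil
      have : (0 : ℚ) ≤ 2 ^ k * z (e i) := by positivity
      linarith
    · refine ⟨i, ?_, le_rfl, hr.mono (by omega)⟩
      have h3 : φ (G.tgt (e i) + 1) + z (e i) ≤ φ (G.src (e i) + 1) + 2 ^ k * z (e i) := by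
        calc φ (G.tgt (e i) + 1) + z (e i)
            ≤ φ (G.src (e i) + 1) + (n - 1) * z (e i) + z (e i) :=
              Nat.add_le_add_right ((hb hil).trans (Nat.add_le_add_left
                (Nat.mul_le_mul_left _ (he _ _ hil)) _)) _
          _ = φ (G.src (e i) + 1) + (n - 1 + 1) * z (e i) := by ring
          _ ≤ _ := Nat.add_le_add_left (Nat.mul_le_mul_right _ (by omega)) _
      have h4 : (φ (G.tgt (e i) + 1) + z (e i) : ℚ) ≤ φ (G.src (e i) + 1) + 2 ^ k * z (e i) := by
        exact_mod_cast h3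
      linarith
  have hc0 : ∀ a, 0 ≤ c a := fun a => by rw [hc]; positivity
  refine isMinBalanced_of_reach (δ := 1 / 2 ^ k) hG (by nlinarith) ?_ ?_ ?_ hc0
  · rw [mul_one_div, le_div_iff₀ hkq]; nlinarith
  · intro a
    obtain ⟨l, h, -⟩ := key a
    have h3 : (0 : ℚ) ≤ 2 ^ k * d * G.reducedCost c π a := le_trans (by positivity) h
    exact nonneg_of_mul_nonneg_right h3 (by positivity)
  · intro a
    obtain ⟨l, h, hle, hr⟩ := key a
    refine ⟨z (e l) / d, ?_, ?_, ?_⟩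
    · rw [div_mul_div_comm, one_mul, div_le_iff₀ (by positivity)]
      linarith
    · rw [hc]
      exact div_le_div_of_nonneg_right (by exact_mod_cast hle) hdq.le
    · have : ∀ x y : ℕ, (sortedArcs G z e he pw hpw).Reach (l + 1) x y → ∀ a : Fin n, (a : ℕ) = x →
          ∃ b : Fin n, (b : ℕ) = y ∧ Relation.ReflTransGen (fun x y => ∃ f, c f ≤ z (e l) / d ∧
            G.src f = x ∧ G.tgt f = y) a b := by
        intro x y hxy
        induction hxy with
        | refl => exact fun a ha => ⟨a, ha, .refl⟩
        | tail _ hs ih =>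
          intro a ha
          obtain ⟨b, hb, hab⟩ := ih a ha
          obtain ⟨i, hi, hil, hsrc, htgt⟩ := hs
          refine ⟨G.tgt (e i), htgt, hab.tail ⟨e i, ?_, ?_, rfl⟩⟩
          · rw [hc]
            exact div_le_div_of_nonneg_right (by exact_mod_cast he _ _ (by omega)) hdq.le
          · exact Fin.ext (by rw [hb]; exact hsrc)
      obtain ⟨b, hb, hab⟩ := this _ _ hr _ rfl
      rwa [Fin.ext hb] at hab

theorem StronglyConnected.reach (hG : G.StronglyConnected) (hsurj : ∀ a, ∃ i < m, e i = a)
    (u v : Fin n) : (sortedArcs G z e he pw hpw).Reach pw u v := by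
  refine Relation.ReflTransGen.lift (fun v : Fin n => (v : ℕ)) ?_ u v (hG u v)
  rintro x y ⟨a, rfl, rfl⟩
  obtain ⟨i, hi, rfl⟩ := hsurj a
  exact ⟨i, hi, by omega, rfl, rfl⟩

/-- The invariant between rounds holds for the hierarchy of all nodes and single nodes. -/
theorem ready_of_init (hG : G.StronglyConnected) (hsurj : ∀ a, ∃ i < m, e i = a) (hn : 1 ≤ n)
    {s : AS} (hm : s.v .m = m) (ht : ∀ i < m, s.a .tail i = G.src (e i) + 1)
    (hh : ∀ i < m, s.a .head i = G.tgt (e i) + 1) (hp : ∀ x, s.a .parent x = 0)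
    (hl : ∀ x, s.a .level x = 0) (h0 : s.a .size 0 = n) (h1 : ∀ x, 1 ≤ x → x ≤ n → s.a .size x = 1)
    (h2 : ∀ x, n < x → s.a .size x = 0) (hnn : s.v .nn = n + 1) (hln : s.v .ln = 0) :
    Ready (sortedArcs G z e he pw hpw) pw (Balances (sortedArcs G z e he pw hpw)) s := by
  set S := sortedArcs G z e he pw hpw with hS
  have hSm : S.m = m := rfl
  have hSn : S.n = n := rfl
  have hSp : S.pw = pw := rfl
  have hsize : ∀ M p, ∑ x ∈ Finset.Ico 1 M with s.a .parent x = p, s.a .size x ≤ s.a .size p := by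
    intro M p
    by_cases hp0 : p = 0
    · subst hp0
      rw [h0]
      calc ∑ x ∈ Finset.Ico 1 M with s.a .parent x = 0, s.a .size x
          ≤ ∑ x ∈ Finset.Ico 1 M, s.a .size x :=
            Finset.sum_le_sum_of_subset (Finset.filter_subset _ _)
        _ ≤ ∑ x ∈ Finset.Ico 1 M, if x ∈ Finset.Ico 1 (n + 1) then 1 else 0 := by
            refine Finset.sum_le_sum fun x hx => ?_
            simp only [Finset.mem_Ico] at hx ⊢
            split_ifs with hc
            · rw [h1 x hx.1 (by omega)]
            · rw [h2 x (by omega)]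
        _ ≤ n := by
            rw [← Finset.sum_filter, Finset.sum_const, smul_eq_mul, mul_one]
            calc _ ≤ (Finset.Ico 1 (n + 1)).card :=
                  Finset.card_le_card fun x hx => (Finset.mem_filter.1 hx).2
              _ = n := by simp
    · rw [Finset.filter_false_of_mem (fun x _ => by rw [hp]; exact fun h => hp0 h.symm)]
      simp
  have ht' : ∀ i < m, s.forest.tail i = S.src i + 1 := ht
  have hh' : ∀ i < m, s.forest.head i = S.tgt i + 1 := hh
  have hp' : ∀ x, s.forest.parent x = 0 := hp
  have hl' : ∀ x, s.forest.level x = 0 := hl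
  have hc' : s.forest.count = n + 1 := hnn
  have hsrc : ∀ i, S.src i < n := fun i => (G.src (e i)).2
  have htgt : ∀ i, S.tgt i < n := fun i => (G.tgt (e i)).2
  refine ⟨hm, ⟨?_, ?_, ?_, ?_, ?_, ?_, ?_, ?_, ?_, ?_, ?_, ?_, ?_, ?_⟩, hp 0, hsize, ?_, ?_, ?_⟩
  · intro i hi; rw [ht' i hi]; omega
  · intro i hi; rw [hh' i hi]; omega
  · intro i hi; rw [ht' i hi, hc']; have := hsrc i; omega
  · intro i hi; rw [hh' i hi, hc']; have := htgt i; omega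
  · omega
  · intro x _ _; rw [hp', hc']; omega
  · intro x _ _; rw [hl']; omega
  · intro i _; rw [hp', hp']
  · intro i _; rw [hl', hl']
  · intro i _ hi; rw [hl'] at hi; omega
  · exact fun p => hsize _ p
  · intro x hx
    rw [hc'] at hx
    change s.a .size x ≤ n
    rcases Nat.eq_zero_or_pos x with rfl | hx0
    · rw [h0]
    · rw [h1 x hx0 (by omega)]; omega
  · intro i hi
    rw [hl', zero_add]
    exact StronglyConnected.reach hG hsurj _ _
  · refine ⟨fun a x => a + 1 = x, fun i hi => (ht' i hi).symm, fun i hi => (hh' i hi).symm, ?_⟩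
    intro x _ _ a b ha hb
    obtain rfl : a = b := by omega
    exact .refl
  · intro x hx
    exact h2 x (by omega)
  · intro j hj; omega
  · intro φ hφ
    rw [hln]
    intro i hi
    obtain ⟨l, -, h3, h4, h5, h6⟩ := hφ.arc i hi
    have hsz : s.forest.size (s.forest.head i) = 1 := by
      rw [hh' i hi]
      exact h1 _ (by omega) (htgt i)
    rw [hl', zero_add] at h3
    rw [hsz, one_mul, ht' i hi, hh' i hi] at h4
    rw [hsz, ht' i hi, hh' i hi] at h5
    exact ⟨l, h3, h4, h5, h6⟩

end

end MinBalance

/-! ### The program -/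

namespace MinBalance

/-- The array program that computes the potential. -/
def mainCode : Code :=
  copyInput ;; sortArcs ;; powerOfTwo ;; gatherArcs ;; initBlocks ;; refineAll ;; setPotential ;;
  unrollLog ;; scaleDenominator ;; writeOutput

/-- The initial state of the array program, in which `r` holds the variables and `low` the input. -/
def initAS (r : Reg → ℕ) (low : ℕ → ℕ) : AS where
  v := r
  a _ _ := 0
  low := low
  tick := 0

section

variable {n m : ℕ} {G : ArcDigraph (Fin n) (Fin m)} {z : Fin m → ℕ} {W base cap : ℕ}

theorem wp_mainCode (hG : G.StronglyConnected) (hn2 : 2 ≤ n) (hnm : n ≤ m) {r : Reg → ℕ}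
    {low : ℕ → ℕ} {d : ℕ} (hrn : r .n = n) (hrm : r .m = m) (hrd : r .d = d) (hrl : r .ln = 0)
    (h0 : ∀ i : Fin m, low (3 * i) = G.src i) (h1 : ∀ i : Fin m, low (3 * i + 1) = G.tgt i)
    (h2 : ∀ i : Fin m, low (3 * i + 2) = z i) (hbase : 3 * m ≤ base)
    (hcap : 4 * m * (Nat.clog 2 m + 1) ≤ cap) (hcW : cap < W) (hdW : 4 * n * d < W)
    (hzW : ∀ a, 2 * (n * z a) < W) :
    wp W base cap mainCode (initAS r low) fun s' =>
      ∃ (e : ℕ → Fin m) (he : ∀ i j, i ≤ j → z (e i) ≤ z (e j)) (pw : ℕ) (hpw : m ≤ pw)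
        (φ : ℕ → ℕ) (k : ℕ), (∀ a, ∃ i < m, e i = a) ∧
        Balances (sortedArcs G z e he pw hpw) φ ∧ 2 * n ≤ 2 ^ k ∧ 2 ^ k < 4 * n ∧
        s'.v .n = d * 2 ^ k ∧ (∀ i < n, s'.low i = φ (i + 1)) ∧
        s'.tick ≤ 2000 * (m * Nat.clog 2 m ^ 2) := by
  set L := Nat.clog 2 m with hL
  have hL1 : 1 ≤ L := Nat.clog_pos (by norm_num) (by omega)
  have hmL : m ≤ m * L := Nat.le_mul_of_pos_right _ hL1
  have hcap' : 4 * (m * L) + 4 * m ≤ cap := by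
    calc _ = 4 * m * (L + 1) := by ring
      _ ≤ cap := hcap
  have hpw1 : m ≤ 2 ^ L := Nat.le_pow_clog (by norm_num) m
  have hpw2 : 2 ^ L < 2 * m := two_pow_clog_lt (by omega)
  simp only [mainCode, wp_seq_iff]
  refine wp_mono _ ?_ (wp_copyInput (m := m) (by exact hrm) hbase (by omega) (by omega))
  rintro s1 ⟨f1, q1, t1⟩
  refine wp_mono _ ?_ (wp_sortArcs (m := m) (by rw [f1.v _ (by decide)]; exact hrm) (by omega)
    (by omega) ⟨fun k hk => by rw [(q1 k hk).2.2.2]; exact hk,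
      fun k hk => ⟨k, hk, (q1 k hk).2.2.2⟩⟩)
  rintro s2 ⟨f2, p2, o2, t2⟩
  have hin : ∀ k (hk : k < m), s2.a .inTail k = G.src ⟨k, hk⟩ ∧ s2.a .inHead k = G.tgt ⟨k, hk⟩ ∧
      s2.a .inCost k = z ⟨k, hk⟩ := fun k hk => by
    rw [f2.a .inTail (by decide), f2.a .inHead (by decide), f2.a .inCost (by decide)]
    obtain ⟨a1, a2, a3, -⟩ := q1 k hk
    exact ⟨a1.trans (h0 ⟨k, hk⟩), a2.trans (h1 ⟨k, hk⟩), a3.trans (h2 ⟨k, hk⟩)⟩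
  have hmin : ∀ i, min i (m - 1) < m := fun i => by omega
  let e : ℕ → Fin m := fun i => ⟨s2.a .perm (min i (m - 1)), p2.1 _ (hmin i)⟩
  have ecost : ∀ i, s2.a .inCost (s2.a .perm (min i (m - 1))) = z (e i) := fun i =>
    (hin _ (p2.1 _ (hmin i))).2.2
  have ends : ∀ i < m, s2.a .inTail (s2.a .perm i) = G.src (e i) ∧
      s2.a .inHead (s2.a .perm i) = G.tgt (e i) := fun i hi => by
    have hi' : i = min i (m - 1) := by omega
    have h := hin _ (p2.1 _ (hmin i))
    exact ⟨(congrArg (fun k => s2.a .inTail (s2.a .perm k)) hi').trans h.1,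
      (congrArg (fun k => s2.a .inHead (s2.a .perm k)) hi').trans h.2.1⟩
  have he : ∀ i j, i ≤ j → z (e i) ≤ z (e j) := by
    intro i j hij
    rw [← ecost, ← ecost, f2.a .inCost (by decide)]
    exact o2 _ _ (by omega) (hmin j)
  have hsurj : ∀ a, ∃ i < m, e i = a := by
    intro a
    obtain ⟨k, hk, hka⟩ := p2.2 a a.2
    refine ⟨k, hk, Fin.ext ?_⟩
    have : min k (m - 1) = k := by omega
    change s2.a .perm (min k (m - 1)) = a
    rw [this, hka]
  refine wp_mono _ ?_ (wp_powerOfTwo (m := m)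
    (by rw [f2.v _ (by decide), f1.v _ (by decide)]; exact hrm) (by omega))
  rintro s3 ⟨f3, w3, t3⟩
  have a3 : ∀ k, s3.a k = s2.a k := fun k => f3.a k (by simp)
  refine wp_mono _ ?_ (wp_gatherArcs (m := m)
    (by rw [f3.v _ (by decide), f2.v _ (by decide), f1.v _ (by decide)]; exact hrm) w3 hpw1
    hpw2.le (by omega) (by omega) (by rw [a3]; exact p2.1)
    (fun k hk => by rw [a3, (hin k hk).1]; have := (G.src ⟨k, hk⟩).2; omega)
    (fun k hk => by rw [a3, (hin k hk).2.1]; have := (G.tgt ⟨k, hk⟩).2; omega))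
  rintro s4 ⟨f4, g4, c4, t4⟩
  simp only [a3] at g4 c4
  have v4 : ∀ r', r' ∉ [Reg.i, .j, .t] →
      r' ∉ [Reg.width, .k, .next, .i, .j, .iEnd, .jEnd, .p, .q, .x, .y, .t] → r' ∉ [Reg.pw] →
      r' ∉ [Reg.i, .z, .p, .x, .t] → s4.v r' = r r' := fun r' b1 b2 b3 b4 => by
    rw [f4.v _ b4, f3.v _ b3, f2.v _ b2, f1.v _ b1]; rfl
  refine wp_mono _ ?_ (wp_initBlocks (n := n)
    (by rw [v4 _ (by decide) (by decide) (by decide) (by decide)]; exact hrn) (by omega) (by omega))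
  rintro s5 ⟨f5, nn5, z5, o5, u5, t5⟩
  have v5 : ∀ r', r' ∉ [Reg.i, .j, .t] →
      r' ∉ [Reg.width, .k, .next, .i, .j, .iEnd, .jEnd, .p, .q, .x, .y, .t] → r' ∉ [Reg.pw] →
      r' ∉ [Reg.i, .z, .p, .x, .t] → r' ∉ [Reg.i, .nn] → s5.v r' = r r' :=
    fun r' b1 b2 b3 b4 b5 => by rw [f5.v _ b5, v4 r' b1 b2 b3 b4]
  have z4 : ∀ k, k ∉ [Arr.inTail, .inHead, .inCost, .perm] → k ∉ [Arr.perm, .merged] →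
      k ∉ [Arr.tail, .head, .cost] → ∀ x, s4.a k x = 0 := fun k b1 b2 b3 x => by
    rw [f4.a k b3, a3, f2.a k b2, f1.a k b1]; rfl
  have hready := ready_of_init (he := he) (hpw := hpw1) hG hsurj (by omega) (s := s5)
    (by rw [v5 _ (by decide) (by decide) (by decide) (by decide) (by decide)]; exact hrm)
    (fun i hi => by rw [f5.a _ (by decide), (g4 i hi).1, (ends i hi).1])
    (fun i hi => by rw [f5.a _ (by decide), (g4 i hi).2, (ends i hi).2])
    (fun x => by rw [f5.a _ (by decide), z4 _ (by decide) (by decide) (by decide)])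
    (fun x => by rw [f5.a _ (by decide), z4 _ (by decide) (by decide) (by decide)])
    z5 o5 (fun x hx => by rw [u5 x hx, z4 _ (by decide) (by decide) (by decide)]) nn5
    (by rw [v5 _ (by decide) (by decide) (by decide) (by decide) (by decide)]; exact hrl)
  set S := sortedArcs G z e he (2 ^ L) hpw1 with hS
  have hSm : S.m = m := rfl
  have hSn : S.n = n := rfl
  have hSp : S.pw = 2 ^ L := rfl
  have hSc : ∀ i, S.cost i = z (e i) := fun _ => rfl
  have l5 : s5.v .ln = 0 := by
    rw [v5 _ (by decide) (by decide) (by decide) (by decide) (by decide)]; exact hrl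
  have e2mL : 2 * m * L = 2 * (m * L) := by ring
  refine wp_mono _ ?_ (wp_refineAll (L := L)
    (by rw [f5.v _ (by decide), f4.v _ (by decide), w3]) hSp hready (by rw [hSm, e2mL]; omega) l5
    (by rw [hSm]; omega) hcW (by rw [hSn]; omega) (by omega))
  rintro s6 ⟨p6, f6, n6, l6, t6⟩
  rw [hSm, e2mL] at n6 l6
  rw [hSm] at t6
  have hW : 2 * (S.n * S.cost (S.pw - 1)) < W := hzW _
  have hcost : ∀ i < S.pw, s6.a .cost i = S.cost i := fun i hi => by
    rw [f6.a _ (by decide), f5.a _ (by decide), c4 i hi, ecost]; rfl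
  have hsum : ∀ p, s6.a .sum p = 0 := fun p => by
    rw [f6.a _ (by decide), f5.a _ (by decide), z4 _ (by decide) (by decide) (by decide)]
  refine wp_mono _ ?_ (wp_setPotential (R := L + 1) p6 (by omega) hcW (by rw [hSp]; omega)
    (by rw [hSn, pow_succ]; omega) (by rw [hSn]; omega) hW hsum hcost)
  rintro s7 ⟨f7, b7, t7⟩
  have hgood := p6.hierarchy.good_basePotential b7
  have hlog := p6.log _ hgood
  refine wp_mono _ ?_ (wp_unrollLog (Q := Balances S) (B := S.n * S.cost (S.pw - 1)) ?_ ?_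
    (by omega)
    (by rw [f7.a .logChild (by decide), f7.a .logParent (by decide), f7.v .ln (by decide)]
        exact hlog))
  swap
  · rw [f7.a .logChild (by decide), f7.a .logParent (by decide), f7.v .ln (by decide)]
    intro j hj
    have := p6.log_le j hj
    omega
  swap
  · rw [f7.v .ln (by decide)]; omega
  rintro s8 ⟨f8, b8, t8⟩
  refine wp_mono _ ?_ (wp_scaleDenominator (n := n) (d := d)
    (by rw [f8.v _ (by decide), f7.v _ (by decide), f6.v _ (by decide), v5 _ (by decide)
          (by decide) (by decide) (by decide) (by decide)]; exact hrn) (by omega)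
    (by rw [f8.v _ (by decide), f7.v _ (by decide), f6.v _ (by decide), v5 _ (by decide)
          (by decide) (by decide) (by decide) (by decide)]; exact hrd) (by omega) hdW)
  rintro s9 ⟨f9, ⟨k, d9, k1, k2⟩, t9⟩
  refine wp_mono _ ?_ (wp_writeOutput (n := n)
    (by rw [f9.v _ (by decide), f8.v _ (by decide), f7.v _ (by decide), f6.v _ (by decide),
          v5 _ (by decide) (by decide) (by decide) (by decide) (by decide)]; exact hrn) (by omega)
    (by omega) (by omega))
  rintro s10 ⟨n10, b10, t10⟩
  refine ⟨e, he, _, hpw1, s8.a .pot, k, hsurj, b8, k1, k2, by rw [n10, d9], ?_, ?_⟩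
  · intro i hi
    rw [b10 i hi, f9.a _ (by decide)]
  · have t0 : (initAS r low).tick = 0 := rfl
    rw [t0] at t1
    have l7 : s7.v .ln = s6.v .ln := f7.v _ (by decide)
    have x1 : m * L ≤ m * L ^ 2 := by
      rw [pow_two]; exact Nat.mul_le_mul_left _ (Nat.le_mul_of_pos_right _ hL1)
    have x2 : L ≤ m * L := Nat.le_mul_of_pos_left _ (by omega)
    have x3 : (7 * (L + 1) + 34) * s6.v .nn ≤ (48 * L) * (4 * (m * L)) :=
      Nat.mul_le_mul (by omega) (by omega)
    have x4 : (48 * L) * (4 * (m * L)) = 192 * (m * L ^ 2) := by ring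
    have x5 : (60 * m + 10) * L = 60 * (m * L) + 10 * L := by ring
    have x6 : (1010 * m + 22) * L = 1010 * (m * L) + 22 * L := by ring
    rw [← hL] at t2
    omega

end

end MinBalance

namespace MinBalance

open WordRAM

/-- The word RAM program: the arrays are placed above the first `4 * m` cells. -/
def mainProgram : Program :=
  .seq (.binary 61 .add (.reg 1) (.reg 1))
    (.seq (.binary 61 .add (.reg 61) (.reg 61)) mainCode.compile)

section

variable {n m : ℕ} {G : ArcDigraph (Fin n) (Fin m)}

/-- Every node of a strongly connected digraph has an outgoing arc. -/
theorem nodes_le_arcs (hG : G.StronglyConnected) (hn : 2 ≤ n) : n ≤ m := by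
  have : ∀ v : Fin n, ∃ e, G.src e = v := by
    intro v
    obtain ⟨u, hu⟩ : ∃ u : Fin n, u ≠ v := by
      have : Nontrivial (Fin n) := Fin.nontrivial_iff_two_le.2 hn
      exact exists_ne v
    rcases (hG v u).cases_head with h | ⟨x, ⟨e, he, -⟩, -⟩
    · exact absurd h.symm hu
    · exact ⟨e, he⟩
  choose f hf using this
  have hinj : Function.Injective f := fun a b h => by rw [← hf a, ← hf b, h]
  simpa using Fintype.card_le_of_injective f hinj

theorem arcs_le_sq (G : ArcDigraph (Fin n) (Fin m)) : m ≤ n ^ 2 := by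
  have hinj : Function.Injective fun e => (G.src e, G.tgt e) := fun a b h => by
    simp only [Prod.mk.injEq] at h
    exact G.simple a b h.1 h.2
  have := Fintype.card_le_of_injective _ hinj
  simpa [pow_two] using this

theorem clog_le_logb (hn : 2 ≤ n) (h2 : m ≤ n ^ 2) :
    (Nat.clog 2 m : ℝ) ≤ 3 * Real.logb 2 n := by
  have hlog : 1 ≤ Real.logb 2 n := by
    rw [Real.le_logb_iff_rpow_le (by norm_num) (by positivity)]
    simpa using hn
  rcases Nat.eq_zero_or_pos (Nat.clog 2 m) with h0 | h0
  · rw [h0]; simp; linarith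
  · obtain ⟨r, hr⟩ := Nat.exists_eq_succ_of_ne_zero h0.ne'
    have hlt : 2 ^ r < m :=
      (Nat.lt_clog_iff_pow_lt (b := 2) (by norm_num)).1 (show r < Nat.clog 2 m by omega)
    have h3 : (r : ℝ) ≤ Real.logb 2 ((n : ℝ) ^ 2) := by
      rw [Real.le_logb_iff_rpow_le (by norm_num) (by positivity), Real.rpow_natCast]
      exact_mod_cast (hlt.le.trans h2)
    rw [Real.logb_pow] at h3
    rw [hr]
    push_cast at h3 ⊢
    linarith

end

end MinBalance

/-- One fixed word RAM program finds, for every strongly connected simple digraph with `n ≥ 2` nodes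
and `m` arcs and all positive rational costs `c e = z e / d`, a potential `π` for which the
reduced cost is `7 n²`-min-balanced, in time `O(m log² n)`, on every word length that leaves room for
the input numbers times a fixed power of `n`. The constant in the running time depends neither on the
graph, nor on the costs, nor on the word length. -/
theorem lemma3 :
    ∃ (P : WordRAM.Program) (K κ : ℕ),
      ∀ (n m : ℕ) (G : ArcDigraph (Fin n) (Fin m)) (c : Fin m → ℚ),
        2 ≤ n → G.StronglyConnected → (∀ e, 0 < c e) →
        ∀ (d : ℕ) (z : Fin m → ℕ), 0 < d → (∀ e, c e = (z e : ℚ) / (d : ℚ)) →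
        ∀ w : ℕ, n ^ κ * d ≤ 2 ^ w → (∀ e, n ^ κ * z e ≤ 2 ^ w) →
          ∃ (s : WordRAM.State w) (t : ℕ) (π : Fin n → ℚ),
            WordRAM.Runs P (WordRAM.inputState w G d z) s t ∧
            (t : ℝ) ≤ K * (m * Real.logb 2 n ^ 2) ∧
            WordRAM.HoldsPotential s π ∧
            G.IsMinBalanced (7 * (n : ℚ) ^ 2) (G.reducedCost c π) := by
  open MinBalance WordRAM in
  -- As `m ≤ n ^ 2`, the arrays occupy `O(m ^ 2) = O(n ^ 4)` cells; the exponent `16` leaves room for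
  -- the constant, since `2 ^ 12 ≤ n ^ 12`.
  refine ⟨mainProgram, 20000, 16, ?_⟩
  intro n m G c hn hG hc0 d z hd hc w hw1 hw2
  have hnm := nodes_le_arcs hG hn
  have hmn := arcs_le_sq G
  set L := Nat.clog 2 m with hL
  have hLm : L ≤ m := (Nat.clog_le_iff_le_pow (by norm_num)).2 Nat.lt_two_pow_self.le
  have hL1 : 1 ≤ L := Nat.clog_pos (by norm_num) (by omega)
  have hdq : (0 : ℚ) < d := by exact_mod_cast hd
  have hz0 : ∀ a, 0 < z a := by
    intro a
    rcases Nat.eq_zero_or_pos (z a) with h | h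
    · have := hc0 a
      rw [hc, h] at this
      simp at this
    · exact h
  -- The word length leaves room for the arrays and for the numbers.
  have hpow : ∀ k, 2 ^ k ≤ n ^ k := fun k => Nat.pow_le_pow_left hn k
  have hW : n ^ 16 ≤ 2 ^ w := (Nat.le_mul_of_pos_right _ hd).trans hw1
  have hroom : 4 * m + 32 * (4 * m * (L + 1)) < 2 ^ w := by
    refine lt_of_lt_of_le ?_ hW
    have h1 : m * m ≤ n ^ 4 := by
      calc m * m ≤ n ^ 2 * n ^ 2 := Nat.mul_le_mul hmn hmn
        _ = n ^ 4 := by ring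
    have h2 : m * L ≤ m * m := Nat.mul_le_mul_left _ hLm
    have h3 : m ≤ m * m := Nat.le_mul_of_pos_left _ (by omega)
    have h4 : 4 * m + 32 * (4 * m * (L + 1)) = 132 * m + 128 * (m * L) := by ring
    have h5 : 2 ^ 12 * n ^ 4 ≤ n ^ 16 := by
      calc 2 ^ 12 * n ^ 4 ≤ n ^ 12 * n ^ 4 := Nat.mul_le_mul_right _ (hpow 12)
        _ = n ^ 16 := by ring
    omega
  have hbig : ∀ x, 0 < x → n ^ 16 * x ≤ 2 ^ w → 4 * n * x < 2 ^ w := by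
    intro x hx h
    refine lt_of_lt_of_le ?_ h
    refine Nat.mul_lt_mul_of_pos_right ?_ hx
    calc 4 * n < 2 ^ 3 * n := by omega
      _ ≤ n ^ 15 * n := Nat.mul_le_mul_right _
          ((Nat.pow_le_pow_left hn 3).trans (Nat.pow_le_pow_right (by omega) (by norm_num)))
      _ = n ^ 16 := by ring
  have hdw := hbig d hd hw1
  have hzw : ∀ a, 2 * (n * z a) < 2 ^ w := fun a => by
    have := hbig (z a) (hz0 a) (hw2 a)
    rw [mul_assoc] at this
    omega
  have hzw' : ∀ a, z a < 2 ^ w := fun a => by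
    have := Nat.le_mul_of_pos_left (z a) (show 0 < n by omega)
    have := hzw a
    omega
  have hdw' : d < 2 ^ w := by
    have := Nat.le_mul_of_pos_left d (show 0 < 4 * n by omega)
    omega
  have hm1 : m ≤ m * (L + 1) := Nat.le_mul_of_pos_right _ (by omega)
  have hcapm : 4 * m * (L + 1) = 4 * (m * (L + 1)) := by ring
  -- The state after the computation of the base address.
  set σ₀ := inputState w G d z with hσ₀
  have hr0 : (σ₀.reg 0).toNat = n := Nat.mod_eq_of_lt (by omega)
  have hr1 : (σ₀.reg 1).toNat = m := Nat.mod_eq_of_lt (by omega)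
  have hr2 : (σ₀.reg 2).toNat = d := Nat.mod_eq_of_lt hdw'
  set σ₁ := σ₀.setReg 61 (σ₀.reg 1 + σ₀.reg 1) with hσ₁
  set σ₂ := σ₁.setReg 61 (σ₁.reg 61 + σ₁.reg 61) with hσ₂
  have hreg : ∀ k, k ≠ 61 → σ₂.reg k = σ₀.reg k := fun k hk => by
    simp [hσ₂, hσ₁, State.setReg, Function.update_of_ne hk]
  have hmem : σ₂.mem = σ₀.mem := rfl
  have hbase : (σ₂.reg 61).toNat = 4 * m := by
    simp only [hσ₂, hσ₁, State.setReg, Function.update_self, BitVec.toNat_add, hr1]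
    rw [Nat.mod_eq_of_lt (show m + m < 2 ^ w by omega), Nat.mod_eq_of_lt (by omega)]
    ring
  have hcell : ∀ i k, k < 3 → (hi : i < m) → (σ₀.mem (BitVec.ofNat w (3 * i + k))).toNat =
      if k = 0 then (G.src ⟨i, hi⟩ : ℕ) else if k = 1 then (G.tgt ⟨i, hi⟩ : ℕ) else z ⟨i, hi⟩ := by
    intro i k hk hi
    have h1 : (BitVec.ofNat w (3 * i + k)).toNat = 3 * i + k := Nat.mod_eq_of_lt (by omega)
    have h2 : (3 * i + k) / 3 = i := by omega
    have h3 : (3 * i + k) % 3 = k := by omega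
    have hs := (G.src ⟨i, hi⟩).2
    have ht := (G.tgt ⟨i, hi⟩).2
    simp only [hσ₀, inputState, h1, h2, h3, hi, dite_true]
    interval_cases k
    · exact Nat.mod_eq_of_lt (by omega)
    · exact Nat.mod_eq_of_lt (by omega)
    · exact Nat.mod_eq_of_lt (hzw' _)
  have hrep : Rep (4 * m) (4 * m * (L + 1)) (initAS (fun r => (σ₂.reg r.code).toNat)
      (fun i => (σ₂.mem (BitVec.ofNat w i)).toNat)) σ₂ := by
    refine ⟨fun _ => rfl, hbase, fun _ _ => rfl, fun k j hj => ?_⟩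
    have hk := k.code_lt
    have h1 : (BitVec.ofNat w (4 * m + 32 * j + k.code)).toNat = 4 * m + 32 * j + k.code :=
      Nat.mod_eq_of_lt (by omega)
    have h2 : ¬ (4 * m + 32 * j + k.code) / 3 < m := by omega
    simp only [hmem, hσ₀, inputState, h1, h2, dite_false]
    rfl
  have hwp := wp_mainCode (G := G) (z := z) (W := 2 ^ w) (base := 4 * m)
    (cap := 4 * m * (L + 1)) hG hn hnm (r := fun r => (σ₂.reg r.code).toNat)
    (low := fun i => (σ₂.mem (BitVec.ofNat w i)).toNat) (d := d)
    ((congrArg BitVec.toNat (hreg 0 (by norm_num))).trans hr0)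
    ((congrArg BitVec.toNat (hreg 1 (by norm_num))).trans hr1)
    ((congrArg BitVec.toNat (hreg 2 (by norm_num))).trans hr2)
    (by
      change (σ₂.reg 26).toNat = 0
      rw [hreg 26 (by norm_num)]
      rfl)
    (fun i => by simpa [hmem] using hcell i 0 (by norm_num) i.2)
    (fun i => by simpa [hmem] using hcell i 1 (by norm_num) i.2)
    (fun i => by simpa [hmem] using hcell i 2 (by norm_num) i.2)
    (by omega) le_rfl (by omega) hdw hzw
  obtain ⟨s, σ, t, hrun, hrep', htick, e, he, pw, hpw, φ, k, hsurj, hφ, hk1, hk2, hsn, hlow,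
    hst⟩ := runs_of_wp hroom.le (by
      have := hpow 16
      omega) mainCode rfl hrep hwp
  have hregn : (σ.reg 0).toNat = d * 2 ^ k := (hrep'.reg_eq .n).trans hsn
  refine ⟨σ, 1 + (1 + t), fun v => ((σ.mem (BitVec.ofNat w v)).toNat : ℚ) / ((σ.reg 0).toNat : ℚ),
    .seq (.binary ..) (.seq (.binary ..) hrun), ?_, ⟨?_, fun v => rfl⟩, ?_⟩
  · have ht : 1 + (1 + t) ≤ 2002 * (m * L ^ 2) := by
      have : 1 ≤ m * L ^ 2 := Nat.mul_pos (by omega) (pow_pos hL1 2)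
      rw [← hL] at hst
      simp only [initAS] at htick
      omega
    have hlog := clog_le_logb hn hmn
    rw [← hL] at hlog
    calc ((1 + (1 + t) : ℕ) : ℝ) ≤ ((2002 * (m * L ^ 2) : ℕ) : ℝ) := by exact_mod_cast ht
      _ = 2002 * (m * (L : ℝ) ^ 2) := by push_cast; ring
      _ ≤ 2002 * (m * (3 * Real.logb 2 n) ^ 2) := by gcongr
      _ = 18018 * (m * Real.logb 2 n ^ 2) := by ring
      _ ≤ (20000 : ℕ) * (m * Real.logb 2 n ^ 2) := by
        refine mul_le_mul_of_nonneg_right (by norm_num) (by positivity)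
  · rw [hregn]; positivity
  · refine hφ.isMinBalanced hsurj hn hG hd hk1 hk2 hc fun v => ?_
    rw [hregn, hrep'.low_eq v (by omega), hlow v v.2]
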